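/- \textbf{Setting.} Let a set of atoms be given, with a negation $a\mapsto\bar a$ that is an involution with $\bar a\neq a$ for every atom $a$. Formulae are freely built from the units $\mathsf f$ (false) and $\mathsf t$ (true) and the atoms by disjunction $[\alpha\vee\beta]$ and conjunction $(\alpha\wedge\beta)$. A context $\xi\{\ \}$ is a formula with one hole. System $\mathsf{SKS}$ has the following rules, written premiss $\to$ conclusion, where $a$ is any atom and $\alpha,\beta,\gamma,\delta$ are any formulae: identity $\mathsf t\to[a\vee\bar a]$; weakening $\mathsf f\to a$; contraction $[a\vee a]\to a$; cut $(a\wedge\bar a)\to\mathsf f$; coweakening $a\to\mathsf t$; cocontraction $a\to(a\wedge a)$; switch $(\alpha\wedge[\beta\vee\gamma])\to[(\alpha\wedge\beta)\vee\gamma]$; medial $[(\alpha\wedge\beta)\vee(\gamma\wedge\delta)]\to([\alpha\vee\gamma]\wedge[\beta\vee\delta])$; and the rule $=$, which replaces one side of any of the following equations by the other, in either direction: commutativity and associativity of $\vee$ and of $\wedge$, $[\alpha\vee\mathsf f]=\alpha$, $(\alpha\wedge\mathsf t)=\alpha$, $[\mathsf t\vee\mathsf t]=\mathsf t$, $(\mathsf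 f\wedge\mathsf f)=\mathsf f$. An inference step leads from $\xi\{\gamma\}$ to $\xi\{\delta\}$, where $\xi\{\ \}$ is any context and $\gamma\to\delta$ an instance of a rule. A derivation is a finite chain of inference steps; a proof of $\alpha$ is a derivation with premiss $\mathsf t$ and conclusion $\alpha$. The size of a derivation is the number of occurrences of units and atoms in the formulae of the chain. Analytic $\mathsf{SKS}$, written $\mathsf{aSKS}$, is $\mathsf{SKS}$ without the rules cut and coweakening. A function $q\colon\mathbb N\to\mathbb N$ is quasipolynomial if, for some constant $c$, $q(n)\le 2^{c(\lfloor\log_2 n\rfloor+1)^c}$ for all $n\ge1$. Algorithms are programs of a first-order Lisp-like language with recursion, on binary trees whose leaves are $\mathsf{nil}$ or atoms; atoms can only be moved, recognised, compared and negated; each evaluation step costs the size (number of nodes) of the tree on which it acts. Derivations are given to programs, and returned by them, as trees that list the premiss and, for each step, its context, its rule and the premiss and conclusion of the rule instance. \textbf{Theorem.} There are an algorithm and a quasipolynomial function $q$ such that, for every set of atoms, every formula $\alpha$ and every proof $\Pi$ of $\alpha$ in $\mathsf{SKS}$, the algorithm on input $\Pi$ constructs a proof of $\alpha$ in $\mathsf{aSKS}$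 in time at most $q(|\Pi|)$, where $|\Pi|$ is the size of $\Pi$. -/

import Mathlib

universe u

namespace DeepInference

/-! ### Formulae, contexts and inference rules -/

/-- A set of atoms: it carries an involution, negation, that sends no atom to itself. -/
class Atoms (A : Type u) where
  dual : A → A
  dual_dual : ∀ a, dual (dual a) = a
  dual_ne : ∀ a, dual a ≠ a

/-- Formulae, freely built from the units, the atoms, disjunction and conjunction. -/
inductive Formula (A : Type u) : Type u
  | ff : Formula A
  | tt : Formula A
  | atom (a : A) : Formula A
  | or (α β : Formula A) : Formula A
  | and (α β : Formula A) : Formula A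

/-- Formulae with exactly one hole. -/
inductive Context (A : Type u) : Type u
  | hole : Context A
  | orLeft (ξ : Context A) (β : Formula A) : Context A
  | orRight (α : Formula A) (ξ : Context A) : Context A
  | andLeft (ξ : Context A) (β : Formula A) : Context A
  | andRight (α : Formula A) (ξ : Context A) : Context A

/-- The names of the rules: identity, weakening, contraction (`down`), cut, coweakening,
cocontraction (`up`), switch, medial, and the rule `=`. -/
inductive Rule : Type
  | aiDown | awDown | acDown | aiUp | awUp | acUp | switch | medial | equal

variable {A : Type u}

/-- The number of unit and atom occurrences in a formula. -/
def Formula.size : Formula A → ℕ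
  | .ff => 1
  | .tt => 1
  | .atom _ => 1
  | .or α β => α.size + β.size
  | .and α β => α.size + β.size

/-- `ξ.fill γ` is the formula `ξ{γ}`. -/
def Context.fill : Context A → Formula A → Formula A
  | .hole, γ => γ
  | .orLeft ξ β, γ => .or (ξ.fill γ) β
  | .orRight α ξ, γ => .or α (ξ.fill γ)
  | .andLeft ξ β, γ => .and (ξ.fill γ) β
  | .andRight α ξ, γ => .and α (ξ.fill γ)

open Formula in
/-- The equations that generate the rule `=`, read from left to right. -/
inductive Equation : Formula A → Formula A → Prop
  | orComm (α β : Formula A) : Equation (or α β) (or β α)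
  | andComm (α β : Formula A) : Equation (and α β) (and β α)
  | orAssoc (α β γ : Formula A) : Equation (or (or α β) γ) (or α (or β γ))
  | andAssoc (α β γ : Formula A) : Equation (and (and α β) γ) (and α (and β γ))
  | orFalse (α : Formula A) : Equation (or α ff) α
  | andTrue (α : Formula A) : Equation (and α tt) α
  | orTrue : Equation (or tt tt) tt
  | andFalse : Equation (and ff ff) ff

open Formula in
/-- `Instance ρ γ δ`: there is an instance of the rule `ρ` with premiss `γ` and conclusion `δ`. -/
inductive Instance [Atoms A] : Rule → Formula A → Formula A → Prop
  | aiDown (a : A) : Instance .aiDown tt (or (atom a) (atom (Atoms.dual a)))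
  | awDown (a : A) : Instance .awDown ff (atom a)
  | acDown (a : A) : Instance .acDown (or (atom a) (atom a)) (atom a)
  | aiUp (a : A) : Instance .aiUp (and (atom a) (atom (Atoms.dual a))) ff
  | awUp (a : A) : Instance .awUp (atom a) tt
  | acUp (a : A) : Instance .acUp (atom a) (and (atom a) (atom a))
  | switch (α β γ : Formula A) : Instance .switch (and α (or β γ)) (or (and α β) γ)
  | medial (α β γ δ : Formula A) :
      Instance .medial (or (and α β) (and γ δ)) (and (or α γ) (or β δ))
  | equal {γ δ : Formula A} (h : Equation γ δ) : Instance .equal γ δ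
  | equalSymm {γ δ : Formula A} (h : Equation γ δ) : Instance .equal δ γ

/-! ### Derivations and proofs -/

/-- The data of one inference step, from `context{upper}` to `context{lower}` by `rule`. -/
structure Step (A : Type u) : Type u where
  context : Context A
  rule : Rule
  upper : Formula A
  lower : Formula A

def Step.premiss (s : Step A) : Formula A := s.context.fill s.upper

def Step.conclusion (s : Step A) : Formula A := s.context.fill s.lower

/-- The data of a derivation: the premiss, and the inference steps from top to bottom. -/
structure Derivation (A : Type u) : Type u where
  premiss : Formula A
  steps : List (Step A)

/-- The listed steps form a chain of inference steps, with rules from `S`, from `α` to `β`. -/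
def IsChain [Atoms A] (S : Set Rule) : Formula A → List (Step A) → Formula A → Prop
  | α, [], β => α = β
  | α, s :: L, β =>
      s.rule ∈ S ∧ Instance s.rule s.upper s.lower ∧ s.premiss = α ∧ IsChain S s.conclusion L β

/-- `Φ` is a derivation from `α` to `β` in the system `S`. -/
def IsDerivation [Atoms A] (S : Set Rule) (α β : Formula A) (Φ : Derivation A) : Prop :=
  Φ.premiss = α ∧ IsChain S α Φ.steps β

/-- `P` is a proof of `α` in the system `S`. -/
def IsProof [Atoms A] (S : Set Rule) (α : Formula A) (P : Derivation A) : Prop :=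
  IsDerivation S .tt α P

/-- The number of unit and atom occurrences in a derivation, that is, in the chain of formulae
that consists of its premiss and of the conclusions of its steps. -/
def Derivation.size (Φ : Derivation A) : ℕ :=
  Φ.premiss.size + (Φ.steps.map fun s => s.conclusion.size).sum

/-- System `SKS`; the rule `=` belongs to every system. -/
def SKS : Set Rule := Set.univ

/-- Analytic `SKS`: no cut and no coweakening. -/
def aSKS : Set Rule := SKS \ {.aiUp, .awUp}

/-! ### Algorithms and their running time

Algorithms are programs of a small first-order Lisp: they work on binary trees whose leaves are
`nil` or atoms, and have unrestricted recursion. Atoms are opaque to a program, which can only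
compare and negate them; an atom has size one, as it has in the size of a formula. Each operation
is charged the full size of the tree on which it acts, so that the costs agree with those of
Turing machines up to a polynomial (and up to the length of the names of the atoms). -/

/-- The data of programs: binary trees with leaves `nil` and atoms. -/
inductive Tree (A : Type u) : Type u
  | nil : Tree A
  | atom (a : A) : Tree A
  | pair (x y : Tree A) : Tree A

/-- The number of nodes of a tree, leaves included. -/
def Tree.size : Tree A → ℕ
  | .nil => 1
  | .atom _ => 1
  | .pair x y => x.size + y.size + 1

/-- A tree that stands for "true"; `nil` stands for "false". -/
def Tree.true : Tree A := .pair .nil .nil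

/-- The primitive operations. -/
inductive Op : Type
  | const | id | head | tail | isAtom | eq | dual

open Classical in
/-- The effect of the primitive operations; `eq` compares the two components of a pair, and
`isAtom` keeps atoms and turns all other trees into `nil`. -/
noncomputable def Op.eval [Atoms A] : Op → Tree A → Tree A
  | .const, _ => .nil
  | .id, x => x
  | .head, .pair x _ => x
  | .tail, .pair _ y => y
  | .isAtom, .atom a => .atom a
  | .eq, .pair x y => if x = y then .true else .nil
  | .dual, .atom a => .atom (Atoms.dual a)
  | _, _ => .nil

/-- Programs, each of which acts on one tree and returns one tree. `comp p q` runs `q` and then `p`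
on the result, `pair p q` runs both on the input and pairs the results, `cond b p q` runs `p` if
`b` returns a tree other than `nil`, and else `q`. `fix p` is the recursive procedure with body `p`;
`call` inside `p` is its recursive call. -/
inductive Prog : Type
  | op (o : Op) : Prog
  | comp (p q : Prog) : Prog
  | pair (p q : Prog) : Prog
  | cond (b p q : Prog) : Prog
  | fix (p : Prog) : Prog
  | call : Prog

/-- `Runs r p x y t`: inside a recursive procedure with body `r`, the program `p` halts on `x` with
output `y` after time `t`. -/
inductive Runs [Atoms A] : Prog → Prog → Tree A → Tree A → ℕ → Prop
  | op (r : Prog) (o : Op) (x : Tree A) : Runs r (.op o) x (o.eval x) x.size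
  | comp {r p q : Prog} {x y z : Tree A} {s t : ℕ} :
      Runs r q x y s → Runs r p y z t → Runs r (.comp p q) x z (s + t + x.size)
  | pair {r p q : Prog} {x y z : Tree A} {s t : ℕ} :
      Runs r p x y s → Runs r q x z t → Runs r (.pair p q) x (.pair y z) (s + t + x.size)
  | condTrue {r b p q : Prog} {x y z : Tree A} {s t : ℕ} :
      Runs r b x y s → y ≠ .nil → Runs r p x z t → Runs r (.cond b p q) x z (s + t + x.size)
  | condFalse {r b p q : Prog} {x z : Tree A} {s t : ℕ} :
      Runs r b x .nil s → Runs r q x z t → Runs r (.cond b p q) x z (s + t + x.size)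
  | fix {r p : Prog} {x y : Tree A} {t : ℕ} :
      Runs p p x y t → Runs r (.fix p) x y (t + x.size)
  | call {r : Prog} {x y : Tree A} {t : ℕ} :
      Runs r r x y t → Runs r .call x y (t + x.size)

/-- The program `p`, as a recursive procedure, halts on `x` with output `y` after time `t`. -/
def Prog.HaltsWith [Atoms A] (p : Prog) (x y : Tree A) (t : ℕ) : Prop := Runs p p x y t

/-- Output and running time are determined by the program and the input. -/
theorem Runs.deterministic [Atoms A] {r p : Prog} {x y : Tree A} {t : ℕ} (h : Runs r p x y t) :
    ∀ {y' : Tree A} {t' : ℕ}, Runs r p x y' t' → y = y' ∧ t = t' := by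
  induction h with
  | op => intro y' t' h'; cases h'; exact ⟨rfl, rfl⟩
  | comp _ _ ih₁ ih₂ =>
    intro y' t' h'; cases h' with
    | comp h₁ h₂ =>
      obtain ⟨rfl, rfl⟩ := ih₁ h₁
      obtain ⟨rfl, rfl⟩ := ih₂ h₂
      exact ⟨rfl, rfl⟩
  | pair _ _ ih₁ ih₂ =>
    intro y' t' h'; cases h' with
    | pair h₁ h₂ =>
      obtain ⟨rfl, rfl⟩ := ih₁ h₁
      obtain ⟨rfl, rfl⟩ := ih₂ h₂
      exact ⟨rfl, rfl⟩
  | condTrue _ hy _ ih₁ ih₂ =>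
    intro y' t' h'; cases h' with
    | condTrue h₁ _ h₂ =>
      obtain ⟨rfl, rfl⟩ := ih₁ h₁
      obtain ⟨rfl, rfl⟩ := ih₂ h₂
      exact ⟨rfl, rfl⟩
    | condFalse h₁ _ => exact absurd (ih₁ h₁).1 hy
  | condFalse _ _ ih₁ ih₂ =>
    intro y' t' h'; cases h' with
    | condTrue h₁ hy _ => exact absurd (ih₁ h₁).1.symm hy
    | condFalse h₁ h₂ =>
      obtain ⟨_, rfl⟩ := ih₁ h₁
      obtain ⟨rfl, rfl⟩ := ih₂ h₂
      exact ⟨rfl, rfl⟩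
  | fix _ ih =>
    intro y' t' h'; cases h' with
    | fix h₁ => obtain ⟨rfl, rfl⟩ := ih h₁; exact ⟨rfl, rfl⟩
  | call _ ih =>
    intro y' t' h'; cases h' with
    | call h₁ => obtain ⟨rfl, rfl⟩ := ih h₁; exact ⟨rfl, rfl⟩

theorem Tree.size_pos (x : Tree A) : 0 < x.size := by
  cases x <;> simp [Tree.size]

theorem Op.size_eval_le [Atoms A] (o : Op) (x : Tree A) : (o.eval x).size ≤ x.size := by
  cases x with
  | pair x y =>
    have hx := x.size_pos
    have hy := y.size_pos
    cases o <;> simp only [Op.eval, Tree.size] <;> try omega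
    split <;> simp only [Tree.true, Tree.size] <;> omega
  | _ => cases o <;> simp [Op.eval, Tree.size]

/-- The running time bounds the size of the output. -/
theorem Runs.size_le [Atoms A] {r p : Prog} {x y : Tree A} {t : ℕ} (h : Runs r p x y t) :
    y.size ≤ t := by
  induction h with
  | op r o x => exact o.size_eval_le x
  | @pair r p q x y z s t _ _ ih₁ ih₂ =>
    have := x.size_pos
    simp only [Tree.size]
    omega
  | _ => omega

/-! ### Derivations as input and output of programs -/

/-- A natural number as a tree; used as a tag. -/
def Tree.num : ℕ → Tree A
  | 0 => .nil
  | n + 1 => .pair .nil (Tree.num n)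

/-- A tag together with a tuple of components. -/
def Tree.tagged (n : ℕ) (x : Tree A) : Tree A := .pair (.num n) x

def Formula.encode : Formula A → Tree A
  | .ff => .tagged 0 .nil
  | .tt => .tagged 1 .nil
  | .atom a => .tagged 2 (.atom a)
  | .or α β => .tagged 3 (.pair α.encode β.encode)
  | .and α β => .tagged 4 (.pair α.encode β.encode)

def Context.encode : Context A → Tree A
  | .hole => .tagged 0 .nil
  | .orLeft ξ β => .tagged 1 (.pair ξ.encode β.encode)
  | .orRight α ξ => .tagged 2 (.pair α.encode ξ.encode)
  | .andLeft ξ β => .tagged 3 (.pair ξ.encode β.encode)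
  | .andRight α ξ => .tagged 4 (.pair α.encode ξ.encode)

def Rule.encode : Rule → Tree A
  | .aiDown => .num 0
  | .awDown => .num 1
  | .acDown => .num 2
  | .aiUp => .num 3
  | .awUp => .num 4
  | .acUp => .num 5
  | .switch => .num 6
  | .medial => .num 7
  | .equal => .num 8

def Step.encode (s : Step A) : Tree A :=
  .pair s.context.encode (.pair s.rule.encode (.pair s.upper.encode s.lower.encode))

def encodeSteps : List (Step A) → Tree A
  | [] => .nil
  | s :: L => .pair s.encode (encodeSteps L)

def Derivation.encode (Φ : Derivation A) : Tree A :=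
  .pair Φ.premiss.encode (encodeSteps Φ.steps)

theorem Tree.num_injective : Function.Injective (Tree.num : ℕ → Tree A) := by
  intro m
  induction m with
  | zero => intro n h; cases n <;> simp_all [Tree.num]
  | succ m ih =>
    intro n h
    cases n with
    | zero => simp [Tree.num] at h
    | succ n => simp only [Tree.num, Tree.pair.injEq, true_and] at h; rw [ih h]

theorem Formula.encode_injective : Function.Injective (Formula.encode : Formula A → Tree A) := by
  intro α
  induction α with
  | or α β ih₁ ih₂ | and α β ih₁ ih₂ =>
    intro γ h
    cases γ <;> simp [Formula.encode, Tree.tagged, Tree.num_injective.eq_iff] at h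
    rw [ih₁ h.1, ih₂ h.2]
  | _ =>
    intro γ h
    cases γ <;> simp_all [Formula.encode, Tree.tagged, Tree.num_injective.eq_iff]

theorem Context.encode_injective : Function.Injective (Context.encode : Context A → Tree A) := by
  intro ξ
  induction ξ with
  | hole =>
    intro ζ h
    cases ζ <;> simp_all [Context.encode, Tree.tagged, Tree.num_injective.eq_iff]
  | orLeft ξ β ih | andLeft ξ β ih =>
    intro ζ h
    cases ζ <;> simp [Context.encode, Tree.tagged, Tree.num_injective.eq_iff] at h
    rw [ih h.1, Formula.encode_injective h.2]
  | orRight α ξ ih | andRight α ξ ih =>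
    intro ζ h
    cases ζ <;> simp [Context.encode, Tree.tagged, Tree.num_injective.eq_iff] at h
    rw [Formula.encode_injective h.1, ih h.2]

theorem Rule.encode_injective : Function.Injective (Rule.encode : Rule → Tree A) := by
  intro ρ σ h
  cases ρ <;> cases σ <;> simp_all [Rule.encode, Tree.num_injective.eq_iff]

theorem Step.encode_injective : Function.Injective (Step.encode : Step A → Tree A) := by
  rintro ⟨ξ, ρ, γ, δ⟩ ⟨ξ', ρ', γ', δ'⟩ h
  simp only [Step.encode, Tree.pair.injEq] at h
  rw [Context.encode_injective h.1, Rule.encode_injective h.2.1,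
    Formula.encode_injective h.2.2.1, Formula.encode_injective h.2.2.2]

theorem encodeSteps_injective :
    Function.Injective (encodeSteps : List (Step A) → Tree A) := by
  intro L
  induction L with
  | nil => intro M h; cases M <;> simp_all [encodeSteps]
  | cons s L ih =>
    intro M h
    cases M with
    | nil => simp [encodeSteps] at h
    | cons r M =>
      simp only [encodeSteps, Tree.pair.injEq] at h
      rw [Step.encode_injective h.1, ih h.2]

theorem Derivation.encode_injective :
    Function.Injective (Derivation.encode : Derivation A → Tree A) := by
  rintro ⟨α, L⟩ ⟨β, M⟩ h
  simp only [Derivation.encode, Tree.pair.injEq] at h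
  rw [Formula.encode_injective h.1, encodeSteps_injective h.2]

/-- The function `q` grows at most quasipolynomially: `q n = 2 ^ (log n) ^ O(1)`. -/
def IsQuasipolynomial (q : ℕ → ℕ) : Prop :=
  ∃ c : ℕ, ∀ n : ℕ, q n ≤ 2 ^ (c * (Nat.log 2 n + 1) ^ c)

end DeepInference

-- Cuts are removed by means of threshold formulae. Let `V` be a disjunction of atoms of the
-- identities and cuts of the given proof, one out of each dual pair, and let T_k be `TH V k`, which
-- says that at least k atoms of `V` are true. Fix k, and replace throughout the proof the dual of
-- each atom p of `V` by T_k with p set to f. This formula serves as a pseudocomplement of p. An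
-- identity on p turns into [p ∨ T_k(p:=f)], which follows from T_k (`der_ext`). A cut on p turns
-- into (p ∧ T_k(p:=f)). Here T_k(p:=f) yields T_{k+1}(p:=t), because making p true raises the count
-- by one (`der_INC`), and together with p this yields T_{k+1} (`der_fill`, `der_cutD`). Linear
-- rules survive the substitution, and the atomic structural rules become their general forms.
--
-- So the translated proof needs no cut. It consumes copies of T_k at the identities, made by
-- cocontraction, and emits copies of T_{k+1} at the cuts, merged by contraction. In its conclusion
-- each pseudocomplement is turned back into the atom for which it stands, by a new identity and at
-- the price of one more T_{k+1} (`der_fin`). This gives a derivation from T_k to [α ∨ T_{k+1}]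
-- (`der_layer`). Since T_0 follows from t, and T_n collapses to f once n exceeds the number of
-- leaves of `V`, the layers compose to a cut-free proof of α (`der_whole`).
--
-- That proof still has coweakenings. They are pushed upwards: an atom that is discarded is replaced
-- by t in everything above it, and the rule instances that this touches are patched. The conclusion
-- stays as it is, and the premiss t has no atoms to replace (`run_hFull`).
--
-- For the size, `V` is kept balanced, so its depth is logarithmic. Each level of `V` multiplies the
-- size of the thresholds by a factor linear in k, which makes them quasipolynomial, and all other
-- constructions are polynomial in them.
--
-- For the running time, `Cmp b X` says that one program computes the whole family `X` from the
-- family `b` in quasipolynomial time. This notion is closed under composition, pairing, case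
-- distinction and recursion with bounded results (`Cmp.rec1`, `Cmp.rec2`), and each construction
-- above is shown to have it. Derivations are built as terms `OD` that mention no formulae; `run`
-- recovers the formulae from the conclusion upwards.

universe v w

set_option linter.unusedSectionVars false

/-! ### Quasipolynomial time as a class closed under composition and recursion. -/

namespace DeepInference

/-! ### Monotone quasipolynomial functions -/

/-- Monotone functions of quasipolynomial growth. -/
structure QB (q : ℕ → ℕ) : Prop where
  mono : Monotone q
  quasi : IsQuasipolynomial q

theorem QB.of_le {q r : ℕ → ℕ} (hr : IsQuasipolynomial r) (hq : Monotone q) (h : ∀ n, q n ≤ r n) :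
    QB q :=
  ⟨hq, hr.imp fun _ hc n => (h n).trans (hc n)⟩

theorem QB.mul {q r : ℕ → ℕ} (hq : QB q) (hr : QB r) : QB fun n => q n * r n := by
  refine ⟨fun _ _ h => Nat.mul_le_mul (hq.mono h) (hr.mono h), ?_⟩
  obtain ⟨c, hc⟩ := hq.quasi
  obtain ⟨d, hd⟩ := hr.quasi
  refine ⟨c + d, fun n => (Nat.mul_le_mul (hc n) (hd n)).trans ?_⟩
  rw [← pow_add]
  refine Nat.pow_le_pow_right (by norm_num) ?_
  rw [add_mul]
  gcongr <;> omega

theorem QB.const (k : ℕ) : QB fun _ => k := by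
  refine ⟨monotone_const, k, fun n => Nat.lt_two_pow_self.le.trans ?_⟩
  exact Nat.pow_le_pow_right (by norm_num) (Nat.le_mul_of_pos_right _ (by positivity))

theorem QB.id : QB fun n => n := by
  refine ⟨monotone_id, 1, fun n => ?_⟩
  simpa using (Nat.lt_pow_succ_log_self (by norm_num : 1 < 2) n).le

theorem QB.add {q r : ℕ → ℕ} (hq : QB q) (hr : QB r) : QB fun n => q n + r n := by
  have h : ∀ f : ℕ → ℕ, QB f → QB fun n => f n + 1 := by
    intro f hf
    obtain ⟨c, hc⟩ := hf.quasi
    refine ⟨fun _ _ h => Nat.succ_le_succ (hf.mono h), c + 1, fun n => ?_⟩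
    have h1 : 2 ^ (c * (Nat.log 2 n + 1) ^ c) * 2 ≤ 2 ^ ((c + 1) * (Nat.log 2 n + 1) ^ (c + 1)) := by
      rw [← pow_succ]
      refine Nat.pow_le_pow_right (by norm_num) ?_
      have h2 : (Nat.log 2 n + 1) ^ c ≤ (Nat.log 2 n + 1) ^ (c + 1) :=
        Nat.pow_le_pow_right (by omega) (by omega)
      have h3 : 1 ≤ (Nat.log 2 n + 1) ^ (c + 1) := Nat.one_le_pow _ _ (by omega)
      nlinarith
    have h4 := hc n
    show f n + 1 ≤ _
    have h5 : 1 ≤ 2 ^ (c * (Nat.log 2 n + 1) ^ c) := Nat.one_le_two_pow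
    omega
  refine QB.of_le (((h q hq).mul (h r hr)).quasi) (fun _ _ h => Nat.add_le_add (hq.mono h) (hr.mono h))
    fun n => ?_
  nlinarith

/-- The logarithm of a quasipolynomial function is polylogarithmic, and a polynomial of a
polylogarithm is again one. This is where quasipolynomial growth behaves better than exponential
growth. -/
theorem QB.comp {q r : ℕ → ℕ} (hq : QB q) (hr : QB r) : QB fun n => q (r n) := by
  refine ⟨hq.mono.comp hr.mono, ?_⟩
  obtain ⟨c, hc⟩ := hq.quasi
  obtain ⟨d, hd⟩ := hr.quasi
  refine ⟨c * (d + 1) ^ c + d * c, fun n => (hc _).trans (Nat.pow_le_pow_right (by norm_num) ?_)⟩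
  set L := Nat.log 2 n + 1
  have hL : 1 ≤ L := by omega
  have h1 : Nat.log 2 (r n) + 1 ≤ (d + 1) * L ^ d := by
    have h2 : Nat.log 2 (r n) ≤ d * L ^ d := by
      refine (Nat.log_mono_right (hd n)).trans ?_
      rw [Nat.log_pow (by norm_num)]
    have h3 : 1 ≤ L ^ d := Nat.one_le_pow _ _ hL
    nlinarith
  calc c * (Nat.log 2 (r n) + 1) ^ c ≤ c * ((d + 1) * L ^ d) ^ c := by gcongr
    _ = c * (d + 1) ^ c * L ^ (d * c) := by rw [mul_pow, pow_mul]; ring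
    _ ≤ _ := by gcongr <;> omega

/-- The only bound that is not polynomial: a base linear in the input, raised to the logarithmic
depth of a balanced disjunction. -/
theorem QB.pow_log : QB fun n => n ^ (Nat.log 2 n + 2) := by
  constructor
  · intro m n h
    rcases Nat.eq_zero_or_pos m with rfl | hm
    · simp
    · exact (Nat.pow_le_pow_right hm (by have := Nat.log_mono_right (b := 2) h; omega)).trans
        (Nat.pow_le_pow_left h _)
  · refine ⟨2, fun n => ?_⟩
    refine (Nat.pow_le_pow_left (Nat.lt_pow_succ_log_self (by norm_num : 1 < 2) n).le _).trans ?_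
    rw [← pow_mul]
    refine Nat.pow_le_pow_right (by norm_num) ?_
    simp only [Nat.succ_eq_add_one]
    nlinarith

/-! ### Computability in quasipolynomial time, uniformly in a parameter -/

variable {Ω : Type v} {A : Ω → Type u} [∀ ω, Atoms (A ω)]

/-- One program computes `X ω` from `b ω`, in time quasipolynomial in the size of `b ω`. -/
class Cmp (b X : ∀ ω, Tree (A ω)) : Prop where
  -- The run must succeed inside every enclosing procedure `r`, with the same bound, so the program
  -- may be placed in the body of any recursion.
  out : ∃ (p : Prog) (q : ℕ → ℕ), QB q ∧ ∀ ω r, ∃ t, t ≤ q (b ω).size ∧ Runs r p (b ω) (X ω) t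

/-- `g ω` is bounded quasipolynomially in the size of `b ω`. -/
class Bd (b : ∀ ω, Tree (A ω)) (g : Ω → ℕ) : Prop where
  out : ∃ q : ℕ → ℕ, QB q ∧ ∀ ω, g ω ≤ q (b ω).size

section
variable {b : ∀ ω, Tree (A ω)}

theorem Bd.mono {g h : Ω → ℕ} (H : Bd b h) (hgh : ∀ ω, g ω ≤ h ω) : Bd b g :=
  ⟨H.out.imp fun _ hq => ⟨hq.1, fun ω => (hgh ω).trans (hq.2 ω)⟩⟩

theorem Bd.comp {g : Ω → ℕ} {q : ℕ → ℕ} (hq : QB q) (H : Bd b g) : Bd b fun ω => q (g ω) := by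
  obtain ⟨r, hr, h⟩ := H.out
  exact ⟨_, hq.comp hr, fun ω => hq.mono (h ω)⟩

instance Bd.const (k : ℕ) : Bd b fun _ => k := ⟨_, QB.const k, fun _ => le_rfl⟩

instance Bd.add {g h : Ω → ℕ} [H : Bd b g] [H' : Bd b h] : Bd b fun ω => g ω + h ω := by
  obtain ⟨q, hq, h1⟩ := H.out
  obtain ⟨r, hr, h2⟩ := H'.out
  exact ⟨_, hq.add hr, fun ω => Nat.add_le_add (h1 ω) (h2 ω)⟩

instance Bd.mul {g h : Ω → ℕ} [H : Bd b g] [H' : Bd b h] : Bd b fun ω => g ω * h ω := by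
  obtain ⟨q, hq, h1⟩ := H.out
  obtain ⟨r, hr, h2⟩ := H'.out
  exact ⟨_, hq.mul hr, fun ω => Nat.mul_le_mul (h1 ω) (h2 ω)⟩

/-- Running time bounds output size. Hence the size of anything already shown computable can serve
as a bound in later recursions. -/
instance Bd.size {X : ∀ ω, Tree (A ω)} [H : Cmp b X] : Bd b fun ω => (X ω).size := by
  obtain ⟨p, q, hq, h⟩ := H.out
  refine ⟨q, hq, fun ω => ?_⟩
  obtain ⟨t, ht, h⟩ := h ω .call
  exact h.size_le.trans ht

instance Cmp.refl : Cmp b b :=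
  ⟨.op .id, _, QB.id, fun ω r => ⟨_, le_rfl, .op r .id (b ω)⟩⟩

theorem Cmp.trans {Y X : ∀ ω, Tree (A ω)} (h₁ : Cmp b Y) (h₂ : Cmp Y X) : Cmp b X := by
  obtain ⟨p, q, hq, h⟩ := h₁.out
  obtain ⟨p', q', hq', h'⟩ := h₂.out
  refine ⟨.comp p' p, _, (hq.add (hq'.comp hq)).add QB.id, fun ω r => ?_⟩
  obtain ⟨t, ht, h⟩ := h ω r
  obtain ⟨t', ht', h'⟩ := h' ω r
  exact ⟨_, Nat.add_le_add (Nat.add_le_add ht (ht'.trans (hq'.mono (h.size_le.trans ht)))) le_rfl,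
    .comp h h'⟩

/-- The same program serves every reindexing of the family. This carries computability over to
subfamilies and to indices with extra data. -/
theorem Cmp.pull {Ω' : Type w} (f : Ω' → Ω) {X : ∀ ω, Tree (A ω)} (h : Cmp b X) :
    Cmp (fun x => b (f x)) (fun x => X (f x)) := by
  obtain ⟨p, q, hq, h⟩ := h.out
  exact ⟨p, q, hq, fun x r => h (f x) r⟩

theorem Cmp.op (o : Op) {X : ∀ ω, Tree (A ω)} (h : Cmp b X) : Cmp b fun ω => o.eval (X ω) :=
  h.trans ⟨.op o, _, QB.id, fun ω r => ⟨_, le_rfl, .op r o (X ω)⟩⟩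

instance Cmp.nil : Cmp b fun _ => .nil := Cmp.op .const Cmp.refl

instance Cmp.pair {X Y : ∀ ω, Tree (A ω)} [h₁ : Cmp b X] [h₂ : Cmp b Y] :
    Cmp b fun ω => .pair (X ω) (Y ω) := by
  obtain ⟨p, q, hq, h⟩ := h₁.out
  obtain ⟨p', q', hq', h'⟩ := h₂.out
  refine ⟨.pair p p', _, (hq.add hq').add QB.id, fun ω r => ?_⟩
  obtain ⟨t, ht, h⟩ := h ω r
  obtain ⟨t', ht', h'⟩ := h' ω r
  exact ⟨_, Nat.add_le_add (Nat.add_le_add ht ht') le_rfl, .pair h h'⟩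

theorem Cmp.fst {X Y : ∀ ω, Tree (A ω)} (h : Cmp b fun ω => .pair (X ω) (Y ω)) : Cmp b X :=
  h.op .head

theorem Cmp.snd {X Y : ∀ ω, Tree (A ω)} (h : Cmp b fun ω => .pair (X ω) (Y ω)) : Cmp b Y :=
  h.op .tail

open Classical in
/-- A truth value as a tree. -/
noncomputable def bt {A : Type u} (p : Prop) : Tree A := if p then .true else .nil

theorem Cmp.ite {X Y : ∀ ω, Tree (A ω)} {c : Ω → Prop} {d : ∀ ω, Decidable (c ω)}
    (hc : Cmp b fun ω => bt (c ω)) (hX : Cmp b X) (hY : Cmp b Y) :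
    Cmp b fun ω => if c ω then X ω else Y ω := by
  obtain ⟨p₀, q₀, hq₀, h₀⟩ := hc.out
  obtain ⟨p, q, hq, h⟩ := hX.out
  obtain ⟨p', q', hq', h'⟩ := hY.out
  refine ⟨.cond p₀ p p', _, (hq₀.add (hq.add hq')).add QB.id, fun ω r => ?_⟩
  obtain ⟨t₀, ht₀, h₀⟩ := h₀ ω r
  obtain ⟨t, ht, h⟩ := h ω r
  obtain ⟨t', ht', h'⟩ := h' ω r
  by_cases hc : c ω
  · simp only [hc, if_true, bt] at h₀ ⊢
    exact ⟨_, by omega, .condTrue h₀ (by simp [Tree.true]) h⟩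
  · simp only [hc, if_false, bt] at h₀ ⊢
    exact ⟨_, by omega, .condFalse h₀ h'⟩

instance Cmp.btEq {X Y : ∀ ω, Tree (A ω)} [hX : Cmp b X] [hY : Cmp b Y] :
    Cmp b fun ω => bt (X ω = Y ω) :=
  Cmp.op .eq (Cmp.pair (X := X) (Y := Y))

instance Cmp.btAnd {c d : Ω → Prop} [hc : Cmp b fun ω => bt (c ω)] [hd : Cmp b fun ω => bt (d ω)] :
    Cmp b fun ω => bt (c ω ∧ d ω) := by
  classical
  convert Cmp.ite (d := fun _ => Classical.dec _) hc hd (Cmp.nil (A := A)) using 2 with ω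
  by_cases h : c ω <;> by_cases h' : d ω <;> simp [h, h', bt]

instance Cmp.btOr {c d : Ω → Prop} [hc : Cmp b fun ω => bt (c ω)] [hd : Cmp b fun ω => bt (d ω)] :
    Cmp b fun ω => bt (c ω ∨ d ω) := by
  classical
  convert Cmp.ite (d := fun _ => Classical.dec _) hc hc hd using 2 with ω
  by_cases h : c ω <;> by_cases h' : d ω <;> simp [h, h', bt]

instance Cmp.btTrue : Cmp b fun _ => bt True := by
  simp only [bt, if_true, Tree.true]; infer_instance

instance Cmp.btFalse : Cmp b fun _ => bt False := by
  simp only [bt, if_false]; infer_instance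

instance Cmp.btNot {c : Ω → Prop} [hc : Cmp b fun ω => bt (c ω)] :
    Cmp b fun ω => bt (¬ c ω) := by
  classical
  convert Cmp.ite (d := fun _ => Classical.dec _) hc Cmp.btFalse Cmp.btTrue using 2 with ω
  by_cases h : c ω <;> simp [h]

end

/-! ### Recursion -/

section
variable {b : ∀ ω, Tree (A ω)} {I : Ω → Type w}

/-- Binary recursion; the first recursive call may use the result of the second. -/
theorem Cmp.rec2 (inp out : ∀ ω, I ω → Tree (A ω)) (node : ∀ ω, I ω → Prop)
    (c₁ c₂ : ∀ ω, I ω → I ω) (m : ∀ ω, I ω → ℕ)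
    (hguard : Cmp (Ω := Σ ω, I ω) (fun x => inp x.1 x.2) fun x => bt (node x.1 x.2))
    (hleaf : Cmp (Ω := Σ ω, {i : I ω // ¬ node ω i}) (fun x => inp x.1 x.2) fun x => out x.1 x.2)
    (h₂ : Cmp (Ω := Σ ω, {i : I ω // node ω i}) (fun x => inp x.1 x.2)
      fun x => inp x.1 (c₂ x.1 x.2))
    (h₁ : Cmp (Ω := Σ ω, {i : I ω // node ω i})
      (fun x => .pair (inp x.1 x.2) (out x.1 (c₂ x.1 x.2))) fun x => inp x.1 (c₁ x.1 x.2))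
    (hh : Cmp (Ω := Σ ω, {i : I ω // node ω i})
      (fun x => .pair (.pair (inp x.1 x.2) (out x.1 (c₂ x.1 x.2))) (out x.1 (c₁ x.1 x.2)))
      fun x => out x.1 x.2)
    (hm : ∀ ω i, node ω i → m ω (c₁ ω i) + m ω (c₂ ω i) + 1 ≤ m ω i)
    (M : Ω → ℕ) [hM : Bd b M] (hinp : ∀ ω i, (inp ω i).size ≤ M ω)
    (hout : ∀ ω i, (out ω i).size ≤ M ω) (hmM : ∀ ω i, m ω i ≤ M ω)
    (i₀ : ∀ ω, I ω) (h₀ : Cmp b fun ω => inp ω (i₀ ω)) : Cmp b fun ω => out ω (i₀ ω) := by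
  obtain ⟨p₀, q₀, hq₀, h₀⟩ := h₀.out
  obtain ⟨qM, hqM, hM⟩ := hM.out
  obtain ⟨pg, qg, hqg, hg⟩ := hguard.out
  obtain ⟨pl, ql, hql, hl⟩ := hleaf.out
  obtain ⟨p₂, q₂, hq₂, h₂⟩ := h₂.out
  obtain ⟨p₁, q₁, hq₁, h₁⟩ := h₁.out
  obtain ⟨ph, qh, hqh, hh⟩ := hh.out
  set body : Prog := .cond pg (.comp ph (.comp (.pair (.op .id) (.comp .call p₁))
    (.pair (.op .id) (.comp .call p₂)))) pl with hbody
  -- `K N` bounds the cost of one call apart from its recursive calls, when all inputs and outputs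
  -- have size at most `N`. The arguments 2N+1 and 3N+2 are the sizes of the input paired with one
  -- and with two results; the last summand pays for the surcharges of the composite programs.
  set K : ℕ → ℕ := fun N => qg N + ql N + q₂ N + q₁ (2 * N + 1) + qh (3 * N + 2) + 20 * (N + 1)
    with hK
  -- At most 2m+1 calls are made below an index of measure m.
  have key : ∀ n ω i, m ω i ≤ n → ∃ t, t ≤ (2 * m ω i + 1) * K (M ω) ∧
      Runs body body (inp ω i) (out ω i) t := by
    intro n
    induction n with
    | zero =>
      intro ω i hi
      have hn : ¬ node ω i := fun h => by have := hm ω i h; omega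
      obtain ⟨t, ht, hg⟩ := hg ⟨ω, i⟩ body
      obtain ⟨t', ht', hl⟩ := hl ⟨ω, i, hn⟩ body
      simp only [bt, hn, if_false] at hg
      refine ⟨_, ?_, .condFalse hg hl⟩
      have e1 := ht.trans (hqg.mono (hinp ω i))
      have e2 := ht'.trans (hql.mono (hinp ω i))
      have e3 := hinp ω i
      simp only [hK]
      nlinarith [Nat.zero_le (m ω i)]
    | succ n ih =>
      intro ω i hi
      obtain ⟨t, ht, hg⟩ := hg ⟨ω, i⟩ body
      have e1 := ht.trans (hqg.mono (hinp ω i))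
      have e3 := hinp ω i
      by_cases hn : node ω i
      · obtain ⟨t₂, ht₂, h₂⟩ := h₂ ⟨ω, i, hn⟩ body
        obtain ⟨t₁, ht₁, h₁⟩ := h₁ ⟨ω, i, hn⟩ body
        obtain ⟨th, hth, hh⟩ := hh ⟨ω, i, hn⟩ body
        have hm' := hm ω i hn
        obtain ⟨s₂, hs₂, r₂⟩ := ih ω (c₂ ω i) (by omega)
        obtain ⟨s₁, hs₁, r₁⟩ := ih ω (c₁ ω i) (by omega)
        simp only [bt, hn, if_true] at hg
        refine ⟨_, ?_, .condTrue hg (by simp [Tree.true]) (.comp (.comp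
          (.pair (.op _ .id _) (.comp h₂ (.call r₂))) (.pair (.op _ .id _) (.comp h₁ (.call r₁))))
          hh)⟩
        have a1 := hinp ω (c₂ ω i)
        have a2 := hinp ω (c₁ ω i)
        have a3 := hout ω (c₂ ω i)
        have a4 := hout ω (c₁ ω i)
        have b2 := ht₂.trans (hq₂.mono (hinp ω i))
        have b1 := ht₁.trans (hq₁.mono (b := 2 * M ω + 1) (by simp only [Tree.size]; omega))
        have bh := hth.trans (hqh.mono (b := 3 * M ω + 2) (by simp only [Tree.size]; omega))
        have hKb : qg (M ω) + q₂ (M ω) + q₁ (2 * M ω + 1) + qh (3 * M ω + 2) + 20 * (M ω + 1)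
            ≤ K (M ω) := by simp only [hK]; omega
        -- The calls below both children and the present call fit the budget: `hm` gives
        -- (2m₁+1)+(2m₂+1)+1 ≤ 2m+1.
        have hmul : (2 * m ω (c₁ ω i) + 1 + (2 * m ω (c₂ ω i) + 1) + 1) * K (M ω)
            ≤ (2 * m ω i + 1) * K (M ω) := Nat.mul_le_mul_right _ (by omega)
        rw [add_mul, add_mul] at hmul
        have hid := Op.size_eval_le .id (inp ω i)
        simp only [Tree.size]
        omega
      · obtain ⟨t', ht', hl⟩ := hl ⟨ω, i, hn⟩ body
        simp only [bt, hn, if_false] at hg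
        refine ⟨_, ?_, .condFalse hg hl⟩
        have e2 := ht'.trans (hql.mono (hinp ω i))
        simp only [hK]
        nlinarith [Nat.zero_le (m ω i)]
  have hKq : QB K := ((((hqg.add hql).add hq₂).add (hq₁.comp (((QB.const 2).mul QB.id).add
    (QB.const 1)))).add (hqh.comp (((QB.const 3).mul QB.id).add (QB.const 2)))).add
    ((QB.const 20).mul (QB.id.add (QB.const 1)))
  refine ⟨.comp (.fix body) p₀, _, ((hq₀.add (((QB.const 2).mul hqM).add (QB.const 1) |>.mul
    (hKq.comp hqM))).add hqM).add QB.id, fun ω r => ?_⟩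
  obtain ⟨t₀, ht₀, h₀⟩ := h₀ ω r
  obtain ⟨t, ht, h⟩ := key _ ω (i₀ ω) le_rfl
  refine ⟨_, ?_, .comp h₀ (.fix h)⟩
  have e1 := (hinp ω (i₀ ω)).trans (hM ω)
  have e2 := (hmM ω (i₀ ω)).trans (hM ω)
  have e3 : t ≤ (2 * qM (b ω).size + 1) * K (qM (b ω).size) :=
    ht.trans (Nat.mul_le_mul (by omega) (hKq.mono (hM ω)))
  omega

/-- Unary recursion. -/
theorem Cmp.rec1 (inp out : ∀ ω, I ω → Tree (A ω)) (node : ∀ ω, I ω → Prop)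
    (c : ∀ ω, I ω → I ω) (m : ∀ ω, I ω → ℕ)
    (hguard : Cmp (Ω := Σ ω, I ω) (fun x => inp x.1 x.2) fun x => bt (node x.1 x.2))
    (hleaf : Cmp (Ω := Σ ω, {i : I ω // ¬ node ω i}) (fun x => inp x.1 x.2) fun x => out x.1 x.2)
    (h₁ : Cmp (Ω := Σ ω, {i : I ω // node ω i}) (fun x => inp x.1 x.2)
      fun x => inp x.1 (c x.1 x.2))
    (hh : Cmp (Ω := Σ ω, {i : I ω // node ω i})
      (fun x => .pair (inp x.1 x.2) (out x.1 (c x.1 x.2))) fun x => out x.1 x.2)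
    (hm : ∀ ω i, node ω i → m ω (c ω i) + 1 ≤ m ω i)
    (M : Ω → ℕ) [hM : Bd b M] (hinp : ∀ ω i, (inp ω i).size ≤ M ω)
    (hout : ∀ ω i, (out ω i).size ≤ M ω) (hmM : ∀ ω i, m ω i ≤ M ω)
    (i₀ : ∀ ω, I ω) (h₀ : Cmp b fun ω => inp ω (i₀ ω)) : Cmp b fun ω => out ω (i₀ ω) := by
  obtain ⟨p₀, q₀, hq₀, h₀⟩ := h₀.out
  obtain ⟨qM, hqM, hM⟩ := hM.out
  obtain ⟨pg, qg, hqg, hg⟩ := hguard.out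
  obtain ⟨pl, ql, hql, hl⟩ := hleaf.out
  obtain ⟨p₁, q₁, hq₁, h₁⟩ := h₁.out
  obtain ⟨ph, qh, hqh, hh⟩ := hh.out
  set body : Prog := .cond pg (.comp ph (.pair (.op .id) (.comp .call p₁))) pl with hbody
  set K : ℕ → ℕ := fun N => qg N + ql N + q₁ N + qh (2 * N + 1) + 20 * (N + 1) with hK
  have key : ∀ n ω i, m ω i ≤ n → ∃ t, t ≤ (m ω i + 1) * K (M ω) ∧
      Runs body body (inp ω i) (out ω i) t := by
    intro n
    induction n with
    | zero =>
      intro ω i hi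
      have hn : ¬ node ω i := fun h => by have := hm ω i h; omega
      obtain ⟨t, ht, hg⟩ := hg ⟨ω, i⟩ body
      obtain ⟨t', ht', hl⟩ := hl ⟨ω, i, hn⟩ body
      simp only [bt, hn, if_false] at hg
      refine ⟨_, ?_, .condFalse hg hl⟩
      have e1 := ht.trans (hqg.mono (hinp ω i))
      have e2 := ht'.trans (hql.mono (hinp ω i))
      have e3 := hinp ω i
      simp only [hK]
      nlinarith [Nat.zero_le (m ω i)]
    | succ n ih =>
      intro ω i hi
      obtain ⟨t, ht, hg⟩ := hg ⟨ω, i⟩ body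
      have e1 := ht.trans (hqg.mono (hinp ω i))
      have e3 := hinp ω i
      by_cases hn : node ω i
      · obtain ⟨t₁, ht₁, h₁⟩ := h₁ ⟨ω, i, hn⟩ body
        obtain ⟨th, hth, hh⟩ := hh ⟨ω, i, hn⟩ body
        have hm' := hm ω i hn
        obtain ⟨s₁, hs₁, r₁⟩ := ih ω (c ω i) (by omega)
        simp only [bt, hn, if_true] at hg
        refine ⟨_, ?_, .condTrue hg (by simp [Tree.true]) (.comp
          (.pair (.op _ .id _) (.comp h₁ (.call r₁))) hh)⟩
        have a2 := hinp ω (c ω i)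
        have a4 := hout ω (c ω i)
        have b1 := ht₁.trans (hq₁.mono (hinp ω i))
        have bh := hth.trans (hqh.mono (b := 2 * M ω + 1) (by simp only [Tree.size]; omega))
        have hKb : qg (M ω) + q₁ (M ω) + qh (2 * M ω + 1) + 20 * (M ω + 1)
            ≤ K (M ω) := by simp only [hK]; omega
        have hmul : (m ω (c ω i) + 1 + 1) * K (M ω)
            ≤ (m ω i + 1) * K (M ω) := Nat.mul_le_mul_right _ (by omega)
        rw [add_mul] at hmul
        have hid := Op.size_eval_le .id (inp ω i)
        dsimp only at *
        omega
      · obtain ⟨t', ht', hl⟩ := hl ⟨ω, i, hn⟩ body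
        simp only [bt, hn, if_false] at hg
        refine ⟨_, ?_, .condFalse hg hl⟩
        have e2 := ht'.trans (hql.mono (hinp ω i))
        simp only [hK]
        nlinarith [Nat.zero_le (m ω i)]
  have hKq : QB K := (((hqg.add hql).add hq₁).add (hqh.comp (((QB.const 2).mul QB.id).add
    (QB.const 1)))).add ((QB.const 20).mul (QB.id.add (QB.const 1)))
  refine ⟨.comp (.fix body) p₀, _, ((hq₀.add ((hqM.add (QB.const 1)).mul
    (hKq.comp hqM))).add hqM).add QB.id, fun ω r => ?_⟩
  obtain ⟨t₀, ht₀, h₀⟩ := h₀ ω r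
  obtain ⟨t, ht, h⟩ := key _ ω (i₀ ω) le_rfl
  refine ⟨_, ?_, .comp h₀ (.fix h)⟩
  have e1 := (hinp ω (i₀ ω)).trans (hM ω)
  have e2 := (hmM ω (i₀ ω)).trans (hM ω)
  have e3 : t ≤ (qM (b ω).size + 1) * K (qM (b ω).size) :=
    ht.trans (Nat.mul_le_mul (by omega) (hKq.mono (hM ω)))
  omega

end
end DeepInference

namespace DeepInference

/-! ### Computability on formulae, numbers, lists and contexts -/

section
variable {Ω : Type v} {A : Ω → Type u} [∀ ω, Atoms (A ω)] {b : ∀ ω, Tree (A ω)}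

/-- Case distinction, where each branch has to be computed only where it applies. -/
theorem Cmp.cases {X : ∀ ω, Tree (A ω)} (c : Ω → Prop) [hc : Cmp b fun ω => bt (c ω)]
    (h₁ : Cmp (Ω := {ω // c ω}) (fun ω => b ω) fun ω => X ω)
    (h₂ : Cmp (Ω := {ω // ¬ c ω}) (fun ω => b ω) fun ω => X ω) : Cmp b X := by
  obtain ⟨p₀, q₀, hq₀, h₀⟩ := hc.out
  obtain ⟨p, q, hq, h⟩ := h₁.out
  obtain ⟨p', q', hq', h'⟩ := h₂.out
  refine ⟨.cond p₀ p p', _, (hq₀.add (hq.add hq')).add QB.id, fun ω r => ?_⟩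
  obtain ⟨t₀, ht₀, h₀⟩ := h₀ ω r
  by_cases hc : c ω
  · obtain ⟨t, ht, h⟩ := h ⟨ω, hc⟩ r
    simp only [hc, if_true, bt] at h₀
    exact ⟨_, by dsimp only at *; omega, .condTrue h₀ (by simp [Tree.true]) h⟩
  · obtain ⟨t', ht', h'⟩ := h' ⟨ω, hc⟩ r
    simp only [hc, if_false, bt] at h₀
    exact ⟨_, by dsimp only at *; omega, .condFalse h₀ h'⟩

/-- The image of a situation determines the computation. -/
theorem Cmp.congr {X Y : ∀ ω, Tree (A ω)} (h : Cmp b X) (e : ∀ ω, X ω = Y ω) : Cmp b Y := by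
  rwa [funext e] at h

instance Cmp.iteTree {X Y : ∀ ω, Tree (A ω)} {c : Ω → Prop} {d : ∀ ω, Decidable (c ω)}
    [hc : Cmp b fun ω => bt (c ω)] [hX : Cmp b X] [hY : Cmp b Y] :
    Cmp b fun ω => if c ω then X ω else Y ω := Cmp.ite hc hX hY

/-! #### Numbers -/

instance Cmp.num (n : ℕ) : Cmp b fun _ => Tree.num n := by
  induction n with
  | zero => exact Cmp.nil
  | succ n ih => simp only [Tree.num]; infer_instance

instance Cmp.numSucc {n : Ω → ℕ} [h : Cmp b fun ω => Tree.num (n ω)] :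
    Cmp b fun ω => Tree.num (n ω + 1) := by
  simp only [Tree.num]; infer_instance

theorem Tree.size_num {B : Type u} (n : ℕ) : (Tree.num n : Tree B).size = 2 * n + 1 := by
  induction n with
  | zero => rfl
  | succ n ih => simp only [Tree.num, Tree.size, ih]; ring

instance Cmp.tagged {n : ℕ} {X : ∀ ω, Tree (A ω)} [Cmp b X] : Cmp b fun ω => Tree.tagged n (X ω) := by
  unfold Tree.tagged; infer_instance

theorem Tree.size_tagged {B : Type u} (n : ℕ) (x : Tree B) :
    (Tree.tagged n x).size = x.size + (2 * n + 2) := by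
  simp only [Tree.tagged, Tree.size, Tree.size_num]; ring

/-! #### Atoms -/

instance Cmp.dual {a : ∀ ω, A ω} [h : Cmp b fun ω => Tree.atom (a ω)] :
    Cmp b fun ω => Tree.atom (Atoms.dual (a ω)) :=
  Cmp.op .dual h

/-! #### Formulae -/

instance Cmp.ff : Cmp b fun _ => Formula.ff.encode := by unfold Formula.encode; infer_instance

instance Cmp.tt : Cmp b fun _ => Formula.tt.encode := by unfold Formula.encode; infer_instance

instance Cmp.atom {a : ∀ ω, A ω} [Cmp b fun ω => Tree.atom (a ω)] :
    Cmp b fun ω => (Formula.atom (a ω)).encode := by unfold Formula.encode; infer_instance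

instance Cmp.or {F G : ∀ ω, Formula (A ω)} [Cmp b fun ω => (F ω).encode]
    [Cmp b fun ω => (G ω).encode] : Cmp b fun ω => (Formula.or (F ω) (G ω)).encode := by
  simp only [Formula.encode]; infer_instance

instance Cmp.and {F G : ∀ ω, Formula (A ω)} [Cmp b fun ω => (F ω).encode]
    [Cmp b fun ω => (G ω).encode] : Cmp b fun ω => (Formula.and (F ω) (G ω)).encode := by
  simp only [Formula.encode]; infer_instance

instance Cmp.iteFormula {X Y : ∀ ω, Formula (A ω)} {c : Ω → Prop} {d : ∀ ω, Decidable (c ω)}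
    [hc : Cmp b fun ω => bt (c ω)] [hX : Cmp b fun ω => (X ω).encode]
    [hY : Cmp b fun ω => (Y ω).encode] :
    Cmp b fun ω => (if c ω then X ω else Y ω).encode :=
  (Cmp.ite (d := d) hc hX hY).congr fun ω => by split <;> rfl

instance Cmp.btFormulaEq {x y : ∀ ω, Formula (A ω)} [Cmp b fun ω => (x ω).encode]
    [Cmp b fun ω => (y ω).encode] : Cmp b fun ω => bt (x ω = y ω) :=
  (Cmp.btEq (b := b) (X := fun ω => (x ω).encode) (Y := fun ω => (y ω).encode)).congr
    fun ω => by rw [Formula.encode_injective.eq_iff]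

end

section
variable {B : Type u}

/-- The number of the outermost constructor. -/
def Formula.tag : Formula B → ℕ
  | .ff => 0
  | .tt => 1
  | .atom _ => 2
  | .or _ _ => 3
  | .and _ _ => 4

/-- The left immediate subformula, if there is one. -/
def Formula.L : Formula B → Formula B
  | .or α _ => α
  | .and α _ => α
  | α => α

/-- The right immediate subformula, if there is one. -/
def Formula.R : Formula B → Formula B
  | .or _ β => β
  | .and _ β => β
  | α => α

theorem Formula.eq_ff_of_tag {F : Formula B} (h : F.tag = 0) : F = .ff := by
  cases F <;> simp [tag] at h ⊢

theorem Formula.eq_tt_of_tag {F : Formula B} (h : F.tag = 1) : F = .tt := by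
  cases F <;> simp [tag] at h ⊢

theorem Formula.eq_or_of_tag {F : Formula B} (h : F.tag = 3) : F = .or F.L F.R := by
  cases F <;> simp [tag, L, R] at h ⊢

theorem Formula.eq_and_of_tag {F : Formula B} (h : F.tag = 4) : F = .and F.L F.R := by
  cases F <;> simp [tag, L, R] at h ⊢

theorem Formula.exists_atom_of_tag {F : Formula B} (h0 : F.tag ≠ 0) (h1 : F.tag ≠ 1)
    (h : ¬ (F.tag = 3 ∨ F.tag = 4)) : ∃ a, F = .atom a := by
  cases F <;> simp [tag] at h h0 h1 ⊢

theorem Formula.size_encode_children {F : Formula B} (h : F.tag = 3 ∨ F.tag = 4) :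
    F.L.encode.size + F.R.encode.size + 1 ≤ F.encode.size := by
  cases F <;> simp [tag] at h <;> simp only [L, R, encode, Tree.size_tagged, Tree.size] <;> omega

theorem Formula.size_pos (F : Formula B) : 0 < F.size := by
  induction F <;> simp only [Formula.size] <;> omega

theorem Formula.size_encode (F : Formula B) :
    F.size ≤ F.encode.size ∧ F.encode.size + 11 ≤ 18 * F.size := by
  induction F <;> simp only [Formula.encode, Formula.size, Tree.size_tagged, Tree.size] at * <;>
    omega

end

section
variable {Ω : Type v} {A : Ω → Type u} [∀ ω, Atoms (A ω)] {b : ∀ ω, Tree (A ω)}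

instance Cmp.btTagEq {F : ∀ ω, Formula (A ω)} {n : ℕ} [h : Cmp b fun ω => (F ω).encode] :
    Cmp b fun ω => bt ((F ω).tag = n) :=
  (Cmp.btEq (hX := h.op .head) (hY := Cmp.num n)).congr fun ω => by
    cases F ω <;> simp [Formula.encode, Tree.tagged, Op.eval, Formula.tag,
      Tree.num_injective.eq_iff]

instance Cmp.formulaL {F : ∀ ω, Formula (A ω)} [h : Cmp b fun ω => (F ω).encode] :
    Cmp b fun ω => (F ω).L.encode :=
  (Cmp.ite (d := fun _ => inferInstance) (c := fun ω => (F ω).tag = 3 ∨ (F ω).tag = 4)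
    inferInstance ((h.op .tail).op .head) h).congr fun ω => by
    cases h : F ω <;> simp [Formula.encode, Tree.tagged, Op.eval, Formula.tag, Formula.L]

instance Cmp.formulaR {F : ∀ ω, Formula (A ω)} [h : Cmp b fun ω => (F ω).encode] :
    Cmp b fun ω => (F ω).R.encode :=
  (Cmp.ite (d := fun _ => inferInstance) (c := fun ω => (F ω).tag = 3 ∨ (F ω).tag = 4)
    inferInstance ((h.op .tail).op .tail) h).congr fun ω => by
    cases h : F ω <;> simp [Formula.encode, Tree.tagged, Op.eval, Formula.tag, Formula.R]

/-- Structural recursion on a formula, with an invariant `S` that passes to subformulae. -/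
theorem Cmp.formulaRecOn (F : ∀ ω, Formula (A ω)) (f : ∀ ω, Formula (A ω) → Tree (A ω))
    (S : ∀ ω, Formula (A ω) → Prop) (hF : ∀ ω, S ω (F ω))
    (hL : ∀ ω G, S ω G → S ω G.L) (hR : ∀ ω G, S ω G → S ω G.R)
    (M : Ω → ℕ) [hM : Bd b M] (hM₁ : ∀ ω G, S ω G → G.encode.size ≤ M ω)
    (hM₂ : ∀ ω G, S ω G → (f ω G).size ≤ M ω)
    (h₀ : Cmp b fun ω => (F ω).encode)
    (hff : Cmp b fun ω => f ω .ff) (htt : Cmp b fun ω => f ω .tt)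
    -- The base `b'` is left abstract here and below. A proof of the recursion step may use only
    -- that whatever is computable from `b`, the constituents and the recursive results are
    -- computable from `b'`. The tuple that the program really carries is supplied once, inside this
    -- proof.
    (hatom : ∀ b' : (∀ x : (Σ ω, A ω), Tree (A x.1)), (∀ Y, Cmp b Y → Cmp b' fun x => Y x.1) →
      Cmp b' (fun x => .atom x.2) → Cmp b' fun x => f x.1 (.atom x.2))
    (hor : ∀ b' : (∀ x : (Σ ω, Formula (A ω) × Formula (A ω)), Tree (A x.1)),
      (∀ Y, Cmp b Y → Cmp b' fun x => Y x.1) →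
      Cmp b' (fun x => x.2.1.encode) → Cmp b' (fun x => x.2.2.encode) →
      Cmp b' (fun x => f x.1 x.2.1) → Cmp b' (fun x => f x.1 x.2.2) →
      Cmp b' fun x => f x.1 (.or x.2.1 x.2.2))
    (hand : ∀ b' : (∀ x : (Σ ω, Formula (A ω) × Formula (A ω)), Tree (A x.1)),
      (∀ Y, Cmp b Y → Cmp b' fun x => Y x.1) →
      Cmp b' (fun x => x.2.1.encode) → Cmp b' (fun x => x.2.2.encode) →
      Cmp b' (fun x => f x.1 x.2.1) → Cmp b' (fun x => f x.1 x.2.2) →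
      Cmp b' fun x => f x.1 (.and x.2.1 x.2.2)) :
    Cmp b fun ω => f ω (F ω) := by
  have hB : Bd b fun ω => (b ω).size + M ω + 1 := inferInstance
  refine Cmp.rec2 (b := b) (I := fun ω => {G : Formula (A ω) // S ω G})
    (fun ω G => .pair (b ω) G.1.encode) (fun ω G => f ω G.1)
    (fun ω G => G.1.tag = 3 ∨ G.1.tag = 4) (fun ω G => ⟨G.1.L, hL ω _ G.2⟩)
    (fun ω G => ⟨G.1.R, hR ω _ G.2⟩) (fun ω G => G.1.encode.size) ?_ ?_ ?_ ?_ ?_ ?_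
    (fun ω => (b ω).size + M ω + 1) (hM := hB) ?_ ?_ ?_ (fun ω => ⟨F ω, hF ω⟩) inferInstance
  · have h := (Cmp.refl (Ω := Σ ω, {G : Formula (A ω) // S ω G}) (A := fun x => A x.1)
      (b := fun x => .pair (b x.1) x.2.1.encode)).snd
    infer_instance
  · have h0 := Cmp.refl (Ω := Σ ω, {i : {G : Formula (A ω) // S ω G} // ¬ (i.1.tag = 3 ∨ i.1.tag = 4)})
      (A := fun x => A x.1) (b := fun x => .pair (b x.1) x.2.1.1.encode)
    have h := h0.snd
    refine Cmp.cases (fun x => x.2.1.1.tag = 0) ?_ (Cmp.cases (fun x => x.1.2.1.1.tag = 1)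
      (hc := (Cmp.btTagEq (h := h)).pull _) ?_ ?_)
    · exact ((h0.fst.trans (hff.pull _)).pull _).congr fun x =>
        congrArg (f x.1.1) (Formula.eq_ff_of_tag x.2).symm
    · exact (((h0.fst.trans (htt.pull _)).pull _).pull _).congr fun x =>
        congrArg (f x.1.1.1) (Formula.eq_tt_of_tag x.2).symm
    -- Choice only names the atom, so that `hatom` can be applied at the right index; the program
    -- itself reads the atom off the tree.
    · have ha : ∀ x : {x : {x : Σ ω, {i : {G : Formula (A ω) // S ω G} //
          ¬ (i.1.tag = 3 ∨ i.1.tag = 4)} // ¬ x.2.1.1.tag = 0} // ¬ x.1.2.1.1.tag = 1},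
          ∃ a, x.1.1.2.1.1 = .atom a :=
        fun x => Formula.exists_atom_of_tag x.1.2 x.2 x.1.1.2.2
      choose a ha using ha
      have hA := hatom (fun x => .pair (b x.1) (.atom x.2))
        (fun Y hY => Cmp.refl.fst.trans (hY.pull _)) Cmp.refl.snd
      have hA' := hA.pull (fun x => (⟨x.1.1.1, a x⟩ : Σ ω, A ω))
      have h1 := ((h0.fst.pull (fun x : {x // ¬ x.2.1.1.tag = 0} => x.1)).pull
        (fun x : {x // ¬ x.1.2.1.1.tag = 1} => x.1))
      have h2 := (((h.op .tail).pull (fun x : {x // ¬ x.2.1.1.tag = 0} => x.1)).pull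
        (fun x : {x // ¬ x.1.2.1.1.tag = 1} => x.1))
      refine (Cmp.trans (Cmp.pair (h₁ := h1) (h₂ := h2.congr fun x => ?_)) hA').congr fun x => ?_
      · rw [ha]; simp [Formula.encode, Tree.tagged, Op.eval]
      · rw [ha]
  · have h0 := Cmp.refl (Ω := Σ ω, {i : {G : Formula (A ω) // S ω G} // (i.1.tag = 3 ∨ i.1.tag = 4)})
      (A := fun x => A x.1) (b := fun x => .pair (b x.1) x.2.1.1.encode)
    have h1 := h0.fst
    have h2 := h0.snd
    infer_instance
  · have h0 := Cmp.refl (Ω := Σ ω, {i : {G : Formula (A ω) // S ω G} // (i.1.tag = 3 ∨ i.1.tag = 4)})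
      (A := fun x => A x.1) (b := fun x => .pair (.pair (b x.1) x.2.1.1.encode) (f x.1 x.2.1.1.R))
    have h1 := h0.fst.fst
    have h2 := h0.fst.snd
    infer_instance
  · have h0 := Cmp.refl (Ω := Σ ω, {i : {G : Formula (A ω) // S ω G} // (i.1.tag = 3 ∨ i.1.tag = 4)})
      (A := fun x => A x.1) (b := fun x => .pair (.pair (.pair (b x.1) x.2.1.1.encode)
        (f x.1 x.2.1.1.R)) (f x.1 x.2.1.1.L))
    have e := h0.fst.fst.snd
    have hbase : Cmp (Ω := Σ ω, {i : {G : Formula (A ω) // S ω G} // (i.1.tag = 3 ∨ i.1.tag = 4)})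
      (A := fun x => A x.1) (fun x => .pair (.pair (.pair (b x.1) x.2.1.1.encode)
        (f x.1 x.2.1.1.R)) (f x.1 x.2.1.1.L))
        (fun x => .pair (b x.1) (.pair (.pair x.2.1.1.L.encode x.2.1.1.R.encode)
          (.pair (f x.1 x.2.1.1.L) (f x.1 x.2.1.1.R)))) := by
      have i1 := h0.fst.fst.fst
      have i2 := h0.fst.snd
      have i3 := h0.snd
      infer_instance
    have key : ∀ c : (∀ α : Type u, Formula α → Formula α → Formula α), (∀ b' : (∀ x : (Σ ω, Formula (A ω) × Formula (A ω)), Tree (A x.1)),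
      (∀ Y, Cmp b Y → Cmp b' fun x => Y x.1) →
      Cmp b' (fun x => x.2.1.encode) → Cmp b' (fun x => x.2.2.encode) →
      Cmp b' (fun x => f x.1 x.2.1) → Cmp b' (fun x => f x.1 x.2.2) →
      Cmp b' fun x => f x.1 (c _ x.2.1 x.2.2)) → Cmp (Ω := Σ ω, {i : {G : Formula (A ω) // S ω G} // (i.1.tag = 3 ∨ i.1.tag = 4)})
      (A := fun x => A x.1) (fun x => .pair (.pair (.pair (b x.1) x.2.1.1.encode)
        (f x.1 x.2.1.1.R)) (f x.1 x.2.1.1.L)) (fun x => f x.1 (c _ x.2.1.1.L x.2.1.1.R)) := by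
      intro c hc
      have H := hc (fun x => .pair (b x.1) (.pair (.pair x.2.1.encode x.2.2.encode)
          (.pair (f x.1 x.2.1) (f x.1 x.2.2)))) (fun Y hY => Cmp.refl.fst.trans (hY.pull _))
          Cmp.refl.snd.fst.fst Cmp.refl.snd.fst.snd Cmp.refl.snd.snd.fst Cmp.refl.snd.snd.snd
      exact hbase.trans (H.pull fun x : Σ ω, {i : {G : Formula (A ω) // S ω G} // (i.1.tag = 3 ∨ i.1.tag = 4)} => ⟨x.1, x.2.1.1.L, x.2.1.1.R⟩)
    refine Cmp.cases (fun x => x.2.1.1.tag = 3) ?_ ?_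
    · exact ((key (fun _ => .or) hor).pull _).congr fun x =>
        congrArg (f x.1.1) (Formula.eq_or_of_tag x.2).symm
    · exact ((key (fun _ => .and) hand).pull _).congr fun x =>
        congrArg (f x.1.1) (Formula.eq_and_of_tag (x.1.2.2.resolve_left x.2)).symm
  · exact fun ω G h => Formula.size_encode_children h
  · intro ω i; have := hM₁ ω _ i.2; simp only [Tree.size]; omega
  · intro ω i; have := hM₂ ω _ i.2; omega
  · intro ω i; have := hM₁ ω _ i.2; omega

/-- Structural recursion on a formula. -/
theorem Cmp.formulaRec (F : ∀ ω, Formula (A ω)) (f : ∀ ω, Formula (A ω) → Tree (A ω))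
    (M : Ω → ℕ) [hM : Bd b M]
    (hf : ∀ ω G, G.encode.size ≤ (F ω).encode.size → (f ω G).size ≤ M ω)
    [h₀ : Cmp b fun ω => (F ω).encode]
    (hff : Cmp b fun ω => f ω .ff) (htt : Cmp b fun ω => f ω .tt)
    (hatom : ∀ b' : (∀ x : (Σ ω, A ω), Tree (A x.1)), (∀ Y, Cmp b Y → Cmp b' fun x => Y x.1) →
      Cmp b' (fun x => .atom x.2) → Cmp b' fun x => f x.1 (.atom x.2))
    (hor : ∀ b' : (∀ x : (Σ ω, Formula (A ω) × Formula (A ω)), Tree (A x.1)),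
      (∀ Y, Cmp b Y → Cmp b' fun x => Y x.1) →
      Cmp b' (fun x => x.2.1.encode) → Cmp b' (fun x => x.2.2.encode) →
      Cmp b' (fun x => f x.1 x.2.1) → Cmp b' (fun x => f x.1 x.2.2) →
      Cmp b' fun x => f x.1 (.or x.2.1 x.2.2))
    (hand : ∀ b' : (∀ x : (Σ ω, Formula (A ω) × Formula (A ω)), Tree (A x.1)),
      (∀ Y, Cmp b Y → Cmp b' fun x => Y x.1) →
      Cmp b' (fun x => x.2.1.encode) → Cmp b' (fun x => x.2.2.encode) →
      Cmp b' (fun x => f x.1 x.2.1) → Cmp b' (fun x => f x.1 x.2.2) →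
      Cmp b' fun x => f x.1 (.and x.2.1 x.2.2)) :
    Cmp b fun ω => f ω (F ω) := by
  have hM' : Bd b fun ω => (F ω).encode.size + M ω := inferInstance
  refine Cmp.formulaRecOn F f (fun ω G => G.encode.size ≤ (F ω).encode.size) (fun _ => le_rfl)
    ?_ ?_ (fun ω => (F ω).encode.size + M ω) (hM := hM') (fun ω G h => h.trans (Nat.le_add_right _ _))
    (fun ω G h => (hf ω G h).trans (Nat.le_add_left _ _)) h₀ hff htt hatom hor hand
  all_goals
    refine fun ω G h => le_trans ?_ h
    cases G <;> simp only [Formula.L, Formula.R, Formula.encode, Tree.size_tagged, Tree.size] <;>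
      omega

/-! #### Recursion on numbers -/

/-- In the step the index comes with a proof that it is below `n ω`, so that table lookups remain in
range there. -/
theorem Cmp.natRec (n : Ω → ℕ) (f : ∀ ω, ℕ → Tree (A ω)) (M : Ω → ℕ) [hM : Bd b M]
    (hf : ∀ ω k, k ≤ n ω → (f ω k).size ≤ M ω) [h₀ : Cmp b fun ω => Tree.num (n ω)]
    (hz : Cmp b fun ω => f ω 0)
    (hs : ∀ b' : (∀ x : (Σ ω : Ω, {k // k < n ω}), Tree (A x.1)),
      (∀ Y, Cmp b Y → Cmp b' fun x => Y x.1) → Cmp b' (fun x => Tree.num x.2.1) →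
      Cmp b' (fun x => f x.1 x.2.1) → Cmp b' fun x => f x.1 (x.2.1 + 1)) :
    Cmp b fun ω => f ω (n ω) := by
  have hB : Bd b fun ω => (b ω).size + M ω + (Tree.num (A := A ω) (n ω)).size + 1 := inferInstance
  refine Cmp.rec1 (b := b) (I := fun ω => {k : ℕ // k ≤ n ω})
    (fun ω k => .pair (b ω) (.num k.1)) (fun ω k => f ω k.1)
    (fun ω k => k.1 ≠ 0) (fun ω k => ⟨k.1 - 1, (Nat.sub_le _ _).trans k.2⟩)
    (fun ω k => k.1) ?_ ?_ ?_ ?_ ?_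
    (fun ω => (b ω).size + M ω + (Tree.num (A := A ω) (n ω)).size + 1) (hM := hB) ?_ ?_ ?_
    (fun ω => ⟨n ω, le_rfl⟩) inferInstance
  · have h := (Cmp.refl (Ω := Σ ω, {k : ℕ // k ≤ n ω}) (A := fun x => A x.1)
      (b := fun x => .pair (b x.1) (.num x.2.1))).snd
    refine (Cmp.btNot (hc := Cmp.btEq (hX := h) (hY := Cmp.nil))).congr fun x => ?_
    rcases x with ⟨ω, ⟨_ | k, hk⟩⟩ <;> simp [Tree.num]
  · have h := (Cmp.refl (Ω := Σ ω, {i : {k : ℕ // k ≤ n ω} // ¬ i.1 ≠ 0}) (A := fun x => A x.1)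
      (b := fun x => .pair (b x.1) (.num x.2.1.1))).fst
    exact (h.trans (hz.pull _)).congr fun x => congrArg (f x.1) (not_not.1 x.2.2).symm
  · have h := Cmp.refl (Ω := Σ ω, {i : {k : ℕ // k ≤ n ω} // i.1 ≠ 0}) (A := fun x => A x.1)
      (b := fun x => .pair (b x.1) (.num x.2.1.1))
    refine (Cmp.pair (h₁ := h.fst) (h₂ := h.snd.op .tail)).congr fun x => ?_
    rcases x with ⟨ω, ⟨⟨_ | k, hk⟩, hk'⟩⟩ <;> simp [Tree.num, Op.eval] at hk' ⊢
  · have h := Cmp.refl (Ω := Σ ω, {i : {k : ℕ // k ≤ n ω} // i.1 ≠ 0}) (A := fun x => A x.1)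
      (b := fun x => .pair (.pair (b x.1) (.num x.2.1.1)) (f x.1 (x.2.1.1 - 1)))
    have H := hs (fun x => .pair (b x.1) (.pair (.num x.2.1) (f x.1 x.2.1)))
      (fun Y hY => Cmp.refl.fst.trans (hY.pull _)) Cmp.refl.snd.fst Cmp.refl.snd.snd
    have H' := H.pull (fun x : Σ ω, {i : {k : ℕ // k ≤ n ω} // i.1 ≠ 0} =>
      (⟨x.1, x.2.1.1 - 1, by have := x.2.1.2; have := x.2.2; omega⟩ : Σ ω : Ω, {k // k < n ω}))
    have hp : ∀ x : Σ ω, {i : {k : ℕ // k ≤ n ω} // i.1 ≠ 0}, x.2.1.1 - 1 + 1 = x.2.1.1 :=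
      fun x => Nat.sub_add_cancel (Nat.one_le_iff_ne_zero.2 x.2.2)
    refine (Cmp.trans (Cmp.pair (h₁ := h.fst.fst) (h₂ := Cmp.pair
      (h₁ := (h.fst.snd.op .tail).congr fun x => ?_) (h₂ := h.snd))) H').congr fun x => ?_
    · show Op.tail.eval (Tree.num x.2.1.1) = Tree.num (x.2.1.1 - 1)
      conv_lhs => rw [← hp x]
      simp [Tree.num, Op.eval]
    · exact congrArg (f x.1) (hp x)
  · intro ω i h; have := Nat.one_le_iff_ne_zero.2 h; dsimp only; omega
  · intro ω i; have := i.2; simp only [Tree.size, Tree.size_num]; omega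
  · intro ω i; have := hf ω _ i.2; omega
  · intro ω i; have := i.2; simp only [Tree.size_num]; omega

end

/-! #### Recursion on lists -/

/-- Lists as trees. -/
def encL {B : Type u} {X : Type w} (e : X → Tree B) : List X → Tree B
  | [] => .nil
  | x :: l => .pair (e x) (encL e l)

theorem encodeSteps_eq {B : Type u} (l : List (Step B)) : encodeSteps l = encL Step.encode l := by
  induction l with
  | nil => rfl
  | cons x l ih => rw [encodeSteps, encL, ih]

theorem encL_size_suffix {B : Type u} {X : Type w} (e : X → Tree B) {l m : List X} (h : l <:+ m) :
    (encL e l).size ≤ (encL e m).size := by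
  obtain ⟨k, rfl⟩ := h
  induction k with
  | nil => rfl
  | cons x k ih => simp only [List.cons_append, encL, Tree.size]; omega

theorem length_le_encL {B : Type u} {X : Type w} (e : X → Tree B) (l : List X) :
    l.length + 1 ≤ (encL e l).size := by
  induction l with
  | nil => simp [encL, Tree.size]
  | cons x l ih => simp only [List.length_cons, encL, Tree.size]; omega

theorem encL_size_le {B : Type u} {X : Type w} (e : X → Tree B) (l : List X) (k : ℕ)
    (h : ∀ x ∈ l, (e x).size ≤ k) : (encL e l).size ≤ l.length * (k + 1) + 1 := by
  induction l with
  | nil => simp [encL, Tree.size]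
  | cons x l ih =>
    have h1 := h x (by simp)
    have h2 := ih fun y hy => h y (by simp [hy])
    simp only [List.length_cons, encL, Tree.size]
    rw [add_mul, one_mul]
    omega

theorem size_le_encL {B : Type u} {X : Type w} (e : X → Tree B) {l : List X} {x : X} (h : x ∈ l) :
    (e x).size ≤ (encL e l).size := by
  induction l with
  | nil => simp at h
  | cons y l ih =>
    simp only [encL, Tree.size]
    rcases List.mem_cons.1 h with rfl | h
    · omega
    · have := ih h; omega

section
variable {Ω : Type v} {A : Ω → Type u} [∀ ω, Atoms (A ω)] {b : ∀ ω, Tree (A ω)}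
  {X : Ω → Type w} {e : ∀ ω, X ω → Tree (A ω)}

instance Cmp.listNil : Cmp b fun ω => encL (e ω) [] := Cmp.nil

instance Cmp.listCons {x : ∀ ω, X ω} {l : ∀ ω, List (X ω)} [Cmp b fun ω => e ω (x ω)]
    [Cmp b fun ω => encL (e ω) (l ω)] : Cmp b fun ω => encL (e ω) (x ω :: l ω) := by
  simp only [encL]; infer_instance

theorem Cmp.listIsNil (e : ∀ ω, X ω → Tree (A ω)) {l : ∀ ω, List (X ω)} [Cmp b fun ω => encL (e ω) (l ω)] :
    Cmp b fun ω => bt (l ω = []) :=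
  (Cmp.btEq (b := b) (X := fun ω => encL (e ω) (l ω)) (Y := fun _ => .nil)).congr fun ω => by
    cases l ω <;> simp [encL]

instance Cmp.listTail {l : ∀ ω, List (X ω)} [h : Cmp b fun ω => encL (e ω) (l ω)] :
    Cmp b fun ω => encL (e ω) (l ω).tail :=
  (h.op .tail).congr fun ω => by cases l ω <;> simp [encL, Op.eval]

theorem Cmp.listRec (l : ∀ ω, List (X ω)) (f : ∀ ω, List (X ω) → Tree (A ω)) (M : Ω → ℕ)
    [hM : Bd b M] (hf : ∀ ω k, k <:+ l ω → (f ω k).size ≤ M ω)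
    [h₀ : Cmp b fun ω => encL (e ω) (l ω)]
    (hnil : Cmp b fun ω => f ω [])
    (hcons : ∀ b' : (∀ x : (Σ ω, X ω × List (X ω)), Tree (A x.1)),
      (∀ Y, Cmp b Y → Cmp b' fun x => Y x.1) →
      Cmp b' (fun x => e x.1 x.2.1) → Cmp b' (fun x => encL (e x.1) x.2.2) →
      Cmp b' (fun x => f x.1 x.2.2) → Cmp b' fun x => f x.1 (x.2.1 :: x.2.2)) :
    Cmp b fun ω => f ω (l ω) := by
  have hB : Bd b fun ω => (b ω).size + M ω + (encL (e ω) (l ω)).size + 1 := inferInstance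
  refine Cmp.rec1 (b := b) (I := fun ω => {k : List (X ω) // k <:+ l ω})
    (fun ω k => .pair (b ω) (encL (e ω) k.1)) (fun ω k => f ω k.1)
    (fun ω k => ¬ k.1 = []) (fun ω k => ⟨k.1.tail, (List.tail_suffix _).trans k.2⟩)
    (fun ω k => k.1.length) ?_ ?_ ?_ ?_ ?_
    (fun ω => (b ω).size + M ω + (encL (e ω) (l ω)).size + 1) (hM := hB) ?_ ?_ ?_
    (fun ω => ⟨l ω, List.suffix_rfl⟩) inferInstance
  · have h := (Cmp.refl (Ω := Σ ω, {k : List (X ω) // k <:+ l ω}) (A := fun x => A x.1)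
      (b := fun x => .pair (b x.1) (encL (e x.1) x.2.1))).snd
    exact Cmp.btNot (hc := Cmp.listIsNil (fun x : Σ ω, {k : List (X ω) // k <:+ l ω} => e x.1)
      (l := fun x => x.2.1))
  · have h := (Cmp.refl (Ω := Σ ω, {i : {k : List (X ω) // k <:+ l ω} // ¬ ¬ i.1 = []})
      (A := fun x => A x.1) (b := fun x => .pair (b x.1) (encL (e x.1) x.2.1.1))).fst
    exact (h.trans (hnil.pull _)).congr fun x => congrArg (f x.1) (not_not.1 x.2.2).symm
  · have h := Cmp.refl (Ω := Σ ω, {i : {k : List (X ω) // k <:+ l ω} // ¬ i.1 = []})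
      (A := fun x => A x.1) (b := fun x => .pair (b x.1) (encL (e x.1) x.2.1.1))
    have h1 := h.fst
    have h2 := h.snd
    exact Cmp.pair (h₂ := Cmp.listTail
      (e := fun x : Σ ω, {i : {k : List (X ω) // k <:+ l ω} // ¬ i.1 = []} => e x.1)
      (l := fun x => x.2.1.1))
  · have h := Cmp.refl (Ω := Σ ω, {i : {k : List (X ω) // k <:+ l ω} // ¬ i.1 = []})
      (A := fun x => A x.1)
      (b := fun x => .pair (.pair (b x.1) (encL (e x.1) x.2.1.1)) (f x.1 x.2.1.1.tail))
    have H := hcons (fun x => .pair (b x.1) (.pair (.pair (e x.1 x.2.1) (encL (e x.1) x.2.2))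
      (f x.1 x.2.2))) (fun Y hY => Cmp.refl.fst.trans (hY.pull _)) Cmp.refl.snd.fst.fst
      Cmp.refl.snd.fst.snd Cmp.refl.snd.snd
    have hp : ∀ x : Σ ω, {i : {k : List (X ω) // k <:+ l ω} // ¬ i.1 = []},
      x.2.1.1.head x.2.2 :: x.2.1.1.tail = x.2.1.1 := fun x => List.cons_head_tail _
    have H' := H.pull (fun x : Σ ω, {i : {k : List (X ω) // k <:+ l ω} // ¬ i.1 = []} =>
      (⟨x.1, x.2.1.1.head x.2.2, x.2.1.1.tail⟩ : Σ ω, X ω × List (X ω)))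
    exact (Cmp.trans (Cmp.pair (h₁ := h.fst.fst) (h₂ := Cmp.pair (h₁ := h.fst.snd.congr fun x =>
      (congrArg (encL (e x.1)) (hp x)).symm) (h₂ := h.snd))) H').congr fun x =>
      congrArg (f x.1) (hp x)
  · intro ω i h
    have : i.1.length ≠ 0 := fun h' => h (List.length_eq_zero_iff.1 h')
    simp only [List.length_tail]; omega
  · intro ω i; have := encL_size_suffix (e ω) i.2; simp only [Tree.size]; omega
  · intro ω i; have := hf ω _ i.2; omega
  · intro ω i
    have := encL_size_suffix (e ω) i.2
    have := length_le_encL (e ω) i.1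
    omega

end

/-! #### Recursion on contexts -/

section
variable {B : Type u}

/-- The number of the outermost constructor. -/
def Context.tag : Context B → ℕ
  | .hole => 0
  | .orLeft _ _ => 1
  | .orRight _ _ => 2
  | .andLeft _ _ => 3
  | .andRight _ _ => 4

/-- The immediate subcontext, if there is one. -/
def Context.sub : Context B → Context B
  | .hole => .hole
  | .orLeft ξ _ => ξ
  | .orRight _ ξ => ξ
  | .andLeft ξ _ => ξ
  | .andRight _ ξ => ξ

/-- The immediate subformula beside the hole, if there is one. -/
def Context.side : Context B → Formula B
  | .hole => .ff
  | .orLeft _ β => β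
  | .orRight α _ => α
  | .andLeft _ β => β
  | .andRight α _ => α

end

section
variable {Ω : Type v} {A : Ω → Type u} [∀ ω, Atoms (A ω)] {b : ∀ ω, Tree (A ω)}

instance Cmp.hole : Cmp b fun _ => Context.hole.encode := by unfold Context.encode; infer_instance

section
variable {ξ : ∀ ω, Context (A ω)} {β : ∀ ω, Formula (A ω)} [h : Cmp b fun ω => (ξ ω).encode]

instance Cmp.orLeft [Cmp b fun ω => (β ω).encode] :
    Cmp b fun ω => (Context.orLeft (ξ ω) (β ω)).encode := by
  simp only [Context.encode]; infer_instance

instance Cmp.orRight [Cmp b fun ω => (β ω).encode] :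
    Cmp b fun ω => (Context.orRight (β ω) (ξ ω)).encode := by
  simp only [Context.encode]; infer_instance

instance Cmp.andLeft [Cmp b fun ω => (β ω).encode] :
    Cmp b fun ω => (Context.andLeft (ξ ω) (β ω)).encode := by
  simp only [Context.encode]; infer_instance

instance Cmp.andRight [Cmp b fun ω => (β ω).encode] :
    Cmp b fun ω => (Context.andRight (β ω) (ξ ω)).encode := by
  simp only [Context.encode]; infer_instance

instance Cmp.btCtxTagEq {n : ℕ} : Cmp b fun ω => bt ((ξ ω).tag = n) :=
  (Cmp.btEq (hX := h.op .head) (hY := Cmp.num n)).congr fun ω => by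
    cases ξ ω <;> simp [Context.encode, Tree.tagged, Op.eval, Context.tag,
      Tree.num_injective.eq_iff]

instance Cmp.ctxSub : Cmp b fun ω => (ξ ω).sub.encode :=
  (Cmp.ite (d := fun _ => inferInstance) (c := fun ω => (ξ ω).tag = 0) inferInstance h
    (Cmp.ite (d := fun _ => inferInstance) (c := fun ω => (ξ ω).tag = 1 ∨ (ξ ω).tag = 3)
    inferInstance ((h.op .tail).op .head) ((h.op .tail).op .tail))).congr fun ω => by
    cases h : ξ ω <;> simp [Context.encode, Tree.tagged, Op.eval, Context.tag, Context.sub]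

instance Cmp.ctxSide : Cmp b fun ω => (ξ ω).side.encode :=
  (Cmp.ite (d := fun _ => inferInstance) (c := fun ω => (ξ ω).tag = 0) inferInstance Cmp.ff
    (Cmp.ite (d := fun _ => inferInstance) (c := fun ω => (ξ ω).tag = 1 ∨ (ξ ω).tag = 3)
    inferInstance ((h.op .tail).op .tail) ((h.op .tail).op .head))).congr fun ω => by
    cases h : ξ ω <;> simp [Context.encode, Tree.tagged, Op.eval, Context.tag, Context.side]

end

theorem Context.size_sub {B : Type u} (ξ : Context B) :
    ξ.sub.encode.size ≤ ξ.encode.size ∧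
      (ξ.tag ≠ 0 → ξ.sub.encode.size + 1 ≤ ξ.encode.size) := by
  cases ξ <;> simp only [tag, sub, encode, Tree.size_tagged, Tree.size] <;> omega

/-- The four kinds of nodes share one step hypothesis, since each has exactly one immediate
subcontext; applications distinguish them by `Context.tag`. -/
theorem Cmp.contextRec (ξ : ∀ ω, Context (A ω)) (f : ∀ ω, Context (A ω) → Tree (A ω))
    (M : Ω → ℕ) [hM : Bd b M]
    (hf : ∀ ω ζ, ζ.encode.size ≤ (ξ ω).encode.size → (f ω ζ).size ≤ M ω)
    [h₀ : Cmp b fun ω => (ξ ω).encode] (hhole : Cmp b fun ω => f ω .hole)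
    (hnode : ∀ b' : (∀ x : (Σ ω, {ζ : Context (A ω) // ζ.tag ≠ 0}), Tree (A x.1)),
      (∀ Y, Cmp b Y → Cmp b' fun x => Y x.1) → Cmp b' (fun x => x.2.1.encode) →
      Cmp b' (fun x => f x.1 x.2.1.sub) → Cmp b' fun x => f x.1 x.2.1) :
    Cmp b fun ω => f ω (ξ ω) := by
  have hB : Bd b fun ω => (b ω).size + M ω + (ξ ω).encode.size + 1 := inferInstance
  refine Cmp.rec1 (b := b) (I := fun ω => {ζ : Context (A ω) // ζ.encode.size ≤ (ξ ω).encode.size})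
    (fun ω k => .pair (b ω) k.1.encode) (fun ω k => f ω k.1)
    (fun ω k => k.1.tag ≠ 0) (fun ω k => ⟨k.1.sub, k.1.size_sub.1.trans k.2⟩)
    (fun ω k => k.1.encode.size) ?_ ?_ ?_ ?_ (fun ω k h => k.1.size_sub.2 h)
    (fun ω => (b ω).size + M ω + (ξ ω).encode.size + 1) (hM := hB) ?_ ?_ ?_
    (fun ω => ⟨ξ ω, le_rfl⟩) inferInstance
  · have h := (Cmp.refl (Ω := Σ ω, {ζ : Context (A ω) // ζ.encode.size ≤ (ξ ω).encode.size})
      (A := fun x => A x.1) (b := fun x => .pair (b x.1) x.2.1.encode)).snd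
    infer_instance
  · have h := (Cmp.refl (Ω := Σ ω, {i : {ζ : Context (A ω) // ζ.encode.size ≤ (ξ ω).encode.size} //
      ¬ i.1.tag ≠ 0}) (A := fun x => A x.1) (b := fun x => .pair (b x.1) x.2.1.1.encode)).fst
    refine (h.trans (hhole.pull _)).congr fun x => congrArg (f x.1) ?_
    have := x.2.2
    revert this
    cases x.2.1.1 <;> simp [Context.tag]
  · have h := Cmp.refl (Ω := Σ ω, {i : {ζ : Context (A ω) // ζ.encode.size ≤ (ξ ω).encode.size} //
      i.1.tag ≠ 0}) (A := fun x => A x.1) (b := fun x => .pair (b x.1) x.2.1.1.encode)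
    have h1 := h.fst
    have h2 := h.snd
    infer_instance
  · have h := Cmp.refl (Ω := Σ ω, {i : {ζ : Context (A ω) // ζ.encode.size ≤ (ξ ω).encode.size} //
      i.1.tag ≠ 0}) (A := fun x => A x.1)
      (b := fun x => .pair (.pair (b x.1) x.2.1.1.encode) (f x.1 x.2.1.1.sub))
    have H := hnode (fun x => .pair (b x.1) (.pair x.2.1.encode (f x.1 x.2.1.sub)))
      (fun Y hY => Cmp.refl.fst.trans (hY.pull _)) Cmp.refl.snd.fst Cmp.refl.snd.snd
    have H' := H.pull (fun x : Σ ω, {i : {ζ : Context (A ω) // ζ.encode.size ≤ (ξ ω).encode.size} //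
      i.1.tag ≠ 0} => (⟨x.1, x.2.1.1, x.2.2⟩ : Σ ω, {ζ : Context (A ω) // ζ.tag ≠ 0}))
    exact Cmp.trans (Cmp.pair (h₁ := h.fst.fst) (h₂ := Cmp.pair (h₁ := h.fst.snd) (h₂ := h.snd))) H'
  · intro ω i; have := i.2; simp only [Tree.size]; omega
  · intro ω i; have := hf ω _ i.2; omega
  · intro ω i; have := i.2; omega

end
end DeepInference

/-! ### Derivation terms, their expansion into derivations, and the removal of coweakening. -/

namespace DeepInference

/-! ### Derivation terms -/

/-- The linear rules: the equations in both directions, switch and medial. -/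
inductive Lin : Type
  | orC | andC | orA | orA' | andA | andA' | orF | orF' | andT | andT' | orT | orT' | andF | andF'
  | sw | md

/-- The rules of derivation terms; `W` is weakening by an arbitrary formula. -/
inductive Rul : Type
  | lin (i : Lin) | ai | aw | ac | awu | acu | W

/-- Derivation terms: derivations that are composed vertically and by the connectives, without
mention of any formula. -/
inductive OD : Type
  | id
  | rule (ρ : Rul)
  | or (D E : OD)
  | and (D E : OD)
  | comp (D E : OD)

infixl:65 " ⨾ " => OD.comp

/-- A linear rule as a derivation term. -/
abbrev OD.l (i : Lin) : OD := .rule (.lin i)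

section
variable {B : Type u}

open Formula in
/-- The instances of the linear rules. -/
inductive LinRel : Lin → Formula B → Formula B → Prop
  | orC (α β) : LinRel .orC (or α β) (or β α)
  | andC (α β) : LinRel .andC (and α β) (and β α)
  | orA (α β γ) : LinRel .orA (or (or α β) γ) (or α (or β γ))
  | orA' (α β γ) : LinRel .orA' (or α (or β γ)) (or (or α β) γ)
  | andA (α β γ) : LinRel .andA (and (and α β) γ) (and α (and β γ))
  | andA' (α β γ) : LinRel .andA' (and α (and β γ)) (and (and α β) γ)
  | orF (α) : LinRel .orF (or α ff) α
  | orF' (α) : LinRel .orF' α (or α ff)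
  | andT (α) : LinRel .andT (and α tt) α
  | andT' (α) : LinRel .andT' α (and α tt)
  | orT : LinRel .orT (or tt tt) tt
  | orT' : LinRel .orT' tt (or tt tt)
  | andF : LinRel .andF (and ff ff) ff
  | andF' : LinRel .andF' ff (and ff ff)
  | sw (α β γ) : LinRel .sw (and α (or β γ)) (or (and α β) γ)
  | md (α β γ δ) : LinRel .md (or (and α β) (and γ δ)) (and (or α γ) (or β δ))

/-- The premiss of a linear rule, from the conclusion. -/
def Lin.up : Lin → Formula B → Formula B
  | .orC, F => .or F.R F.L
  | .andC, F => .and F.R F.L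
  | .orA, F => .or (.or F.L F.R.L) F.R.R
  | .orA', F => .or F.L.L (.or F.L.R F.R)
  | .andA, F => .and (.and F.L F.R.L) F.R.R
  | .andA', F => .and F.L.L (.and F.L.R F.R)
  | .orF, F => .or F .ff
  | .orF', F => F.L
  | .andT, F => .and F .tt
  | .andT', F => F.L
  | .orT, _ => .or .tt .tt
  | .orT', _ => .tt
  | .andF, _ => .and .ff .ff
  | .andF', _ => .ff
  | .sw, F => .and F.L.L (.or F.L.R F.R)
  | .md, F => .or (.and F.L.L F.R.L) (.and F.L.R F.R.R)

/-- The conclusion of a linear rule, from the premiss. -/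
def Lin.down : Lin → Formula B → Formula B
  | .orC, F => .or F.R F.L
  | .andC, F => .and F.R F.L
  | .orA', F => .or (.or F.L F.R.L) F.R.R
  | .orA, F => .or F.L.L (.or F.L.R F.R)
  | .andA', F => .and (.and F.L F.R.L) F.R.R
  | .andA, F => .and F.L.L (.and F.L.R F.R)
  | .orF', F => .or F .ff
  | .orF, F => F.L
  | .andT', F => .and F .tt
  | .andT, F => F.L
  | .orT', _ => .or .tt .tt
  | .orT, _ => .tt
  | .andF', _ => .and .ff .ff
  | .andF, _ => .ff
  | .sw, F => .or (.and F.L F.R.L) F.R.R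
  | .md, F => .and (.or F.L.L F.R.L) (.or F.L.R F.R.R)

theorem LinRel.up_eq {i : Lin} {u l : Formula B} (h : LinRel i u l) : i.up l = u := by
  cases h <;> rfl

theorem LinRel.down_eq {i : Lin} {u l : Formula B} (h : LinRel i u l) : i.down u = l := by
  cases h <;> rfl

/-- The selectors `L` and `R` return default values on formulae of the wrong shape, so one of the
equations alone does not give an instance. Both together do, which lets a program recognise
instances by comparing formulae. -/
theorem linRel_of {i : Lin} {u l : Formula B} (h : i.up l = u) (h' : i.down u = l) :
    LinRel i u l := by
  cases i <;> simp only [Lin.up, Lin.down] at h h' <;> subst h <;>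
    (try simp only [Formula.L, Formula.R] at h') <;> (try rw [← h'] ) <;>
    (try simp only [Formula.L, Formula.R]) <;> constructor

/-- The name of a linear rule. -/
def Lin.name : Lin → Rule
  | .sw => .switch
  | .md => .medial
  | _ => .equal

theorem LinRel.inst [Atoms B] {i : Lin} {u l : Formula B} (h : LinRel i u l) :
    Instance i.name u l := by
  cases h <;> first
    | exact .switch _ _ _
    | exact .medial _ _ _ _
    | exact .equal (by constructor)
    | exact .equalSymm (by constructor)

theorem exists_linRel [Atoms B] {ρ : Rule} {u l : Formula B} (h : Instance ρ u l)
    (hρ : ρ = .switch ∨ ρ = .medial ∨ ρ = .equal) : ∃ i, LinRel i u l := by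
  cases h with
  | switch => exact ⟨_, .sw _ _ _⟩
  | medial => exact ⟨_, .md _ _ _ _⟩
  | equal h =>
    cases h
    exacts [⟨_, .orC _ _⟩, ⟨_, .andC _ _⟩, ⟨_, .orA _ _ _⟩, ⟨_, .andA _ _ _⟩, ⟨_, .orF _⟩,
      ⟨_, .andT _⟩, ⟨_, .orT⟩, ⟨_, .andF⟩]
  | equalSymm h =>
    cases h
    exacts [⟨_, .orC _ _⟩, ⟨_, .andC _ _⟩, ⟨_, .orA' _ _ _⟩, ⟨_, .andA' _ _ _⟩, ⟨_, .orF' _⟩,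
      ⟨_, .andT' _⟩, ⟨_, .orT'⟩, ⟨_, .andF'⟩]
  | _ => simp at hρ

/-- Formulae with an inductive relation `R` on the rules derive each other along a term. -/
inductive Der (R : Rul → Formula B → Formula B → Prop) : OD → Formula B → Formula B → Prop
  | id (α) : Der R .id α α
  | rule {ρ α β} (h : R ρ α β) : Der R (.rule ρ) α β
  | or {D E α β γ δ} (h : Der R D α β) (h' : Der R E γ δ) : Der R (.or D E) (.or α γ) (.or β δ)
  | and {D E α β γ δ} (h : Der R D α β) (h' : Der R E γ δ) :
      Der R (.and D E) (.and α γ) (.and β δ)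
  | comp {D E α β γ} (h : Der R D α β) (h' : Der R E β γ) : Der R (D ⨾ E) α γ

theorem Der.mono {R S : Rul → Formula B → Formula B → Prop} (hRS : ∀ ρ α β, R ρ α β → S ρ α β)
    {D : OD} {α β : Formula B} (h : Der R D α β) : Der S D α β := by
  induction h with
  | id => exact .id _
  | rule h => exact .rule (hRS _ _ _ h)
  | or _ _ ih ih' => exact .or ih ih'
  | and _ _ ih ih' => exact .and ih ih'
  | comp _ _ ih ih' => exact .comp ih ih'

open Formula in
/-- The rules of analytic `SKS`. -/
inductive Raw [Atoms B] : Rul → Formula B → Formula B → Prop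
  | lin {i u l} (h : LinRel i u l) : Raw (.lin i) u l
  | ai (a) : Raw .ai tt (or (atom a) (atom (Atoms.dual a)))
  | aw (a) : Raw .aw ff (atom a)
  | ac (a) : Raw .ac (or (atom a) (atom a)) (atom a)
  | acu (a) : Raw .acu (atom a) (and (atom a) (atom a))

open Formula in
/-- The rules of analytic `SKS`, coweakening, and general weakening. -/
inductive Full [Atoms B] : Rul → Formula B → Formula B → Prop
  | raw {ρ u l} (h : Raw ρ u l) : Full ρ u l
  | awu (a) : Full .awu (atom a) tt
  | W (α) : Full .W ff α

variable [Atoms B]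

theorem Der.l {i : Lin} {u l : Formula B} (h : LinRel i u l) : Der Raw (.l i) u l := .rule (.lin h)

theorem Der.fl {i : Lin} {u l : Formula B} (h : LinRel i u l) : Der Full (.l i) u l :=
  .rule (.raw (.lin h))

theorem Der.full {D : OD} {α β : Formula B} (h : Der Raw D α β) : Der Full D α β :=
  h.mono fun _ _ _ => .raw

theorem Der.W (α : Formula B) : Der Full (.rule .W) .ff α := .rule (.W _)

/-! #### General rules -/

/-- `[[α∨β]∨[γ∨δ]] → [[α∨γ]∨[β∨δ]]`. -/
def orMix : OD := .l .orA ⨾ .or .id (.l .orA' ⨾ .or (.l .orC) .id ⨾ .l .orA) ⨾ .l .orA'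

theorem der_orMix (α β γ δ : Formula B) :
    Der Raw orMix (.or (.or α β) (.or γ δ)) (.or (.or α γ) (.or β δ)) :=
  .comp (.comp (.l (.orA _ _ _)) (.or (.id _) (.comp (.comp (.l (.orA' _ _ _))
    (.or (.l (.orC _ _)) (.id _))) (.l (.orA _ _ _))))) (.l (.orA' _ _ _))

/-- `((α∧β)∧(γ∧δ)) → ((α∧γ)∧(β∧δ))`. -/
def andMix : OD := .l .andA ⨾ .and .id (.l .andA' ⨾ .and (.l .andC) .id ⨾ .l .andA) ⨾ .l .andA'

theorem der_andMix (α β γ δ : Formula B) :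
    Der Raw andMix (.and (.and α β) (.and γ δ)) (.and (.and α γ) (.and β δ)) :=
  .comp (.comp (.l (.andA _ _ _)) (.and (.id _) (.comp (.comp (.l (.andA' _ _ _))
    (.and (.l (.andC _ _)) (.id _))) (.l (.andA _ _ _))))) (.l (.andA' _ _ _))

/-- `f → t`. -/
def ffTt : OD :=
  .l .andT' ⨾ .and .id (.l .orT') ⨾ .l .sw ⨾ .or (.l .andT) .id ⨾ .l .orC ⨾ .l .orF

theorem der_ffTt : Der Raw (B := B) ffTt .ff .tt :=
  .comp (.comp (.comp (.comp (.comp (.l (.andT' _)) (.and (.id _) (.l .orT'))) (.l (.sw _ _ _)))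
    (.or (.l (.andT _)) (.id _))) (.l (.orC _ _))) (.l (.orF _))

/-- Weakening. -/
def wk : Formula B → OD
  | .ff => .id
  | .tt => ffTt
  | .atom _ => .rule .aw
  | .or α β => .l .orF' ⨾ .or (wk α) (wk β)
  | .and α β => .l .andF' ⨾ .and (wk α) (wk β)

theorem der_wk (α : Formula B) : Der Raw (wk α) .ff α := by
  induction α with
  | ff => exact .id _
  | tt => exact der_ffTt
  | atom a => exact .rule (.aw a)
  | or α β h h' => exact .comp (.l (.orF' _)) (.or h h')
  | and α β h h' => exact .comp (.l .andF') (.and h h')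

/-- Coweakening. -/
def cw : Formula B → OD
  | .ff => ffTt
  | .tt => .id
  | .atom _ => .rule .awu
  | .or α β => .or (cw α) (cw β) ⨾ .l .orT
  | .and α β => .and (cw α) (cw β) ⨾ .l .andT

theorem der_cw (α : Formula B) : Der Full (cw α) α .tt := by
  induction α with
  | ff => exact der_ffTt.full
  | tt => exact .id _
  | atom a => exact .rule (.awu a)
  | or α β h h' => exact .comp (.or h h') (.fl .orT)
  | and α β h h' => exact .comp (.and h h') (.fl (.andT _))

/-- Contraction. -/
def ct : Formula B → OD
  | .ff => .l .orF
  | .tt => .l .orT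
  | .atom _ => .rule .ac
  | .or α β => orMix ⨾ .or (ct α) (ct β)
  | .and α β => .l .md ⨾ .and (ct α) (ct β)

theorem der_ct (α : Formula B) : Der Raw (ct α) (.or α α) α := by
  induction α with
  | ff => exact .l (.orF _)
  | tt => exact .l .orT
  | atom a => exact .rule (.ac a)
  | or α β h h' => exact .comp (der_orMix _ _ _ _) (.or h h')
  | and α β h h' => exact .comp (.l (.md _ _ _ _)) (.and h h')

/-- Cocontraction. -/
def cc : Formula B → OD
  | .ff => .l .andF'
  | .tt => .l .andT'
  | .atom _ => .rule .acu
  | .or α β => .or (cc α) (cc β) ⨾ .l .md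
  | .and α β => .and (cc α) (cc β) ⨾ andMix

theorem der_cc (α : Formula B) : Der Raw (cc α) α (.and α α) := by
  induction α with
  | ff => exact .l .andF'
  | tt => exact .l (.andT' _)
  | atom a => exact .rule (.acu a)
  | or α β h h' => exact .comp (.or h h') (.l (.md _ _ _ _))
  | and α β h h' => exact .comp (.and h h') (der_andMix _ _ _ _)

/-- `α → [α∨β]`. -/
def orW : OD := .l .orF' ⨾ .or .id (.rule .W)

theorem der_orW (α β : Formula B) : Der Full orW α (.or α β) :=
  .comp (.fl (.orF' _)) (.or (.id _) (.W _))

/-- `α → [β∨α]`. -/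
def orW' : OD := .l .orF' ⨾ .l .orC ⨾ .or (.rule .W) .id

theorem der_orW' (α β : Formula B) : Der Full orW' α (.or β α) :=
  .comp (.comp (.fl (.orF' _)) (.fl (.orC _ _))) (.or (.W _) (.id _))

/-- `([α∨χ]∧[β∨χ]) → [(α∧β)∨χ]`, for a contraction `c` of `χ`. -/
def pullAnd (c : OD) : OD :=
  .l .sw ⨾ .or (.l .andC ⨾ .l .sw ⨾ .or (.l .andC) .id) .id ⨾ .l .orA ⨾ .or .id c

theorem der_pullAnd {c : OD} {χ : Formula B} (hc : Der Full c (.or χ χ) χ) (α β : Formula B) :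
    Der Full (pullAnd c) (.and (.or α χ) (.or β χ)) (.or (.and α β) χ) :=
  .comp (.comp (.comp (.fl (.sw _ _ _)) (.or (.comp (.comp (.fl (.andC _ _)) (.fl (.sw _ _ _)))
    (.or (.fl (.andC _ _)) (.id _))) (.id _))) (.fl (.orA _ _ _))) (.or (.id _) hc)

/-- `[[α∨χ]∨[β∨χ]] → [[α∨β]∨χ]`, for a contraction `c` of `χ`. -/
def pullOr (c : OD) : OD := orMix ⨾ .or .id c

theorem der_pullOr {c : OD} {χ : Formula B} (hc : Der Full c (.or χ χ) χ) (α β : Formula B) :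
    Der Full (pullOr c) (.or (.or α χ) (.or β χ)) (.or (.or α β) χ) :=
  .comp (der_orMix _ _ _ _).full (.or (.id _) hc)

end

/-! ### From derivation terms to derivations -/

section
variable {B : Type u}

/-- A step inside a larger context. -/
def Step.orL (β : Formula B) (s : Step B) : Step B := { s with context := .orLeft s.context β }

def Step.orR (α : Formula B) (s : Step B) : Step B := { s with context := .orRight α s.context }

def Step.andL (β : Formula B) (s : Step B) : Step B := { s with context := .andLeft s.context β }

def Step.andR (α : Formula B) (s : Step B) : Step B := { s with context := .andRight α s.context }

/-- The derivation with conclusion `F` that a term describes, as its premiss and its steps; `h`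
takes care of the rules. -/
def run (h : Rul → Formula B → Formula B × List (Step B)) :
    OD → Formula B → Formula B × List (Step B)
  | .id, F => (F, [])
  | .rule ρ, F => h ρ F
  | .or D E, F => (.or (run h D F.L).1 (run h E F.R).1,
      (run h D F.L).2.map (Step.orL (run h E F.R).1) ++ (run h E F.R).2.map (Step.orR F.L))
  | .and D E, F => (.and (run h D F.L).1 (run h E F.R).1,
      (run h D F.L).2.map (Step.andL (run h E F.R).1) ++ (run h E F.R).2.map (Step.andR F.L))
  | .comp D E, F => ((run h D (run h E F).1).1, (run h D (run h E F).1).2 ++ (run h E F).2)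

/-- A single step, as a derivation. -/
def single (ρ : Rule) (u l : Formula B) : Formula B × List (Step B) := (u, [⟨.hole, ρ, u, l⟩])

/-- The rules of analytic `SKS`. -/
def hRaw : Rul → Formula B → Formula B × List (Step B)
  | .lin i, F => single i.name (i.up F) F
  | .ai, F => single .aiDown .tt F
  | .aw, F => single .awDown .ff F
  -- Without the test, a contraction applied to a large formula would double it and destroy the
  -- bound `size_hRaw`, which is needed for ill-formed input too.
  | .ac, F => if F.tag = 2 then single .acDown (.or F F) F else (F, [])
  | .acu, F => single .acUp F.L F
  | _, F => (F, [])

/-- The derivation that replaces a rule, when some atoms of its conclusion have been replaced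
by `t`. -/
def patch : Rul → Formula B → OD
  | .ai, F =>
    if F.L.tag = 1 then .l .orF' ⨾ .or .id (wk F.R)
    else if F.R.tag = 1 then .l .orF' ⨾ .l .orC ⨾ .or (wk F.L) .id
    else .rule .ai
  | .aw, F => wk F
  | .ac, F => if F.tag = 1 then .l .orT else .rule .ac
  | .awu, _ => .id
  | .acu, F =>
    if F.L.tag = 1 then .l .andT' ⨾ .l .andC
    else if F.R.tag = 1 then .l .andT'
    else .rule .acu
  | .W, F => wk F
  | ρ, _ => .rule ρ

/-- The premiss of a rule, when some atoms of its conclusion have been replaced by `t`. -/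
def prem (ρ : Rul) (F : Formula B) : Formula B :=
  match ρ with
  -- The premisses of these three rules do not depend on `F`. Stating them outright makes
  -- `size_prem` immediate, with no analysis of `run` on the term `wk F`.
  | .aw => .ff
  | .W => .ff
  | .ai => .tt
  | _ => (run hRaw (patch ρ F) F).1

/-- The rules, when some atoms of their conclusions have been replaced by `t`. -/
def hFull (ρ : Rul) (F : Formula B) : Formula B × List (Step B) :=
  (prem ρ F, (run hRaw (patch ρ F) F).2)

/-- `Pr α β`: the formula `α` is `β` with some atoms replaced by `t`. -/
inductive Pr : Formula B → Formula B → Prop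
  | ff : Pr .ff .ff
  | tt : Pr .tt .tt
  | atom (a) : Pr (.atom a) (.atom a)
  | cut (a) : Pr .tt (.atom a)
  | or {α β γ δ} (h : Pr α β) (h' : Pr γ δ) : Pr (.or α γ) (.or β δ)
  | and {α β γ δ} (h : Pr α β) (h' : Pr γ δ) : Pr (.and α γ) (.and β δ)

theorem Pr.refl (α : Formula B) : Pr α α := by
  induction α <;> constructor <;> assumption

/-- Replacing atoms by t changes no connective and no unit, and linear rules inspect nothing else;
so the instance persists. -/
theorem Pr.linRel {i : Lin} {u l l' : Formula B} (h : LinRel i u l) (h' : Pr l' l) :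
    Pr (i.up l') u ∧ LinRel i (i.up l') l' := by
  cases h
  case orF => exact ⟨.or h' .ff, .orF _⟩
  case andT => exact ⟨.and h' .tt, .andT _⟩
  case orF' => cases h' with | or h1 h2 => cases h2; exact ⟨h1, .orF' _⟩
  case andT' => cases h' with | and h1 h2 => cases h2; exact ⟨h1, .andT' _⟩
  case orC => cases h' with | or h1 h2 => exact ⟨.or h2 h1, .orC _ _⟩
  case andC => cases h' with | and h1 h2 => exact ⟨.and h2 h1, .andC _ _⟩
  case orA => cases h' with | or h1 h2 => cases h2 with | or h2 h3 =>
    exact ⟨.or (.or h1 h2) h3, .orA _ _ _⟩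
  case orA' => cases h' with | or h1 h3 => cases h1 with | or h1 h2 =>
    exact ⟨.or h1 (.or h2 h3), .orA' _ _ _⟩
  case andA => cases h' with | and h1 h2 => cases h2 with | and h2 h3 =>
    exact ⟨.and (.and h1 h2) h3, .andA _ _ _⟩
  case andA' => cases h' with | and h1 h3 => cases h1 with | and h1 h2 =>
    exact ⟨.and h1 (.and h2 h3), .andA' _ _ _⟩
  case orT => cases h'; exact ⟨.or .tt .tt, .orT⟩
  case orT' => cases h' with | or h1 h2 => cases h1; cases h2; exact ⟨.tt, .orT'⟩
  case andF => cases h'; exact ⟨.and .ff .ff, .andF⟩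
  case andF' => cases h' with | and h1 h2 => cases h1; cases h2; exact ⟨.ff, .andF'⟩
  case sw => cases h' with | or h1 h3 => cases h1 with | and h1 h2 =>
    exact ⟨.and h1 (.or h2 h3), .sw _ _ _⟩
  case md => cases h' with | and h1 h2 => cases h1 with | or h1 h3 => cases h2 with | or h2 h4 =>
    exact ⟨.or (.and h1 h2) (.and h3 h4), .md _ _ _ _⟩

variable [Atoms B]

theorem IsChain.append {S : Set Rule} {α β γ : Formula B} {L M : List (Step B)}
    (h : IsChain S α L β) (h' : IsChain S β M γ) : IsChain S α (L ++ M) γ := by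
  induction L generalizing α with
  | nil => cases h; exact h'
  | cons s L ih => exact ⟨h.1, h.2.1, h.2.2.1, ih h.2.2.2⟩

theorem IsChain.orL {S : Set Rule} {α β : Formula B} {L : List (Step B)} (γ : Formula B)
    (h : IsChain S α L β) : IsChain S (.or α γ) (L.map (Step.orL γ)) (.or β γ) := by
  induction L generalizing α with
  | nil => cases h; rfl
  | cons s L ih => exact ⟨h.1, h.2.1, congrArg (Formula.or · γ) h.2.2.1, ih h.2.2.2⟩

theorem IsChain.orR {S : Set Rule} {α β : Formula B} {L : List (Step B)} (γ : Formula B)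
    (h : IsChain S α L β) : IsChain S (.or γ α) (L.map (Step.orR γ)) (.or γ β) := by
  induction L generalizing α with
  | nil => cases h; rfl
  | cons s L ih => exact ⟨h.1, h.2.1, congrArg (Formula.or γ) h.2.2.1, ih h.2.2.2⟩

theorem IsChain.andL {S : Set Rule} {α β : Formula B} {L : List (Step B)} (γ : Formula B)
    (h : IsChain S α L β) : IsChain S (.and α γ) (L.map (Step.andL γ)) (.and β γ) := by
  induction L generalizing α with
  | nil => cases h; rfl
  | cons s L ih => exact ⟨h.1, h.2.1, congrArg (Formula.and · γ) h.2.2.1, ih h.2.2.2⟩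

theorem IsChain.andR {S : Set Rule} {α β : Formula B} {L : List (Step B)} (γ : Formula B)
    (h : IsChain S α L β) : IsChain S (.and γ α) (L.map (Step.andR γ)) (.and γ β) := by
  induction L generalizing α with
  | nil => cases h; rfl
  | cons s L ih => exact ⟨h.1, h.2.1, congrArg (Formula.and γ) h.2.2.1, ih h.2.2.2⟩

/-- If the rules respect a relation `P` between actual and intended formulae, so do terms. -/
theorem run_spec {R : Rul → Formula B → Formula B → Prop} {P : Formula B → Formula B → Prop}
    {h : Rul → Formula B → Formula B × List (Step B)} {S : Set Rule}
    (hor : ∀ {F α β}, P F (.or α β) → ∃ γ δ, F = .or γ δ ∧ P γ α ∧ P δ β)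
    (hand : ∀ {F α β}, P F (.and α β) → ∃ γ δ, F = .and γ δ ∧ P γ α ∧ P δ β)
    (hor' : ∀ {α β γ δ}, P γ α → P δ β → P (.or γ δ) (.or α β))
    (hand' : ∀ {α β γ δ}, P γ α → P δ β → P (.and γ δ) (.and α β))
    (hR : ∀ {ρ u l l'}, R ρ u l → P l' l → P (h ρ l').1 u ∧ IsChain S (h ρ l').1 (h ρ l').2 l')
    {D : OD} {u l : Formula B} (H : Der R D u l) : ∀ {l'}, P l' l →
      P (run h D l').1 u ∧ IsChain S (run h D l').1 (run h D l').2 l' := by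
  induction H with
  | id => exact fun hl => ⟨hl, rfl⟩
  | rule H => exact fun hl => hR H hl
  | or _ _ ih ih' =>
    intro l' hl
    obtain ⟨γ, δ, rfl, h1, h2⟩ := hor hl
    exact ⟨hor' (ih h1).1 (ih' h2).1, ((ih h1).2.orL _).append ((ih' h2).2.orR _)⟩
  | and _ _ ih ih' =>
    intro l' hl
    obtain ⟨γ, δ, rfl, h1, h2⟩ := hand hl
    exact ⟨hand' (ih h1).1 (ih' h2).1, ((ih h1).2.andL _).append ((ih' h2).2.andR _)⟩
  | comp _ _ ih ih' =>
    intro l' hl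
    exact ⟨(ih (ih' hl).1).1, (ih (ih' hl).1).2.append (ih' hl).2⟩

theorem single_chain {ρ : Rule} {u l : Formula B} (h : Instance ρ u l) (hρ : ρ ∈ aSKS) :
    IsChain aSKS (single ρ u l).1 (single ρ u l).2 l :=
  ⟨hρ, h, rfl, rfl⟩

theorem run_hRaw {D : OD} {u l : Formula B} (H : Der Raw D u l) :
    (run hRaw D l).1 = u ∧ IsChain aSKS u (run hRaw D l).2 l := by
  have := run_spec (R := Raw) (P := Eq) (h := hRaw) (S := aSKS) (B := B)
    (fun h => ⟨_, _, h, rfl, rfl⟩) (fun h => ⟨_, _, h, rfl, rfl⟩)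
    (fun h h' => by rw [h, h']) (fun h h' => by rw [h, h']) ?_ H rfl
  · exact ⟨this.1, by have h := this.2; rwa [this.1] at h⟩
  · rintro ρ u l l' H rfl
    cases H with
    | @lin i _ _ h =>
      have e : hRaw (.lin i) l' = single i.name u l' := by simp only [hRaw, h.up_eq]
      rw [e]
      exact ⟨rfl, single_chain h.inst (by cases i <;> simp [Lin.name, aSKS, SKS])⟩
    | ai a => exact ⟨rfl, single_chain (.aiDown a) (by simp [aSKS, SKS])⟩
    | aw a => exact ⟨rfl, single_chain (.awDown a) (by simp [aSKS, SKS])⟩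
    | ac a => exact ⟨rfl, single_chain (.acDown a) (by simp [aSKS, SKS])⟩
    | acu a => exact ⟨rfl, single_chain (.acUp a) (by simp [aSKS, SKS])⟩

/-- This is how a replaced atom moves up through a rule. A coweakening disappears and is where
replacement begins. An identity or weakening with a replaced atom becomes a weakening, and there the
replacement ends. A contraction becomes [t∨t] → t. A cocontraction with a replaced copy becomes a
unit equation that keeps the other copy. -/
theorem hFull_spec {ρ : Rul} {u l l' : Formula B} (H : Full ρ u l) (hl : Pr l' l) :
    Pr (hFull ρ l').1 u ∧ IsChain aSKS (hFull ρ l').1 (hFull ρ l').2 l' := by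
  suffices h : ∃ u', Pr u' u ∧ Der Raw (patch ρ l') u' l' ∧ prem ρ l' = u' by
    obtain ⟨u', h1, h2, h3⟩ := h
    simp only [hFull, h3]
    exact ⟨h1, (run_hRaw h2).2⟩
  cases H with
  | raw H =>
    cases H with
    | @lin i _ _ h =>
      have h1 := hl.linRel h
      refine ⟨i.up l', h1.1, .l h1.2, (run_hRaw (.l h1.2)).1⟩
    | ai a =>
      refine ⟨.tt, .tt, ?_, rfl⟩
      cases hl with
      | or h1 h2 =>
        cases h1 with
        | cut =>
          exact .comp (.l (.orF' _)) (.or (.id _) (der_wk _))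
        | atom =>
          cases h2 with
          | cut =>
              exact .comp (.comp (.l (.orF' _)) (.l (.orC _ _))) (.or (der_wk _) (.id _))
          | atom =>
              exact .rule (.ai a)
    | aw a => exact ⟨.ff, .ff, der_wk _, rfl⟩
    | ac a =>
      cases hl with
      | cut => exact ⟨.or .tt .tt, .or (.cut a) (.cut a), .l .orT, rfl⟩
      | atom => exact ⟨_, .or (.atom a) (.atom a), .rule (.ac a), rfl⟩
    | acu a =>
      cases hl with
      | @and _ _ γ _ h1 h2 =>
        cases h1 with
        | cut =>
          have h := Der.comp (.l (.andT' γ)) (.l (.andC _ _))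
          exact ⟨γ, h2, h, (run_hRaw h).1⟩
        | atom =>
          cases h2 with
          | cut =>
            have h := Der.l (.andT' (.atom a))
            exact ⟨_, .atom a, h, (run_hRaw h).1⟩
          | atom =>
            have h := Der.rule (Raw.acu a)
            exact ⟨_, .atom a, h, (run_hRaw h).1⟩
  | awu a =>
    cases hl
    exact ⟨.tt, .cut a, .id _, rfl⟩
  | W α => exact ⟨.ff, .ff, der_wk _, rfl⟩

/-- Coweakening can be removed from derivations whose conclusion is kept. -/
theorem run_hFull {D : OD} {l : Formula B} (H : Der Full D .tt l) :
    IsChain aSKS .tt (run hFull D l).2 l := by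
  have := run_spec (R := Full) (P := Pr) (h := hFull) (S := aSKS) (B := B)
    (fun h => by cases h; exact ⟨_, _, rfl, by assumption, by assumption⟩)
    (fun h => by cases h; exact ⟨_, _, rfl, by assumption, by assumption⟩)
    .or .and hFull_spec H (.refl l)
  -- The intended premiss t contains no atom, so the actual premiss, being t with some atoms
  -- replaced, is t.
  have e : (run hFull D l).1 = .tt := by
    have h := this.1
    revert h
    generalize (run hFull D l).1 = F
    intro h
    cases h; rfl
  have h := this.2
  rwa [e] at h

end
end DeepInference

/-! ### Cut elimination by threshold formulae. -/

namespace DeepInference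

section
variable {B : Type u}

/-! ### Threshold formulae -/

open Classical in
/-- `sub p χ α` is `α` with the atom `p` replaced by `χ`. -/
noncomputable def sub (p χ : Formula B) : Formula B → Formula B
  | .ff => .ff
  | .tt => .tt
  | .atom b => if .atom b = p then χ else .atom b
  | .or α β => .or (sub p χ α) (sub p χ β)
  | .and α β => .and (sub p χ α) (sub p χ β)

/-- The atom `p` occurs in a formula. -/
def Mem (p : Formula B) : Formula B → Prop
  | .ff => False
  | .tt => False
  | .atom b => .atom b = p
  | .or α β => Mem p α ∨ Mem p β
  | .and α β => Mem p α ∨ Mem p β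

theorem sub_of_not_mem {p χ α : Formula B} (h : ¬ Mem p α) : sub p χ α = α := by
  induction α with
  | ff => rfl
  | tt => rfl
  | atom b => exact if_neg h
  | or α β ih ih' => simp only [Mem, not_or] at h; simp only [sub, ih h.1, ih' h.2]
  | and α β ih ih' => simp only [Mem, not_or] at h; simp only [sub, ih h.1, ih' h.2]

/-- The atom `p` occurs exactly once in a disjunction of atoms and units. -/
def Once (p : Formula B) : Formula B → Prop
  | .atom b => .atom b = p
  | .or α β => (Once p α ∧ ¬ Mem p β) ∨ (¬ Mem p α ∧ Once p β)
  | _ => False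

theorem Once.mem {p α : Formula B} (h : Once p α) : Mem p α := by
  induction α with
  | ff => exact h
  | tt => exact h
  | atom b => exact h
  | or α β ih ih' => exact h.imp (fun h => ih h.1) fun h => ih' h.2
  | and α β ih ih' => exact h.elim

/-- `[(L (i-1) ∧ R j) ∨ [(L (i-2) ∧ R (j+1)) ∨ ⋯]]`. -/
def conv (L R : ℕ → Formula B) : ℕ → ℕ → Formula B
  | 0, _ => .ff
  | i + 1, j => .or (.and (L i) (R j)) (conv L R i (j + 1))

/-- `TH V k` says that at least `k` of the disjuncts of `V` are true. -/
def TH : Formula B → ℕ → Formula B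
  | .or α β => fun k => conv (TH α) (TH β) (k + 1) 0
  | α => fun k => if k = 0 then .tt else if k = 1 then α else .ff

theorem sub_conv (p χ : Formula B) (L R : ℕ → Formula B) (i j : ℕ) :
    sub p χ (conv L R i j) = conv (fun i => sub p χ (L i)) (fun j => sub p χ (R j)) i j := by
  induction i generalizing j with
  | zero => rfl
  | succ i ih => simp only [conv, sub, ih]

theorem not_mem_conv {p : Formula B} {L R : ℕ → Formula B} (hL : ∀ i, ¬ Mem p (L i))
    (hR : ∀ j, ¬ Mem p (R j)) (i j : ℕ) : ¬ Mem p (conv L R i j) := by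
  induction i generalizing j with
  | zero => exact id
  | succ i ih => simp [conv, Mem, hL, hR, ih]

theorem not_mem_TH {p V : Formula B} (h : ¬ Mem p V) (k : ℕ) : ¬ Mem p (TH V k) := by
  have leaf : ∀ F : Formula B, ¬ Mem p F → ¬ Mem p (if k = 0 then .tt else if k = 1 then F else .ff) := by
    intro F hF
    split
    · exact id
    · split
      · exact hF
      · exact id
  induction V generalizing k with
  | or α β ih ih' =>
    simp only [Mem, not_or] at h
    exact not_mem_conv (fun i => ih h.1 i (fun F hF => by split <;> [exact id; (split <;> [exact hF; exact id])]))
      (fun j => ih' h.2 j (fun F hF => by split <;> [exact id; (split <;> [exact hF; exact id])])) _ _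
  | _ => exact leaf _ h

/-! ### Increasing a threshold -/

/-- The disjuncts of `conv` one by one, when the left factors change; the last one is new. -/
def incL (d : ℕ → OD) : ℕ → OD
  | 0 => .rule .W
  | i + 1 => .or (.and (d i) .id) (incL d i)

/-- The disjuncts of `conv` one by one, when the right factors change. -/
def incR (d : ℕ → OD) : ℕ → ℕ → OD
  | 0, _ => .id
  | i + 1, j => .or (.and .id (d j)) (incR d i (j + 1))

variable [Atoms B]

open Classical in
/-- From `TH V k` with `p` false to `TH V (k + 1)` with `p` true. -/
noncomputable def INC (p : Formula B) : Formula B → ℕ → OD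
  | .or α β => fun k => if Mem p α then incL (INC p α) (k + 1) else incR (INC p β) (k + 1) 0 ⨾ orW'
  | _ => fun _ => .id

/-- Raising all left indices by one takes the disjuncts of `conv L R i j` to all but the last
disjunct of the target. The last one, with left index 0, has no source and is weakened in from f. -/
theorem der_incL {d : ℕ → OD} {L L' R : ℕ → Formula B} (hd : ∀ i, Der Full (d i) (L i) (L' (i + 1)))
    (i j : ℕ) : Der Full (incL d i) (conv L R i j) (conv L' R (i + 1) j) := by
  induction i generalizing j with
  | zero => exact .W _
  | succ i ih => exact .or (.and (hd i) (.id _)) (ih (j + 1))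

/-- Raising the right indices leaves the number of disjuncts unchanged. The disjunct that the next
threshold has in addition comes first, with right index 0, and `INC` adds it by `orW'`. -/
theorem der_incR {d : ℕ → OD} {L R R' : ℕ → Formula B} (hd : ∀ i, Der Full (d i) (R i) (R' (i + 1)))
    (i j : ℕ) : Der Full (incR d i j) (conv L R i j) (conv L R' i (j + 1)) := by
  induction i generalizing j with
  | zero => exact .id _
  | succ i ih => exact .or (.and (.id _) (hd j)) (ih (j + 1))

/-- Where p is false and at least k disjuncts are true, making p true yields k+1 of them. As p
occurs once, only one side of each disjunction changes, and there the count rises by one; the other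
side is unaffected by the substitution. -/
theorem der_INC {p V : Formula B} (hV : Once p V) (k : ℕ) :
    Der Full (INC p V k) (sub p .ff (TH V k)) (sub p .tt (TH V (k + 1))) := by
  induction V generalizing k with
  | ff => exact hV.elim
  | tt => exact hV.elim
  | and => exact hV.elim
  | atom b =>
    have hb : Formula.atom b = p := hV
    subst hb
    -- At the leaf p both formulae are t for k = 0 and f for larger k, so the identity term
    -- suffices.
    rcases k with _ | _ | k <;> simp [INC, TH, sub] <;> exact .id _
  | or α β ih ih' =>
    simp only [INC, TH, sub_conv]
    rcases hV with ⟨h, h'⟩ | ⟨h, h'⟩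
    · rw [if_pos h.mem]
      simp only [fun χ j => sub_of_not_mem (χ := χ) (not_mem_TH h' j)]
      exact der_incL (L' := fun i => sub p .tt (TH α i)) (ih h) _ _
    · rw [if_neg h]
      simp only [fun χ j => sub_of_not_mem (χ := χ) (not_mem_TH h j)]
      exact .comp (der_incR (R' := fun i => sub p .tt (TH β i)) (ih' h') _ _) (der_orW' _ _)

/-! ### The first and the last threshold -/

/-- From `t` to the threshold `0`. -/
def st : Formula B → OD
  | .or α β => .l .andT' ⨾ .and (st α) (st β) ⨾ .l .orF'
  | _ => .id

theorem der_st (V : Formula B) : Der Full (st V) .tt (TH V 0) := by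
  induction V with
  | or α β ih ih' => exact .comp (.comp (.fl (.andT' _)) (.and ih ih')) (.fl (.orF' _))
  | _ => exact .id _

/-- The value of a formula, all of whose atoms are true. -/
def val : Formula B → Prop
  | .ff => False
  | .tt => True
  | .atom _ => True
  | .or α β => val α ∨ val β
  | .and α β => val α ∧ val β

open Classical in
/-- From a formula to its value. -/
noncomputable def dn : Formula B → OD
  | .ff => .id
  | .tt => .id
  | .atom _ => .rule .awu
  | .or α β => .or (dn α) (dn β) ⨾
      if val α then (if val β then .l .orT else .l .orF) else .l .orC ⨾ .l .orF
  | .and α β => .and (dn α) (dn β) ⨾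
      if val α then .l .andC ⨾ .l .andT else (if val β then .l .andT else .l .andF)

open Classical in
theorem der_dn (F : Formula B) : Der Full (dn F) F (if val F then .tt else .ff) := by
  induction F with
  | ff => rw [if_neg (by simp [val])]; exact .id _
  | tt => rw [if_pos (by simp [val])]; exact .id _
  | atom a => rw [if_pos (by simp [val])]; exact .rule (.awu a)
  | or α β ih ih' =>
    refine .comp (.or ih ih') ?_
    by_cases h : val α <;> by_cases h' : val β <;> simp only [h, h', val, if_true, if_false, or_true,
      or_false, or_self]
    exacts [.fl .orT, .fl (.orF _), .comp (.fl (.orC _ _)) (.fl (.orF _)),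
      .comp (.fl (.orC _ _)) (.fl (.orF _))]
  | and α β ih ih' =>
    refine .comp (.and ih ih') ?_
    by_cases h : val α <;> by_cases h' : val β <;> simp only [h, h', val, if_true, if_false, and_true,
      and_false, and_self]
    exacts [.comp (.fl (.andC _ _)) (.fl (.andT _)), .comp (.fl (.andC _ _)) (.fl (.andT _)),
      .fl (.andT _), .fl .andF]

/-- The two indices have a constant sum along the disjuncts, and in a true disjunct they are at most
`m` and `n`. -/
theorem val_conv {L R : ℕ → Formula B} {m n : ℕ} (hL : ∀ i, val (L i) → i ≤ m)
    (hR : ∀ j, val (R j) → j ≤ n) {i j : ℕ} (h : val (conv L R (i + 1) j)) : i + j ≤ m + n := by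
  induction i generalizing j with
  | zero =>
    rcases h with ⟨h, h'⟩ | h
    · have := hR _ h'; omega
    · exact h.elim
  | succ i ih =>
    rcases h with ⟨h, h'⟩ | h
    · have := hL _ h; have := hR _ h'; omega
    · have := ih h; omega

theorem le_of_val_TH {V : Formula B} {k : ℕ} (h : val (TH V k)) : k ≤ V.size := by
  induction V generalizing k with
  | or α β ih ih' => exact val_conv (fun _ => ih) (fun _ => ih') h
  | _ =>
    have := fun F : Formula B => F.size_pos
    by_contra hk
    have h0 : k ≠ 0 := by omega
    have h1 : k ≠ 1 := by rintro rfl; exact hk (this _)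
    simp only [TH, h0, h1, if_false] at h
    exact h

/-! ### Extracting and inserting an atom -/

open Classical in
/-- `α → [sub p f α ∨ p]`. -/
noncomputable def ext (p : Formula B) : Formula B → OD
  | .atom b => if .atom b = p then .l .orF' ⨾ .l .orC else orW
  | .or α β => .or (ext p α) (ext p β) ⨾ pullOr (.rule .ac)
  | .and α β => .and (ext p α) (ext p β) ⨾ pullAnd (.rule .ac)
  | _ => orW

/-- At an occurrence of the atom, the atom itself goes to the right and f remains; other leaves are
weakened. The copies of the atom are pulled outwards through the connectives and contracted. -/
theorem der_ext (a : B) (α : Formula B) :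
    Der Full (ext (.atom a) α) α (.or (sub (.atom a) .ff α) (.atom a)) := by
  have hc : Der Full (.rule .ac) (.or (.atom a) (.atom a)) (.atom a) := .rule (.raw (.ac a))
  induction α with
  | ff => exact der_orW _ _
  | tt => exact der_orW _ _
  | atom b =>
    by_cases h : Formula.atom b = .atom a
    · simp only [ext, sub, h, if_true]
      exact .comp (.fl (.orF' _)) (.fl (.orC _ _))
    · simp only [ext, sub, h, if_false]
      exact der_orW _ _
  | or α β ih ih' => exact .comp (.or ih ih') (der_pullOr hc _ _)
  | and α β ih ih' => exact .comp (.and ih ih') (der_pullAnd hc _ _)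

/-- `(χ∧α) → α` if `χ → t` by `c`. -/
def andDrop (c : OD) : OD := .and c .id ⨾ .l .andC ⨾ .l .andT

theorem der_andDrop {c : OD} {χ : Formula B} (hc : Der Full c χ .tt) (α : Formula B) :
    Der Full (andDrop c) (.and χ α) α :=
  .comp (.comp (.and hc (.id _)) (.fl (.andC _ _))) (.fl (.andT _))

/-- `(χ∧[α∨β]) → [(χ∧α)∨(χ∧β)]` for an atom `χ`. -/
def pushOr : OD :=
  .and (.rule .acu) .id ⨾ .l .andA ⨾ .and .id (.l .sw ⨾ .l .orC) ⨾ .l .sw ⨾ .l .orC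

theorem der_pushOr (a : B) (α β : Formula B) : Der Full pushOr (.and (.atom a) (.or α β))
    (.or (.and (.atom a) α) (.and (.atom a) β)) :=
  .comp (.comp (.comp (.comp (.and (.rule (.raw (.acu a))) (.id _)) (.fl (.andA _ _ _)))
    (.and (.id _) (.comp (.fl (.sw _ _ _)) (.fl (.orC _ _))))) (.fl (.sw _ _ _))) (.fl (.orC _ _))

open Classical in
/-- `(p ∧ sub p t α) → α`. -/
noncomputable def fill (p : Formula B) : Formula B → OD
  | .atom b => if .atom b = p then .l .andT else andDrop (.rule .awu)
  | .or α β => pushOr ⨾ .or (fill p α) (fill p β)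
  | .and α β => .and (.rule .acu) .id ⨾ andMix ⨾ .and (fill p α) (fill p β)
  | _ => andDrop (.rule .awu)

/-- The atom is copied by cocontraction down to every leaf. Where t stands in for it, it takes that
place; elsewhere it is discarded by coweakening. -/
theorem der_fill (a : B) (α : Formula B) :
    Der Full (fill (.atom a) α) (.and (.atom a) (sub (.atom a) .tt α)) α := by
  have hc : Der Full (.rule .awu) (.atom a) .tt := .rule (.awu a)
  induction α with
  | ff => exact der_andDrop hc _
  | tt => exact der_andDrop hc _
  | atom b =>
    by_cases h : Formula.atom b = .atom a
    · simp only [fill, sub, h, if_true]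
      exact .fl (.andT _)
    · simp only [fill, sub, h, if_false]
      exact der_andDrop hc _
  | or α β ih ih' => exact .comp (der_pushOr _ _ _) (.or ih ih')
  | and α β ih ih' =>
    exact .comp (.comp (.and (.rule (.raw (.acu a))) (.id _)) (der_andMix _ _ _ _).full) (.and ih ih')

/-! ### Replacing atoms by pseudocomplements -/

/-- The dual of an atom. -/
def neg : Formula B → Formula B
  | .atom a => .atom (Atoms.dual a)
  | α => α

open Classical in
/-- An atom whose dual occurs in `V` is replaced by `T` with that dual false. -/
noncomputable def sg (V T p : Formula B) : Formula B := if Mem (neg p) V then sub (neg p) .ff T else p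

/-- The action of `sg` on formulae. -/
noncomputable def sgF (V T : Formula B) : Formula B → Formula B
  | .ff => .ff
  | .tt => .tt
  | .atom b => sg V T (.atom b)
  | .or α β => .or (sgF V T α) (sgF V T β)
  | .and α β => .and (sgF V T α) (sgF V T β)

/-- Linear rules are schematic in formulae, so they are closed under substitution for atoms. -/
theorem LinRel.sgF {V T : Formula B} {i : Lin} {u l : Formula B} (h : LinRel i u l) :
    LinRel i (sgF V T u) (sgF V T l) := by
  cases h <;> constructor

/-- `(sub p f T ∧ p) → U`. -/
noncomputable def cutD (U p : Formula B) (d : OD) : OD := .and d .id ⨾ .l .andC ⨾ fill p U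

/-- The replacement for a cut. With `χ` the pseudocomplement of the atom in the threshold k and `U`
the threshold k+1, the derivation `d` is `INC`, and the atom beside it fills the places where t was
substituted. -/
theorem der_cutD {U : Formula B} {a : B} {d : OD} {χ : Formula B}
    (hd : Der Full d χ (sub (.atom a) .tt U)) :
    Der Full (cutD U (.atom a) d) (.and χ (.atom a)) U :=
  .comp (.comp (.and hd (.id _)) (.fl (.andC _ _))) (der_fill a U)

open Classical in
/-- `sgF V T α → [α∨U]`; here `I` gives the derivations from `T` to `U`. -/
noncomputable def fin (V U : Formula B) (I : Formula B → OD) : Formula B → OD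
  | .atom b =>
    if Mem (neg (.atom b)) V then
      .l .andT' ⨾ .and .id (.rule .ai) ⨾ .l .sw ⨾
        .or (cutD U (neg (.atom b)) (I (neg (.atom b)))) .id ⨾ .l .orC
    else orW
  | .or α β => .or (fin V U I α) (fin V U I β) ⨾ pullOr (ct U)
  | .and α β => .and (fin V U I α) (fin V U I β) ⨾ pullAnd (ct U)
  | _ => orW

/-- Only pseudocomplements need work. If χ stands for b, then χ → (χ∧[b̄∨b]) → [(χ∧b̄)∨b], and the
left disjunct is a translated cut, which yields `U`. The resulting copies of `U` are pulled out and
contracted. -/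
theorem der_fin {V T U : Formula B} {I : Formula B → OD}
    (hI : ∀ a, Mem (.atom a) V → Der Full (I (.atom a)) (sub (.atom a) .ff T) (sub (.atom a) .tt U))
    (α : Formula B) : Der Full (fin V U I α) (sgF V T α) (.or α U) := by
  induction α with
  | ff => exact der_orW _ _
  | tt => exact der_orW _ _
  | atom b =>
    by_cases h : Mem (neg (.atom b)) V
    · simp only [fin, sgF, sg, h, if_true]
      simp only [neg] at h ⊢
      -- The identity is taken on the dual of `b`, the atom that occurs in `V`; the double dual on
      -- its right is then `b`.
      refine .comp (.comp (.comp (.comp (.fl (.andT' _)) (.and (.id _)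
        (.rule (.raw (.ai (Atoms.dual b)))))) (.fl (.sw _ _ _))) (.or (der_cutD (hI _ h)) (.id _))) ?_
      rw [Atoms.dual_dual]
      exact .fl (.orC _ _)
    · simp only [fin, sgF, sg, h, if_false]
      exact der_orW _ _
  | or α β ih ih' => exact .comp (.or ih ih') (der_pullOr (der_ct U).full _ _)
  | and α β ih ih' => exact .comp (.and ih ih') (der_pullAnd (der_ct U).full _ _)

/-! ### Translation of inference steps -/

/-- All linear rules. -/
def linRules : List Lin :=
  [.orC, .andC, .orA, .orA', .andA, .andA', .orF, .orF', .andT, .andT', .orT, .orT', .andF, .andF',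
    .sw, .md]

open Classical in
/-- The first linear rule of a list that leads from `u` to `l`. -/
noncomputable def detect (u l : Formula B) : List Lin → Lin
  | [] => .orC
  | i :: L => if i.up l = u ∧ i.down u = l then i else detect u l L

/-- The rule `=` does not record which equation was used. Any linear rule that fits will do, so the
first one found is taken. -/
theorem linRel_detect {u l : Formula B} {i : Lin} (h : LinRel i u l) {L : List Lin} (hi : i ∈ L) :
    LinRel (detect u l L) u l := by
  induction L with
  | nil => simp at hi
  | cons j L ih =>
    by_cases hj : j.up l = u ∧ j.down u = l
    · simp only [detect, hj, and_self, if_true]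
      exact linRel_of hj.1 hj.2
    · simp only [detect, hj, if_false]
      refine ih ((List.mem_cons.1 hi).resolve_left ?_)
      rintro rfl
      exact hj ⟨h.up_eq, h.down_eq⟩

/-- From `(T∧ξ{u})` to `[ξ{l}∨U]`, given `d` from `(T∧u)` to `[l∨U]`. -/
def trans (d : OD) : Context B → OD
  | .hole => d
  | .orLeft ξ _ => .l .sw ⨾ .or (trans d ξ) .id ⨾ .l .orA ⨾ .or .id (.l .orC) ⨾ .l .orA'
  | .orRight _ ξ => .and .id (.l .orC) ⨾ .l .sw ⨾ .or (trans d ξ) .id ⨾ .l .orC ⨾ .l .orA'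
  | .andLeft ξ _ => .l .andA' ⨾ .and (trans d ξ) .id ⨾ .l .andC ⨾ .l .sw ⨾ .or (.l .andC) .id
  | .andRight _ ξ => .and .id (.l .andC) ⨾ .l .andA' ⨾ .and (trans d ξ) .id ⨾ .l .andC ⨾ .l .sw

/-- Switch and the equations carry `T` inwards to the hole and `U` outwards from it, past
conjunctions and disjunctions alike. -/
theorem der_trans {V T T' U : Formula B} {d : OD} {u l : Formula B}
    (hd : Der Full d (.and T (sgF V T' u)) (.or (sgF V T' l) U)) (ξ : Context B) :
    Der Full (trans d ξ) (.and T (sgF V T' (ξ.fill u))) (.or (sgF V T' (ξ.fill l)) U) := by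
  induction ξ with
  | hole => exact hd
  | orLeft ξ β ih =>
    exact .comp (.comp (.comp (.comp (.fl (.sw _ _ _)) (.or ih (.id _))) (.fl (.orA _ _ _)))
      (.or (.id _) (.fl (.orC _ _)))) (.fl (.orA' _ _ _))
  | orRight α ξ ih =>
    exact .comp (.comp (.comp (.comp (.and (.id _) (.fl (.orC _ _))) (.fl (.sw _ _ _)))
      (.or ih (.id _))) (.fl (.orC _ _))) (.fl (.orA' _ _ _))
  | andLeft ξ β ih =>
    exact .comp (.comp (.comp (.comp (.fl (.andA' _ _ _)) (.and ih (.id _))) (.fl (.andC _ _)))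
      (.fl (.sw _ _ _))) (.or (.fl (.andC _ _)) (.id _))
  | andRight α ξ ih =>
    exact .comp (.comp (.comp (.comp (.and (.id _) (.fl (.andC _ _))) (.fl (.andA' _ _ _)))
      (.and ih (.id _))) (.fl (.andC _ _))) (.fl (.sw _ _ _))

open Classical in
/-- From `T` to the translation of `[p∨p̄]`. -/
noncomputable def locI (V T p : Formula B) : OD :=
  if Mem p V then ext p T ⨾ .l .orC else ext (neg p) T

open Classical in
/-- From the translation of `(p∧p̄)` to `U`. -/
noncomputable def locC (V U : Formula B) (I : Formula B → OD) (p : Formula B) : OD :=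
  if Mem p V then .l .andC ⨾ cutD U p (I p) else cutD U (neg p) (I (neg p))

/-- From `(T∧u)` to `[l∨U]`, for the premiss `u` and the conclusion `l` of a rule. -/
noncomputable def loc (V T U : Formula B) (I : Formula B → OD) (s : Step B) : OD :=
  match s.rule with
  | .aiDown => .l .andT ⨾ locI V T s.lower.L ⨾ orW
  | .aiUp => andDrop (cw T) ⨾ locC V U I s.upper.L ⨾ orW'
  | .awDown => andDrop (cw T) ⨾ .rule .W ⨾ orW
  | .acDown => andDrop (cw T) ⨾ ct (sg V T s.lower) ⨾ orW
  | .acUp => andDrop (cw T) ⨾ cc (sg V T s.upper) ⨾ orW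
  | .awUp => andDrop (cw T) ⨾ cw (sg V T s.upper) ⨾ orW
  | _ => andDrop (cw T) ⨾ .l (detect s.upper s.lower linRules) ⨾ orW

open Classical in
/-- The atoms of the identity and cut instances. -/
noncomputable def cutAtom (s : Step B) : Formula B := if s.rule = .aiUp then s.upper.L else s.lower.L

/-- By `hV`, exactly one of the two atoms of an identity or cut is replaced. Identities use up `T`
by `der_ext`, cuts produce `U` by `der_cutD`. All other rules discard `T` and add `U` by weakening;
the atomic structural rules need their general forms, since their atom may have become a threshold
formula. -/
theorem der_loc {V T U : Formula B} {I : Formula B → OD}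
    (hI : ∀ a, Mem (.atom a) V → Der Full (I (.atom a)) (sub (.atom a) .ff T) (sub (.atom a) .tt U))
    {s : Step B} (hs : Instance s.rule s.upper s.lower)
    (hV : s.rule = .aiDown ∨ s.rule = .aiUp →
      (Mem (cutAtom s) V ∧ ¬ Mem (neg (cutAtom s)) V) ∨ (¬ Mem (cutAtom s) V ∧ Mem (neg (cutAtom s)) V)) :
    Der Full (loc V T U I s) (.and T (sgF V T s.upper)) (.or (sgF V T s.lower) U) := by
  obtain ⟨ξ, ρ, up, lo⟩ := s
  have hdrop := der_andDrop (der_cw T)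
  dsimp only at hs hV ⊢
  have hlin : ∀ {ρ}, Instance ρ up lo → (ρ = .switch ∨ ρ = .medial ∨ ρ = .equal) →
      Der Full (andDrop (cw T) ⨾ .l (detect up lo linRules) ⨾ orW)
        (.and T (sgF V T up)) (.or (sgF V T lo) U) := by
    intro ρ h hρ
    obtain ⟨i, hi⟩ := exists_linRel h hρ
    exact .comp (.comp (hdrop _) (.fl (linRel_detect hi (by cases i <;> simp [linRules])).sgF))
      (der_orW _ _)
  cases hs with
  | aiDown a =>
    simp only [loc, Formula.L, sgF]
    simp only [locI, sg]
    rcases hV (Or.inl rfl) with ⟨h, h'⟩ | ⟨h, h'⟩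
    · simp only [cutAtom, Formula.L, reduceCtorEq, if_false] at h h'
      have h1 : Mem (neg (.atom (Atoms.dual a))) V := by simpa only [neg, Atoms.dual_dual] using h
      rw [if_pos h, if_neg h', if_pos h1]
      simp only [neg, Atoms.dual_dual]
      exact .comp (.comp (.fl (.andT _)) (.comp (der_ext _ _) (.fl (.orC _ _)))) (der_orW _ _)
    · simp only [cutAtom, Formula.L, reduceCtorEq, if_false] at h h'
      have h1 : ¬ Mem (neg (.atom (Atoms.dual a))) V := by simpa only [neg, Atoms.dual_dual] using h
      rw [if_neg h, if_pos h', if_neg h1]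
      exact .comp (.comp (.fl (.andT _)) (der_ext _ _)) (der_orW _ _)
  | aiUp a =>
    simp only [loc, Formula.L, sgF]
    simp only [locC, sg]
    rcases hV (Or.inr rfl) with ⟨h, h'⟩ | ⟨h, h'⟩
    · simp only [cutAtom, Formula.L, if_true] at h h'
      have h1 : Mem (neg (.atom (Atoms.dual a))) V := by simpa only [neg, Atoms.dual_dual] using h
      rw [if_pos h, if_neg h', if_pos h1]
      simp only [neg, Atoms.dual_dual]
      exact .comp (.comp (hdrop _) (.comp (.fl (.andC _ _)) (der_cutD (hI _ h)))) (der_orW' _ _)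
    · simp only [cutAtom, Formula.L, if_true] at h h'
      have h1 : ¬ Mem (neg (.atom (Atoms.dual a))) V := by simpa only [neg, Atoms.dual_dual] using h
      rw [if_neg h, if_pos h', if_neg h1]
      exact .comp (.comp (hdrop _) (der_cutD (hI _ h'))) (der_orW' _ _)
  | awDown a => exact .comp (.comp (hdrop _) (.W _)) (der_orW _ _)
  | acDown a => exact .comp (.comp (hdrop _) (der_ct _).full) (der_orW _ _)
  | acUp a => exact .comp (.comp (hdrop _) (der_cc _).full) (der_orW _ _)
  | awUp a => exact .comp (.comp (hdrop _) (der_cw _)) (der_orW _ _)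
  | switch => exact hlin (.switch _ _ _) (by simp)
  | medial => exact hlin (.medial _ _ _ _) (by simp)
  | equal h => exact hlin (.equal h) (by simp)
  | equalSymm h => exact hlin (.equalSymm h) (by simp)

/-- From `[(T∧γ)∨U]` to `[(T∧δ)∨U]`, for the translations `γ` of the premiss and `δ` of the
conclusion of a step. -/
noncomputable def stepD (V T U : Formula B) (I : Formula B → OD) (s : Step B) : OD :=
  .or (.and (cc T) .id ⨾ .l .andA ⨾ .and .id (trans (loc V T U I s) s.context) ⨾ .l .sw) .id ⨾
    .l .orA ⨾ .or .id (ct U)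

/-- From `[(T∧γ)∨U]` to `[(T∧δ)∨U]`, for the translations `γ` of the premiss and `δ` of the
conclusion of a chain of steps. -/
noncomputable def chainD (V T U : Formula B) (I : Formula B → OD) : List (Step B) → OD
  | [] => .id
  | s :: L => stepD V T U I s ⨾ chainD V T U I L

/-- The atoms of the identities and cuts of a chain are decided by `V`. -/
def Decided (V : Formula B) (L : List (Step B)) : Prop :=
  ∀ s ∈ L, s.rule = .aiDown ∨ s.rule = .aiUp →
    (Mem (cutAtom s) V ∧ ¬ Mem (neg (cutAtom s)) V) ∨ (¬ Mem (cutAtom s) V ∧ Mem (neg (cutAtom s)) V)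

/-- A step consumes its copy of `T`, so `T` is first duplicated and one copy kept for later steps.
The `U` that the step emits is contracted with those emitted before. -/
theorem der_chainD {V T U : Formula B} {I : Formula B → OD}
    (hI : ∀ a, Mem (.atom a) V → Der Full (I (.atom a)) (sub (.atom a) .ff T) (sub (.atom a) .tt U))
    {S : Set Rule} {L : List (Step B)} {γ δ : Formula B} (hL : IsChain S γ L δ) (hV : Decided V L) :
    Der Full (chainD V T U I L) (.or (.and T (sgF V T γ)) U) (.or (.and T (sgF V T δ)) U) := by
  induction L generalizing γ with
  | nil => cases hL; exact .id _
  | cons s L ih =>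
    obtain ⟨-, h1, rfl, h2⟩ := hL
    refine .comp ?_ (ih h2 fun r hr => hV r (by simp [hr]))
    exact .comp (.comp (.or (.comp (.comp (.comp (.and (der_cc T).full (.id _)) (.fl (.andA _ _ _)))
      (.and (.id _) (der_trans (der_loc hI h1 (hV s (by simp))) _))) (.fl (.sw _ _ _))) (.id _))
      (.fl (.orA _ _ _))) (.or (.id _) (der_ct U).full)

/-- From `T` to `[α∨U]`, for a chain of steps from `t` to `α`. -/
noncomputable def layer (V T U : Formula B) (I : Formula B → OD) (α : Formula B)
    (L : List (Step B)) : OD :=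
  .l .andT' ⨾ orW ⨾ chainD V T U I L ⨾ .or (andDrop (cw T) ⨾ fin V U I α) .id ⨾
    .l .orA ⨾ .or .id (ct U)

/-- The proof starts from t, so `T` and an added `U` suffice to start the translated chain. At its
end `T` is dropped and the pseudocomplements in the conclusion are undone. -/
theorem der_layer {V T U : Formula B} {I : Formula B → OD}
    (hI : ∀ a, Mem (.atom a) V → Der Full (I (.atom a)) (sub (.atom a) .ff T) (sub (.atom a) .tt U))
    {S : Set Rule} {L : List (Step B)} {α : Formula B} (hL : IsChain S .tt L α) (hV : Decided V L) :
    Der Full (layer V T U I α L) T (.or α U) :=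
  .comp (.comp (.comp (.comp (.comp (.fl (.andT' _)) (der_orW _ _)) (der_chainD hI hL hV))
    (.or (.comp (der_andDrop (der_cw T) _) (der_fin hI α)) (.id _))) (.fl (.orA _ _ _)))
    (.or (.id _) (der_ct U).full)

/-- From `t` to `[α∨TH V k]`. -/
noncomputable def layers (V α : Formula B) (L : List (Step B)) : ℕ → OD
  | 0 => st V ⨾ orW'
  | k + 1 => layers V α L k ⨾
      .or .id (layer V (TH V k) (TH V (k + 1)) (fun p => INC p V k) α L) ⨾ .l .orA' ⨾ .or (ct α) .id

/-- From `t` to `α`. -/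
noncomputable def whole (V α : Formula B) (L : List (Step B)) (n : ℕ) : OD :=
  layers V α L n ⨾ .or .id (dn (TH V n)) ⨾ .l .orF

/-- The conclusion of one layer contains the premiss of the next as a disjunct, so the layers can be
stacked, contracting the copies of `α` on the way. The stack starts at threshold 0, which is
provable, and stops at one that cannot be met. -/
theorem der_whole {V α : Formula B} {L : List (Step B)} {n : ℕ} {S : Set Rule}
    (hL : IsChain S .tt L α) (hV : Decided V L) (hV' : ∀ a, Mem (.atom a) V → Once (.atom a) V)
    (hn : V.size < n) : Der Full (whole V α L n) .tt α := by
  have key : ∀ k, Der Full (layers V α L k) .tt (.or α (TH V k)) := by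
    intro k
    induction k with
    | zero => exact .comp (der_st V) (der_orW' _ _)
    | succ k ih =>
      exact .comp (.comp (.comp ih (.or (.id _) (der_layer (fun a ha => der_INC (hV' a ha) k) hL hV)))
        (.fl (.orA' _ _ _))) (.or (der_ct α).full (.id _))
  have h := der_dn (TH V n)
  -- Even with all atoms true, `V` has fewer than `n` true leaves, so the last threshold evaluates
  -- to f.
  rw [if_neg fun h => by have := le_of_val_TH h; omega] at h
  exact .comp (.comp (key n) (.or (.id _) h)) (.fl (.orF _))

/-! ### Collecting the atoms -/

/-- Insertion into a balanced disjunction. -/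
def ins (p : Formula B) : Formula B → Formula B
  | .or α β => .or (ins p β) α
  | α => .or p α

open Classical in
/-- A balanced disjunction of the atoms of identities and cuts, one out of each pair of dual
atoms. -/
noncomputable def collect : List (Step B) → Formula B
  | [] => .ff
  | s :: L =>
    if (s.rule = .aiDown ∨ s.rule = .aiUp) ∧
        ¬ (Mem (cutAtom s) (collect L) ∨ Mem (neg (cutAtom s)) (collect L)) then
      ins (cutAtom s) (collect L)
    else collect L

theorem mem_ins {p q : Formula B} (V : Formula B) :
    Mem q (ins p V) ↔ Mem q p ∨ Mem q V := by
  induction V with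
  | or α β ih ih' => simp only [ins, Mem, ih']; tauto
  | _ => rfl

theorem Once.ins {a : B} {q V : Formula B} (h : Once q V) (hq : ¬ Mem q (.atom a)) :
    Once q (ins (.atom a) V) := by
  induction V with
  | or α β ih ih' =>
    simp only [DeepInference.ins, Once, mem_ins, not_or]
    rcases h with ⟨h1, h2⟩ | ⟨h1, h2⟩
    · exact Or.inr ⟨⟨hq, h2⟩, h1⟩
    · exact Or.inl ⟨ih' h2, h1⟩
  | _ => exact Or.inr ⟨hq, h⟩

theorem once_ins {a : B} {V : Formula B} (h : ¬ Mem (.atom a) V) :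
    Once (.atom a) (ins (.atom a) V) := by
  induction V with
  | or α β ih ih' =>
    simp only [Mem, not_or] at h
    exact Or.inl ⟨ih' h.2, h.1⟩
  | _ => exact Or.inl ⟨rfl, h⟩

theorem size_ins (a : B) (V : Formula B) : (ins (.atom a) V).size = V.size + 1 := by
  induction V with
  | or α β ih ih' => simp only [ins, Formula.size, ih']; ring
  | _ => simp [ins, Formula.size, Nat.add_comm]

/-- The depth of a formula. -/
def dep : Formula B → ℕ
  | .or α β => max (dep α) (dep β) + 1
  | .and α β => max (dep α) (dep β) + 1
  | _ => 0

/-- Balanced disjunctions. -/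
def Bal : Formula B → Prop
  | .or α β => Bal α ∧ Bal β ∧ β.size ≤ α.size ∧ α.size ≤ β.size + 1
  | .and _ _ => False
  | _ => True

/-- The new atom goes into the right part, which is never the larger one, and the parts are swapped;
their sizes keep differing by at most one. -/
theorem Bal.ins {V : Formula B} (h : Bal V) (a : B) : Bal (ins (.atom a) V) := by
  induction V with
  | or α β ih ih' =>
    obtain ⟨h1, h2, h3, h4⟩ := h
    exact ⟨ih' h2, h1, by rw [size_ins]; omega, by rw [size_ins]; omega⟩
  | and => exact h.elim
  | _ => exact ⟨trivial, trivial, le_rfl, Nat.le_succ _⟩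

theorem Bal.dep_le {V : Formula B} (h : Bal V) : 2 ^ dep V ≤ 2 * V.size - 1 := by
  -- The induction needs the sharper bound 2(s-1), which fails only for a single leaf. With a ≤ b+1,
  -- doubling 2(a-1) gives 4a-4 ≤ 2(a+b-1).
  have aux : 2 ^ dep V ≤ 2 * (V.size - 1) ∨ (dep V = 0 ∧ V.size = 1) := by
    induction V with
    | or α β ih ih' =>
      obtain ⟨h1, h2, h3, h4⟩ := h
      have := α.size_pos
      have := β.size_pos
      have ha := ih h1
      have hb := ih' h2
      simp only [dep, Formula.size]
      left
      rcases max_choice (dep α) (dep β) with e | e <;> rw [e, pow_succ]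
      · rcases ha with ha | ⟨ha, ha'⟩
        · omega
        · rw [ha]; omega
      · rcases hb with hb | ⟨hb, hb'⟩
        · omega
        · rw [hb]; omega
    | and => exact h.elim
    | _ => exact Or.inr ⟨rfl, rfl⟩
  have := V.size_pos
  rcases aux with h | ⟨h, h'⟩
  · omega
  · simp [h, h']

theorem exists_cutAtom {s : Step B} (h : Instance s.rule s.upper s.lower)
    (hs : s.rule = .aiDown ∨ s.rule = .aiUp) : ∃ a, cutAtom s = .atom a := by
  obtain ⟨ξ, ρ, up, lo⟩ := s
  dsimp only at h hs
  cases h with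
  | aiDown a => exact ⟨a, by simp [cutAtom, Formula.L]⟩
  | aiUp a => exact ⟨a, by simp [cutAtom, Formula.L]⟩
  | _ => simp at hs

/-- An atom is inserted only if neither it nor its dual is present. Hence no dual pair and no
repetition arises, and each identity or cut has exactly one of its atoms in the collection. -/
theorem collect_spec {L : List (Step B)} (h : ∀ s ∈ L, Instance s.rule s.upper s.lower) :
    (∀ a, Mem (.atom a) (collect L) → ¬ Mem (.atom (Atoms.dual a)) (collect L)) ∧
      (∀ a, Mem (.atom a) (collect L) → Once (.atom a) (collect L)) ∧ Decided (collect L) L := by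
  induction L with
  | nil => exact ⟨fun _ h => h.elim, fun _ h => h.elim, fun _ h => by simp at h⟩
  | cons s L ih =>
    obtain ⟨h1, h2, h3⟩ := ih fun r hr => h r (by simp [hr])
    by_cases hc : (s.rule = .aiDown ∨ s.rule = .aiUp) ∧
        ¬ (Mem (cutAtom s) (collect L) ∨ Mem (neg (cutAtom s)) (collect L))
    · have e : collect (s :: L) = ins (cutAtom s) (collect L) := by rw [collect, if_pos hc]
      rw [e]
      obtain ⟨a, ha⟩ := exists_cutAtom (h s (by simp)) hc.1
      rw [ha] at hc ⊢
      simp only [neg, not_or] at hc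
      have hm : ∀ x, Mem (.atom x) (ins (.atom a) (collect L)) ↔ a = x ∨ Mem (.atom x) (collect L) :=
        fun x => by rw [mem_ins]; simp [Mem]
      refine ⟨fun x hx hx' => ?_, fun x hx => ?_, fun r hr hr' => ?_⟩
      · rw [hm] at hx hx'
        rcases hx with rfl | hx
        · exact hx'.elim (fun e => Atoms.dual_ne _ e.symm) hc.2.2
        · rcases hx' with e | hx'
          · rw [e, Atoms.dual_dual] at hc
            exact hc.2.2 hx
          · exact h1 x hx hx'
      · by_cases e : a = x
        · subst e; exact once_ins hc.2.1
        · exact (h2 x (((hm x).1 hx).resolve_left e)).ins (by simpa [Mem] using e)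
      · obtain ⟨y, hy⟩ := exists_cutAtom (h r hr) hr'
        rw [hy]
        simp only [neg, hm]
        rcases List.mem_cons.1 hr with rfl | hr
        · rw [ha, Formula.atom.injEq] at hy
          subst hy
          exact Or.inl ⟨Or.inl rfl, by simpa [Ne.symm (Atoms.dual_ne a)] using hc.2.2⟩
        · have h4 := h3 r hr hr'
          rw [hy] at h4
          simp only [neg] at h4
          -- A newly inserted atom is not dual to anything present, so it cannot upset a pair that
          -- was already decided; `e2` is the mirror image.
          have e1 : Mem (.atom y) (collect L) → a ≠ Atoms.dual y := by
            rintro hy rfl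
            rw [Atoms.dual_dual] at hc
            exact hc.2.2 hy
          have e2 : Mem (.atom (Atoms.dual y)) (collect L) → a ≠ y := by
            rintro hy rfl
            exact hc.2.2 hy
          rcases h4 with h4 | h4
          · exact Or.inl ⟨Or.inr h4.1, fun hh => hh.elim (e1 h4.1) h4.2⟩
          · exact Or.inr ⟨fun hh => hh.elim (e2 h4.2) h4.1, Or.inr h4.2⟩
    · have e : collect (s :: L) = collect L := by rw [collect, if_neg hc]
      rw [e]
      refine ⟨h1, h2, fun r hr hr' => ?_⟩
      rcases List.mem_cons.1 hr with rfl | hr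
      · obtain ⟨y, hy⟩ := exists_cutAtom (h r (by simp)) hr'
        have hc := not_not.1 (not_and.1 hc hr')
        rw [hy] at hc ⊢
        rcases hc with hc | hc
        · exact Or.inl ⟨hc, h1 _ hc⟩
        · refine Or.inr ⟨fun h' => h1 _ h' hc, hc⟩
      · exact h3 r hr hr'

theorem collect_size {L : List (Step B)} (h : ∀ s ∈ L, Instance s.rule s.upper s.lower) :
    Bal (collect L) ∧ (collect L).size ≤ L.length + 1 := by
  induction L with
  | nil => exact ⟨trivial, le_rfl⟩
  | cons s L ih =>
    obtain ⟨h1, h2⟩ := ih fun r hr => h r (by simp [hr])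
    rw [collect]
    split
    · rename_i hc
      obtain ⟨a, ha⟩ := exists_cutAtom (h s (by simp)) hc.1
      rw [ha, size_ins]
      exact ⟨h1.ins a, by simp only [List.length_cons]; omega⟩
    · exact ⟨h1, by simp only [List.length_cons]; omega⟩

end
end DeepInference

/-! ### The construction runs in quasipolynomial time. -/

namespace DeepInference

/-! ### Recursion with additive growth -/

section
variable {Ω : Type v} {A : Ω → Type u} [∀ ω, Atoms (A ω)] {b : ∀ ω, Tree (A ω)}

/-- A bound in terms of an input with an extra index becomes uniform in that index, as soon as those
inputs have a common size bound. It supplies the constants of the recursions below. -/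
theorem Bd.sup {I : Ω → Type w} {c : ∀ x : Σ ω, I ω, Tree (A x.1)} {g : (Σ ω, I ω) → ℕ}
    (hg : Bd c g) {M : Ω → ℕ} (hM : Bd b M) (h : ∀ ω i, (c ⟨ω, i⟩).size ≤ M ω) :
    ∃ K, Bd b K ∧ ∀ ω i, g ⟨ω, i⟩ ≤ K ω := by
  obtain ⟨q, hq, hg⟩ := hg.out
  exact ⟨_, Bd.comp hq hM, fun ω i => (hg _).trans (hq.mono (h ω i))⟩

theorem Bd.length {X : Ω → Type w} {e : ∀ ω, X ω → Tree (A ω)} {l : ∀ ω, List (X ω)}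
    [h : Cmp b fun ω => encL (e ω) (l ω)] : Bd b fun ω => (l ω).length :=
  (Bd.size (H := h)).mono fun ω => by have := length_le_encL (e ω) (l ω); omega

theorem Bd.num {n : Ω → ℕ} (h : Cmp b fun ω => Tree.num (n ω)) : Bd b n :=
  (Bd.size (H := h)).mono fun ω => by rw [Tree.size_num]; omega

/-- If each connective adds at most `K` to the sizes of the two recursive results, the total is at
most linear in the number of leaves, so the size hypothesis of `Cmp.formulaRec` need not be checked
separately. -/
theorem Cmp.formulaAdd (F : ∀ ω, Formula (A ω)) (f : ∀ ω, Formula (A ω) → Tree (A ω))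
    (K : Ω → ℕ) [hK : Bd b K]
    (hKor : ∀ ω α β, (f ω (.or α β)).size ≤ (f ω α).size + (f ω β).size + K ω)
    (hKand : ∀ ω α β, (f ω (.and α β)).size ≤ (f ω α).size + (f ω β).size + K ω)
    [h₀ : Cmp b fun ω => (F ω).encode]
    (hff : Cmp b fun ω => f ω .ff) (htt : Cmp b fun ω => f ω .tt)
    (hatom : ∀ b' : (∀ x : (Σ ω, A ω), Tree (A x.1)), (∀ Y, Cmp b Y → Cmp b' fun x => Y x.1) →
      Cmp b' (fun x => .atom x.2) → Cmp b' fun x => f x.1 (.atom x.2))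
    (hor : ∀ b' : (∀ x : (Σ ω, Formula (A ω) × Formula (A ω)), Tree (A x.1)),
      (∀ Y, Cmp b Y → Cmp b' fun x => Y x.1) →
      Cmp b' (fun x => x.2.1.encode) → Cmp b' (fun x => x.2.2.encode) →
      Cmp b' (fun x => f x.1 x.2.1) → Cmp b' (fun x => f x.1 x.2.2) →
      Cmp b' fun x => f x.1 (.or x.2.1 x.2.2))
    (hand : ∀ b' : (∀ x : (Σ ω, Formula (A ω) × Formula (A ω)), Tree (A x.1)),
      (∀ Y, Cmp b Y → Cmp b' fun x => Y x.1) →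
      Cmp b' (fun x => x.2.1.encode) → Cmp b' (fun x => x.2.2.encode) →
      Cmp b' (fun x => f x.1 x.2.1) → Cmp b' (fun x => f x.1 x.2.2) →
      Cmp b' fun x => f x.1 (.and x.2.1 x.2.2)) :
    Cmp b fun ω => f ω (F ω) := by
  have hb : Bd b fun ω => (b ω).size + 2 := inferInstance
  obtain ⟨K₁, hK₁, h₁⟩ := Bd.sup (b := b) (Bd.size (H := hatom (fun x => .pair (b x.1) (.atom x.2))
    (fun Y hY => Cmp.refl.fst.trans (hY.pull _)) Cmp.refl.snd)) hb
    (fun ω i => by simp only [Tree.size]; omega)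
  have hB : Bd b fun ω => 2 * (F ω).encode.size *
    (K ω + K₁ ω + (f ω .ff).size + (f ω .tt).size) := inferInstance
  refine Cmp.formulaRec F f _ (hM := hB) (fun ω G hG => ?_) hff htt hatom hor hand
  set k := K ω + K₁ ω + (f ω .ff).size + (f ω .tt).size with hk
  -- The extra `k` on the left is what lets a node absorb its own increment `K ω`: two summands `k`
  -- are available from the children and only one is needed.
  have key : (f ω G).size + k ≤ 2 * G.size * k := by
    clear hG
    induction G with
    | ff => simp only [Formula.size]; omega
    | tt => simp only [Formula.size]; omega
    | atom a => have := h₁ ω a; simp only [Formula.size]; dsimp only at this; omega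
    | or α β ih ih' =>
      have := hKor ω α β
      simp only [Formula.size]
      have e : 2 * (α.size + β.size) * k = 2 * α.size * k + 2 * β.size * k := by ring
      rw [e]
      omega
    | and α β ih ih' =>
      have := hKand ω α β
      simp only [Formula.size]
      have e : 2 * (α.size + β.size) * k = 2 * α.size * k + 2 * β.size * k := by ring
      rw [e]
      omega
  have h2 : 2 * G.size * k ≤ 2 * (F ω).encode.size * k :=
    Nat.mul_le_mul_right _ (Nat.mul_le_mul_left _ (G.size_encode.1.trans hG))
  omega

theorem Cmp.listAdd {X : Ω → Type w} {e : ∀ ω, X ω → Tree (A ω)} (l : ∀ ω, List (X ω))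
    (f : ∀ ω, List (X ω) → Tree (A ω)) (K : Ω → ℕ) [hK : Bd b K]
    (hKcons : ∀ ω x k, x ∈ l ω → (f ω (x :: k)).size ≤ (f ω k).size + K ω)
    [h₀ : Cmp b fun ω => encL (e ω) (l ω)]
    (hnil : Cmp b fun ω => f ω [])
    (hcons : ∀ b' : (∀ x : (Σ ω, X ω × List (X ω)), Tree (A x.1)),
      (∀ Y, Cmp b Y → Cmp b' fun x => Y x.1) →
      Cmp b' (fun x => e x.1 x.2.1) → Cmp b' (fun x => encL (e x.1) x.2.2) →
      Cmp b' (fun x => f x.1 x.2.2) → Cmp b' fun x => f x.1 (x.2.1 :: x.2.2)) :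
    Cmp b fun ω => f ω (l ω) := by
  have hl : Bd b fun ω => (l ω).length := Bd.length (h := h₀)
  have hB : Bd b fun ω => (f ω []).size + (l ω).length * K ω := inferInstance
  refine Cmp.listRec l f _ (hM := hB) (fun ω k hk => ?_) hnil hcons
  have key : (f ω k).size ≤ (f ω []).size + k.length * K ω := by
    induction k with
    | nil => simp
    | cons x k ih =>
      have h1 := hKcons ω x k (hk.subset (by simp))
      have h2 := ih ((List.suffix_cons x k).trans hk)
      rw [List.length_cons, add_mul, one_mul]
      omega
  exact key.trans (Nat.add_le_add_left (Nat.mul_le_mul_right _ hk.length_le) _)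

theorem Cmp.contextAdd (ξ : ∀ ω, Context (A ω)) (f : ∀ ω, Context (A ω) → Tree (A ω))
    (K : Ω → ℕ) [hK : Bd b K]
    (hKnode : ∀ ω ζ, ζ.encode.size ≤ (ξ ω).encode.size → (f ω ζ).size ≤ (f ω ζ.sub).size + K ω)
    [h₀ : Cmp b fun ω => (ξ ω).encode] (hhole : Cmp b fun ω => f ω .hole)
    (hnode : ∀ b' : (∀ x : (Σ ω, {ζ : Context (A ω) // ζ.tag ≠ 0}), Tree (A x.1)),
      (∀ Y, Cmp b Y → Cmp b' fun x => Y x.1) → Cmp b' (fun x => x.2.1.encode) →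
      Cmp b' (fun x => f x.1 x.2.1.sub) → Cmp b' fun x => f x.1 x.2.1) :
    Cmp b fun ω => f ω (ξ ω) := by
  have hB : Bd b fun ω => (f ω .hole).size + (ξ ω).encode.size * K ω := inferInstance
  refine Cmp.contextRec ξ f _ (hM := hB) (fun ω ζ hζ => ?_) hhole hnode
  have key : (f ω ζ).size ≤ (f ω .hole).size + ζ.encode.size * K ω := by
    induction h : ζ.encode.size using Nat.strong_induction_on generalizing ζ with
    | _ n ih =>
      subst h
      by_cases ht : ζ.tag = 0
      · have : ζ = .hole := by cases ζ <;> simp [Context.tag] at ht ⊢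
        subst this
        omega
      · have h1 := ζ.size_sub.2 ht
        have h2 := ih ζ.sub.encode.size (by omega) ζ.sub (by omega) rfl
        have h3 := hKnode ω ζ hζ
        have h4 := Nat.mul_le_mul_right (K ω) h1
        rw [add_mul, one_mul] at h4
        omega
  exact key.trans (Nat.add_le_add_left (Nat.mul_le_mul_right _ hζ) _)

theorem Cmp.natAdd (n : Ω → ℕ) (f : ∀ ω, ℕ → Tree (A ω)) (K : Ω → ℕ) [hK : Bd b K]
    (hKs : ∀ ω k, k < n ω → (f ω (k + 1)).size ≤ (f ω k).size + K ω)
    [h₀ : Cmp b fun ω => Tree.num (n ω)] (hz : Cmp b fun ω => f ω 0)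
    (hs : ∀ b' : (∀ x : (Σ ω : Ω, {k // k < n ω}), Tree (A x.1)),
      (∀ Y, Cmp b Y → Cmp b' fun x => Y x.1) → Cmp b' (fun x => Tree.num x.2.1) →
      Cmp b' (fun x => f x.1 x.2.1) → Cmp b' fun x => f x.1 (x.2.1 + 1)) :
    Cmp b fun ω => f ω (n ω) := by
  have hn := Bd.num h₀
  have hB : Bd b fun ω => (f ω 0).size + n ω * K ω := inferInstance
  refine Cmp.natRec n f _ (hM := hB) (fun ω k hk => ?_) hz hs
  have key : (f ω k).size ≤ (f ω 0).size + k * K ω := by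
    induction k with
    | zero => simp
    | succ k ih =>
      have h1 := hKs ω k hk
      have h2 := ih (by omega)
      rw [add_mul, one_mul]
      omega
  exact key.trans (Nat.add_le_add_left (Nat.mul_le_mul_right _ hk) _)

/-- Case distinction over a finite list. -/
theorem Cmp.enum {E : Type} (l : List E) {ρ : Ω → E} (hl : ∀ ω, ρ ω ∈ l)
    (hg : ∀ σ, Cmp b fun ω => bt (ρ ω = σ)) {X : ∀ ω, E → Tree (A ω)}
    (hX : ∀ σ, Cmp b fun ω => X ω σ) : Cmp b fun ω => X ω (ρ ω) := by
  classical
  have key : ∀ l : List E, Cmp b fun ω => if ρ ω ∈ l then X ω (ρ ω) else .nil := by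
    intro l
    induction l with
    | nil => simpa using Cmp.nil
    | cons σ l ih =>
      have := hg σ
      refine (Cmp.iteTree (c := fun ω => ρ ω = σ) (d := fun _ => Classical.dec _)
        (hX := hX σ) (hY := ih)).congr fun ω => ?_
      by_cases h : ρ ω = σ
      · simp [h]
      · simp [h]
  exact (key l).congr fun ω => if_pos (hl ω)

end

/-! ### Codes -/

/-- All linear rules have numbers. -/
def Lin.code : Lin → ℕ
  | .orC => 0 | .andC => 1 | .orA => 2 | .orA' => 3 | .andA => 4 | .andA' => 5 | .orF => 6
  | .orF' => 7 | .andT => 8 | .andT' => 9 | .orT => 10 | .orT' => 11 | .andF => 12 | .andF' => 13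
  | .sw => 14 | .md => 15

def Rul.code : Rul → ℕ
  | .ai => 0 | .aw => 1 | .ac => 2 | .awu => 3 | .acu => 4 | .W => 5 | .lin i => i.code + 6

/-- All rules of derivation terms. -/
def rules : List Rul := [.ai, .aw, .ac, .awu, .acu, .W] ++ linRules.map .lin

theorem mem_rules (ρ : Rul) : ρ ∈ rules := by
  cases ρ with
  | lin i => cases i <;> simp [rules, linRules]
  | _ => simp [rules]

theorem Rul.code_injective : Function.Injective Rul.code := by
  have : ∀ ρ : Rul, rules.getD ρ.code .W = ρ := by
    intro ρ
    cases ρ with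
    | lin i => cases i <;> rfl
    | _ => rfl
  exact fun ρ σ h => by rw [← this ρ, h, this]

theorem Rul.code_le (ρ : Rul) : ρ.code ≤ 21 := by
  cases ρ with
  | lin i => cases i <;> simp [code, Lin.code]
  | _ => simp [code]

def OD.enc {B : Type u} : OD → Tree B
  | .id => .tagged 0 .nil
  | .rule ρ => .tagged 1 (.num ρ.code)
  | .or D E => .tagged 2 (.pair D.enc E.enc)
  | .and D E => .tagged 3 (.pair D.enc E.enc)
  | .comp D E => .tagged 4 (.pair D.enc E.enc)

/-- The number of nodes of a derivation term. -/
def OD.len : OD → ℕ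
  | .id => 1
  | .rule _ => 1
  | .or D E => D.len + E.len + 1
  | .and D E => D.len + E.len + 1
  | .comp D E => D.len + E.len + 1

theorem OD.len_le {B : Type u} (D : OD) : D.len ≤ (D.enc : Tree B).size := by
  induction D <;> simp only [len, enc, Tree.size_tagged, Tree.size] <;> omega

theorem OD.enc_size_le {B : Type u} (D : OD) : (D.enc : Tree B).size ≤ 60 * D.len := by
  induction D with
  | rule ρ => have := ρ.code_le; simp only [len, enc, Tree.size_tagged, Tree.size_num]; omega
  | _ => simp only [len, enc, Tree.size_tagged, Tree.size] <;> omega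

section
variable {Ω : Type v} {A : Ω → Type u} [∀ ω, Atoms (A ω)] {b : ∀ ω, Tree (A ω)}

instance Cmp.odOr {D E : Ω → OD} [Cmp b fun ω => (D ω).enc] [Cmp b fun ω => (E ω).enc] :
    Cmp b fun ω => (OD.or (D ω) (E ω)).enc := by
  simp only [OD.enc]; infer_instance

instance Cmp.odAnd {D E : Ω → OD} [Cmp b fun ω => (D ω).enc] [Cmp b fun ω => (E ω).enc] :
    Cmp b fun ω => (OD.and (D ω) (E ω)).enc := by
  simp only [OD.enc]; infer_instance

instance Cmp.odComp {D E : Ω → OD} [Cmp b fun ω => (D ω).enc] [Cmp b fun ω => (E ω).enc] :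
    Cmp b fun ω => (D ω ⨾ E ω).enc := by
  simp only [OD.enc]; infer_instance

instance Cmp.odConst (D : OD) : Cmp b fun _ => D.enc := by
  induction D with
  | id => simp only [OD.enc]; infer_instance
  | rule ρ => simp only [OD.enc]; infer_instance
  | _ => infer_instance

instance Cmp.odIte {X Y : Ω → OD} {c : Ω → Prop} {d : ∀ ω, Decidable (c ω)}
    [hc : Cmp b fun ω => bt (c ω)] [hX : Cmp b fun ω => (X ω).enc]
    [hY : Cmp b fun ω => (Y ω).enc] :
    Cmp b fun ω => (if c ω then X ω else Y ω).enc :=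
  (Cmp.ite (d := d) hc hX hY).congr fun ω => by split <;> rfl

/-! ### Computability of the basic constructions -/

end
end DeepInference

namespace DeepInference

/-! ### Computability of the basic constructions -/

section
variable {Ω : Type v} {A : Ω → Type u} [∀ ω, Atoms (A ω)] {b : ∀ ω, Tree (A ω)}

theorem bt_size {B : Type u} (p : Prop) : 1 ≤ (bt p : Tree B).size ∧ (bt p : Tree B).size ≤ 3 := by
  by_cases h : p <;> simp [bt, h, Tree.true, Tree.size]

instance cmp_wk {F : ∀ ω, Formula (A ω)} [Cmp b fun ω => (F ω).encode] :
    Cmp b fun ω => (wk (F ω)).enc := by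
  refine Cmp.formulaAdd F (fun ω G => (wk G).enc) (fun ω => 300) ?_ ?_ ?_ ?_ ?_ ?_ ?_
  iterate 2 intros; simp only [wk, OD.enc, Tree.size_tagged, Tree.size, Tree.size_num, Rul.code, Lin.code]; omega
  all_goals intros; simp only [wk]; infer_instance

instance cmp_cw {F : ∀ ω, Formula (A ω)} [Cmp b fun ω => (F ω).encode] :
    Cmp b fun ω => (cw (F ω)).enc := by
  refine Cmp.formulaAdd F (fun ω G => (cw G).enc) (fun ω => 300) ?_ ?_ ?_ ?_ ?_ ?_ ?_
  iterate 2 intros; simp only [cw, OD.enc, Tree.size_tagged, Tree.size, Tree.size_num, Rul.code, Lin.code]; omega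
  all_goals intros; simp only [cw]; infer_instance

instance cmp_ct {F : ∀ ω, Formula (A ω)} [Cmp b fun ω => (F ω).encode] :
    Cmp b fun ω => (ct (F ω)).enc := by
  have hB : Bd b fun ω => 300 + (orMix.enc : Tree (A ω)).size := inferInstance
  refine Cmp.formulaAdd F (fun ω G => (ct G).enc) _ (hK := hB) ?_ ?_ ?_ ?_ ?_ ?_ ?_
  iterate 2 intros; simp only [ct, OD.enc, Tree.size_tagged, Tree.size, Tree.size_num, Rul.code, Lin.code]; omega
  all_goals intros; simp only [ct]; infer_instance

instance cmp_cc {F : ∀ ω, Formula (A ω)} [Cmp b fun ω => (F ω).encode] :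
    Cmp b fun ω => (cc (F ω)).enc := by
  have hB : Bd b fun ω => 300 + (andMix.enc : Tree (A ω)).size := inferInstance
  refine Cmp.formulaAdd F (fun ω G => (cc G).enc) _ (hK := hB) ?_ ?_ ?_ ?_ ?_ ?_ ?_
  iterate 2 intros; simp only [cc, OD.enc, Tree.size_tagged, Tree.size, Tree.size_num, Rul.code, Lin.code]; omega
  all_goals intros; simp only [cc]; infer_instance

instance cmp_sub {p χ : ∀ ω, Formula (A ω)} {F : ∀ ω, Formula (A ω)} [Cmp b fun ω => (p ω).encode]
    [Cmp b fun ω => (χ ω).encode] [Cmp b fun ω => (F ω).encode] :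
    Cmp b fun ω => (sub (p ω) (χ ω) (F ω)).encode := by
  refine Cmp.formulaAdd F (fun ω G => (sub (p ω) (χ ω) G).encode) (fun ω => 20) ?_ ?_ ?_ ?_ ?_ ?_ ?_
  iterate 2 intros; simp only [sub, Formula.encode, Tree.size_tagged, Tree.size]; omega
  iterate 2 simp only [sub]; infer_instance
  all_goals
    intro b' lift
    intros
    simp only [sub]
    have := lift _ ‹Cmp b fun ω => (p ω).encode›
    have := lift _ ‹Cmp b fun ω => (χ ω).encode›
    infer_instance

instance cmp_mem {p F : ∀ ω, Formula (A ω)} [Cmp b fun ω => (p ω).encode]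
    [Cmp b fun ω => (F ω).encode] : Cmp b fun ω => bt (Mem (p ω) (F ω)) := by
  refine Cmp.formulaAdd F (fun ω G => bt (Mem (p ω) G)) (fun ω => 3) ?_ ?_ ?_ ?_ ?_ ?_ ?_
  iterate 2 exact fun _ _ _ => (bt_size _).2.trans (Nat.le_add_left _ _)
  iterate 2 simp only [Mem]; infer_instance
  all_goals
    intro b' lift
    intros
    simp only [Mem]
    have := lift _ ‹Cmp b fun ω => (p ω).encode›
    infer_instance

instance cmp_val {F : ∀ ω, Formula (A ω)} [Cmp b fun ω => (F ω).encode] :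
    Cmp b fun ω => bt (val (F ω)) := by
  refine Cmp.formulaAdd F (fun ω G => bt (val G)) (fun ω => 3) ?_ ?_ ?_ ?_ ?_ ?_ ?_
  iterate 2 exact fun _ _ _ => (bt_size _).2.trans (Nat.le_add_left _ _)
  all_goals intros; simp only [val]; infer_instance

instance cmp_neg {F : ∀ ω, Formula (A ω)} [Cmp b fun ω => (F ω).encode] :
    Cmp b fun ω => (neg (F ω)).encode := by
  refine Cmp.formulaAdd F (fun ω G => (neg G).encode) (fun ω => 30) ?_ ?_ ?_ ?_ ?_ ?_ ?_
  iterate 2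
    intro ω α β
    have : ∀ G : Formula (A ω), G.encode.size ≤ (neg G).encode.size := fun G => by cases G <;> rfl
    have h1 := this α
    have h2 := this β
    refine le_trans (b := α.encode.size + β.encode.size + 30) ?_ (by omega)
    simp only [neg, Formula.encode, Tree.size_tagged, Tree.size]
    omega
  all_goals intros; simp only [neg]; infer_instance

instance cmp_ext {p : ∀ ω, Formula (A ω)} {F : ∀ ω, Formula (A ω)} [Cmp b fun ω => (p ω).encode]
    [Cmp b fun ω => (F ω).encode] :
    Cmp b fun ω => (ext (p ω) (F ω)).enc := by
  have hB : Bd b fun ω => 300 + ((pullOr (.rule .ac)).enc : Tree (A ω)).size + ((pullAnd (.rule .ac)).enc : Tree (A ω)).size := inferInstance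
  refine Cmp.formulaAdd F (fun ω G => (ext (p ω) G).enc) _ (hK := hB) ?_ ?_ ?_ ?_ ?_ ?_ ?_
  iterate 2 intros; simp only [ext, OD.enc, Tree.size_tagged, Tree.size]; omega
  iterate 2 simp only [ext]; infer_instance
  all_goals
    intro b' lift
    intros
    simp only [ext]
    have := lift _ ‹Cmp b fun ω => (p ω).encode›
    infer_instance

instance cmp_fill {p : ∀ ω, Formula (A ω)} {F : ∀ ω, Formula (A ω)} [Cmp b fun ω => (p ω).encode]
    [Cmp b fun ω => (F ω).encode] :
    Cmp b fun ω => (fill (p ω) (F ω)).enc := by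
  have hB : Bd b fun ω => 300 + (pushOr.enc : Tree (A ω)).size + (andMix.enc : Tree (A ω)).size := inferInstance
  refine Cmp.formulaAdd F (fun ω G => (fill (p ω) G).enc) _ (hK := hB) ?_ ?_ ?_ ?_ ?_ ?_ ?_
  iterate 2 intros; simp only [fill, OD.enc, Tree.size_tagged, Tree.size, Tree.size_num, Rul.code]; omega
  iterate 2 simp only [fill]; infer_instance
  all_goals
    intro b' lift
    intros
    simp only [fill]
    have := lift _ ‹Cmp b fun ω => (p ω).encode›
    infer_instance

instance cmp_st {F : ∀ ω, Formula (A ω)} [Cmp b fun ω => (F ω).encode] :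
    Cmp b fun ω => (st (F ω)).enc := by
  refine Cmp.formulaAdd F (fun ω G => (st G).enc) (fun ω => 300) ?_ ?_ ?_ ?_ ?_ ?_ ?_
  iterate 2 intros; simp only [st, OD.enc, Tree.size_tagged, Tree.size, Tree.size_num, Rul.code, Lin.code]; omega
  all_goals intros; simp only [st]; infer_instance

instance cmp_dn {F : ∀ ω, Formula (A ω)} [Cmp b fun ω => (F ω).encode] :
    Cmp b fun ω => (dn (F ω)).enc := by
  refine Cmp.formulaAdd F (fun ω G => (dn G).enc) (fun ω => 300) ?_ ?_ ?_ ?_ ?_ ?_ ?_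
  iterate 2 intros; simp only [dn, OD.enc, Tree.size_tagged, Tree.size]; (try split_ifs) <;> simp only [OD.enc, Tree.size_tagged, Tree.size, Tree.size_num, Rul.code, Lin.code] <;> omega
  all_goals intros; simp only [dn]; infer_instance

instance cmp_sg {V T p : ∀ ω, Formula (A ω)} [Cmp b fun ω => (V ω).encode]
    [Cmp b fun ω => (T ω).encode] [Cmp b fun ω => (p ω).encode] :
    Cmp b fun ω => (sg (V ω) (T ω) (p ω)).encode := by
  unfold sg; infer_instance

instance cmp_pullOr {c : Ω → OD} [Cmp b fun ω => (c ω).enc] :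
    Cmp b fun ω => (pullOr (c ω)).enc := by
  unfold pullOr; infer_instance

instance cmp_pullAnd {c : Ω → OD} [Cmp b fun ω => (c ω).enc] :
    Cmp b fun ω => (pullAnd (c ω)).enc := by
  unfold pullAnd; infer_instance

instance cmp_andDrop {c : Ω → OD} [Cmp b fun ω => (c ω).enc] :
    Cmp b fun ω => (andDrop (c ω)).enc := by
  unfold andDrop; infer_instance

instance cmp_cutD {U p : ∀ ω, Formula (A ω)} {c : Ω → OD} [Cmp b fun ω => (U ω).encode]
    [Cmp b fun ω => (p ω).encode] [Cmp b fun ω => (c ω).enc] :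
    Cmp b fun ω => (cutD (U ω) (p ω) (c ω)).enc := by
  unfold cutD; infer_instance

/-- Computable families of derivation terms, indexed by formulae. -/
abbrev CmpI (b : ∀ ω, Tree (A ω)) (I : ∀ ω, Formula (A ω) → OD) : Prop :=
  Cmp (Ω := Σ ω, Formula (A ω)) (fun x => .pair (b x.1) x.2.encode) fun x => (I x.1 x.2).enc

/-- The families `I` are functions on formulae and have no code of their own; computability of all
their values, with the formula as extra input, takes the place of one. -/
theorem CmpI.app {I : ∀ ω, Formula (A ω) → OD} (hI : CmpI b I) {Ω' : Type w} {g : Ω' → Ω}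
    {b' : ∀ x, Tree (A (g x))} (hb : Cmp b' fun x => b (g x)) {p : ∀ x, Formula (A (g x))}
    (hp : Cmp b' fun x => (p x).encode) : Cmp b' fun x => (I (g x) (p x)).enc :=
  (Cmp.pair (h₁ := hb) (h₂ := hp)).trans (hI.pull fun x => ⟨g x, p x⟩)

theorem cmp_fin {V U F : ∀ ω, Formula (A ω)} {I : ∀ ω, Formula (A ω) → OD}
    [Cmp b fun ω => (V ω).encode] [Cmp b fun ω => (U ω).encode] [Cmp b fun ω => (F ω).encode]
    (hI : CmpI b I) : Cmp b fun ω => (fin (V ω) (U ω) (I ω) (F ω)).enc := by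
  have hB : Bd b fun ω => 300 + ((pullOr (ct (U ω))).enc : Tree (A ω)).size +
    ((pullAnd (ct (U ω))).enc : Tree (A ω)).size := inferInstance
  refine Cmp.formulaAdd F (fun ω G => (fin (V ω) (U ω) (I ω) G).enc) _ (hK := hB)
    ?_ ?_ ?_ ?_ ?_ ?_ ?_
  iterate 2 intros; simp only [fin, OD.enc, Tree.size_tagged, Tree.size]; omega
  iterate 2 simp only [fin]; infer_instance
  all_goals
    intro b' lift
    intros
    have := lift _ ‹Cmp b fun ω => (V ω).encode›
    have := lift _ ‹Cmp b fun ω => (U ω).encode›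
    have hb := lift _ Cmp.refl
    simp only [fin]
  · have := hI.app hb (p := fun x : Σ ω, A ω => neg (.atom x.2)) inferInstance
    infer_instance
  all_goals infer_instance

end
end DeepInference

namespace DeepInference

section
variable {Ω : Type v} {A : Ω → Type u} [∀ ω, Atoms (A ω)] {b : ∀ ω, Tree (A ω)}

/-! ### Computability of the translation -/

instance cmp_ruleConst (ρ : Rule) : Cmp b fun _ => ρ.encode := by
  cases ρ <;> simp only [Rule.encode] <;> infer_instance

instance cmp_stepMk {ξ : ∀ ω, Context (A ω)} {ρ : Ω → Rule} {u l : ∀ ω, Formula (A ω)}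
    [Cmp b fun ω => (ξ ω).encode] [Cmp b fun ω => (ρ ω).encode] [Cmp b fun ω => (u ω).encode]
    [Cmp b fun ω => (l ω).encode] : Cmp b fun ω => (Step.mk (ξ ω) (ρ ω) (u ω) (l ω)).encode := by
  simp only [Step.encode]; infer_instance

section
variable {s : ∀ ω, Step (A ω)} [h : Cmp b fun ω => (s ω).encode]

instance cmp_stepContext : Cmp b fun ω => (s ω).context.encode := h.op .head

instance cmp_stepRule : Cmp b fun ω => (s ω).rule.encode := (h.op .tail).op .head

instance cmp_stepUpper : Cmp b fun ω => (s ω).upper.encode := ((h.op .tail).op .tail).op .head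

instance cmp_stepLower : Cmp b fun ω => (s ω).lower.encode := ((h.op .tail).op .tail).op .tail

instance cmp_btRuleEq (ρ : Rule) : Cmp b fun ω => bt ((s ω).rule = ρ) :=
  (Cmp.btEq (b := b) (X := fun ω => (s ω).rule.encode) (Y := fun _ => ρ.encode)).congr
    fun ω => by rw [Rule.encode_injective.eq_iff]

instance cmp_cutAtom : Cmp b fun ω => (cutAtom (s ω)).encode := by
  unfold cutAtom; infer_instance

end

instance cmp_up (i : Lin) {F : ∀ ω, Formula (A ω)} [Cmp b fun ω => (F ω).encode] :
    Cmp b fun ω => (i.up (F ω)).encode := by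
  cases i <;> simp only [Lin.up] <;> infer_instance

instance cmp_down (i : Lin) {F : ∀ ω, Formula (A ω)} [Cmp b fun ω => (F ω).encode] :
    Cmp b fun ω => (i.down (F ω)).encode := by
  cases i <;> simp only [Lin.down] <;> infer_instance

instance cmp_detect {u l : ∀ ω, Formula (A ω)} [Cmp b fun ω => (u ω).encode]
    [Cmp b fun ω => (l ω).encode] (L : List Lin) :
    Cmp b fun ω => (OD.l (detect (u ω) (l ω) L)).enc := by
  induction L with
  | nil => simp only [detect]; infer_instance
  | cons i L ih =>
    refine (Cmp.iteTree (c := fun ω => i.up (l ω) = u ω ∧ i.down (u ω) = l ω)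
      (d := fun _ => Classical.dec _) (hX := Cmp.odConst (.l i)) (hY := ih)).congr fun ω => ?_
    simp only [detect]
    split <;> rfl

instance cmp_trans {d : Ω → OD} {ξ : ∀ ω, Context (A ω)} [Cmp b fun ω => (d ω).enc]
    [Cmp b fun ω => (ξ ω).encode] : Cmp b fun ω => (trans (d ω) (ξ ω)).enc := by
  refine Cmp.contextAdd ξ (fun ω ζ => (trans (d ω) ζ).enc) (fun _ => 500) ?_ ?_ ?_
  · intro ω ζ _
    cases ζ <;> simp only [trans, Context.sub, OD.enc, Tree.size_tagged, Tree.size, Tree.size_num,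
      Rul.code, Lin.code] <;> omega
  · simp only [trans]; infer_instance
  · intro b' lift h h'
    have H : ∀ D : OD → OD, (∀ E : (Σ ω, {ζ : Context (A ω) // ζ.tag ≠ 0}) → OD,
        (Cmp b' fun x => (E x).enc) → Cmp b' fun x => (D (E x)).enc) →
        Cmp b' fun x => (D (trans (d x.1) x.2.1.sub)).enc := fun D hD => hD _ h'
    have h1 := H (fun D => .l .sw ⨾ .or D .id ⨾ .l .orA ⨾ .or .id (.l .orC) ⨾ .l .orA')
      (fun E hE => inferInstance)
    have h2 := H (fun D => .and .id (.l .orC) ⨾ .l .sw ⨾ .or D .id ⨾ .l .orC ⨾ .l .orA')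
      (fun E hE => inferInstance)
    have h3 := H (fun D => .l .andA' ⨾ .and D .id ⨾ .l .andC ⨾ .l .sw ⨾ .or (.l .andC) .id)
      (fun E hE => inferInstance)
    have h4 := H (fun D => .and .id (.l .andC) ⨾ .l .andA' ⨾ .and D .id ⨾ .l .andC ⨾ .l .sw)
      (fun E hE => inferInstance)
    refine (Cmp.iteTree (c := fun x => x.2.1.tag = 1) (d := fun _ => inferInstance) (hX := h1)
      (hY := Cmp.iteTree (c := fun x => x.2.1.tag = 2) (d := fun _ => inferInstance) (hX := h2)
      (hY := Cmp.iteTree (c := fun x => x.2.1.tag = 3) (d := fun _ => inferInstance) (hX := h3)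
      (hY := h4)))).congr ?_
    rintro ⟨ω, ζ, hζ⟩
    cases ζ
    · exact absurd rfl hζ
    all_goals rfl

theorem CmpI.lift {I : ∀ ω, Formula (A ω) → OD} (hI : CmpI b I) {Ω' : Type w} {g : Ω' → Ω}
    {b' : ∀ x, Tree (A (g x))} (hb : Cmp b' fun x => b (g x)) : CmpI b' fun x => I (g x) :=
  hI.app (Cmp.refl.fst.trans (hb.pull _)) Cmp.refl.snd

instance cmp_locI {V T p : ∀ ω, Formula (A ω)} [Cmp b fun ω => (V ω).encode]
    [Cmp b fun ω => (T ω).encode] [Cmp b fun ω => (p ω).encode] :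
    Cmp b fun ω => (locI (V ω) (T ω) (p ω)).enc := by
  unfold locI; infer_instance

theorem cmp_locC {V U p : ∀ ω, Formula (A ω)} {I : ∀ ω, Formula (A ω) → OD}
    [Cmp b fun ω => (V ω).encode] [Cmp b fun ω => (U ω).encode] [Cmp b fun ω => (p ω).encode]
    (hI : CmpI b I) : Cmp b fun ω => (locC (V ω) (U ω) (I ω) (p ω)).enc := by
  have := hI.app Cmp.refl (p := p) inferInstance
  have := hI.app Cmp.refl (p := fun ω => neg (p ω)) inferInstance
  unfold locC; infer_instance

theorem mem_ruleList (ρ : Rule) : ρ ∈ ([.aiDown, .awDown, .acDown, .aiUp, .awUp, .acUp, .switch,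
    .medial, .equal] : List Rule) := by
  cases ρ <;> simp

theorem cmp_loc {V T U : ∀ ω, Formula (A ω)} {I : ∀ ω, Formula (A ω) → OD} {s : ∀ ω, Step (A ω)}
    [Cmp b fun ω => (V ω).encode] [Cmp b fun ω => (T ω).encode] [Cmp b fun ω => (U ω).encode]
    [Cmp b fun ω => (s ω).encode] (hI : CmpI b I) :
    Cmp b fun ω => (loc (V ω) (T ω) (U ω) (I ω) (s ω)).enc := by
  have := cmp_locC (V := V) (U := U) (p := fun ω => (s ω).upper.L) hI
  refine Cmp.enum (ρ := fun ω => (s ω).rule)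
    -- Only the rule name is varied and the other data of the step are kept, so that `loc` reduces
    -- to a single branch for each name.
    (X := fun ω ρ => (loc (V ω) (T ω) (U ω) (I ω) { s ω with rule := ρ }).enc) _
    (fun _ => mem_ruleList _) (fun σ => inferInstance) (fun σ => ?_)
  cases σ <;> simp only [loc] <;> infer_instance

theorem cmp_stepD {V T U : ∀ ω, Formula (A ω)} {I : ∀ ω, Formula (A ω) → OD}
    {s : ∀ ω, Step (A ω)} [Cmp b fun ω => (V ω).encode] [Cmp b fun ω => (T ω).encode]
    [Cmp b fun ω => (U ω).encode] [Cmp b fun ω => (s ω).encode] (hI : CmpI b I) :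
    Cmp b fun ω => (stepD (V ω) (T ω) (U ω) (I ω) (s ω)).enc := by
  have := cmp_loc (V := V) (T := T) (U := U) (s := s) hI
  unfold stepD; infer_instance

theorem cmp_chainD {V T U : ∀ ω, Formula (A ω)} {I : ∀ ω, Formula (A ω) → OD}
    {L : ∀ ω, List (Step (A ω))} [hV : Cmp b fun ω => (V ω).encode]
    [hT : Cmp b fun ω => (T ω).encode] [hU : Cmp b fun ω => (U ω).encode]
    [hL : Cmp b fun ω => encL Step.encode (L ω)] (hI : CmpI b I) :
    Cmp b fun ω => (chainD (V ω) (T ω) (U ω) (I ω) (L ω)).enc := by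
  have hB : Bd b fun ω => (b ω).size + (encL Step.encode (L ω)).size + 1 := inferInstance
  -- Taking the step itself as part of the input gives, by `Bd.sup`, one bound for the contributions
  -- of all steps of the list.
  have hst : Cmp (Ω := Σ ω, {s // s ∈ L ω}) (fun x => .pair (b x.1) x.2.1.encode)
      fun x => (stepD (V x.1) (T x.1) (U x.1) (I x.1) x.2.1).enc := by
    have h := Cmp.refl (Ω := Σ ω, {s // s ∈ L ω}) (A := fun x => A x.1)
      (b := fun x => .pair (b x.1) x.2.1.encode)
    have hV' := h.fst.trans (hV.pull _)
    have hT' := h.fst.trans (hT.pull _)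
    have hU' := h.fst.trans (hU.pull _)
    have hs := h.snd
    exact cmp_stepD (V := fun x => V x.1) (T := fun x => T x.1) (U := fun x => U x.1)
      (s := fun x : Σ ω, {s // s ∈ L ω} => x.2.1) (hI.lift (g := fun x : Σ ω, {s // s ∈ L ω} => x.1) h.fst)
  obtain ⟨K, hK, h⟩ := Bd.sup (b := b) (Bd.size (H := hst)) hB fun ω i => by
    have := size_le_encL Step.encode i.2
    simp only [Tree.size]; omega
  have hK' : Bd b fun ω => K ω + 20 := inferInstance
  refine Cmp.listAdd L (fun ω l => (chainD (V ω) (T ω) (U ω) (I ω) l).enc) _ (hK := hK') (h₀ := hL)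
    ?_ ?_ ?_
  · intro ω s k hs
    have := h ω ⟨s, hs⟩
    simp only [chainD, OD.enc, Tree.size_tagged, Tree.size]
    dsimp only at this
    omega
  · simp only [chainD]; infer_instance
  · intro b' lift h1 h2 h3
    have := lift _ hV
    have := lift _ hT
    have := lift _ hU
    have := cmp_stepD (V := fun x => V x.1) (T := fun x => T x.1) (U := fun x => U x.1)
        (s := fun x : Σ ω, Step (A ω) × List (Step (A ω)) => x.2.1) (hI.lift
        (g := fun x : Σ ω, Step (A ω) × List (Step (A ω)) => x.1) (lift _ Cmp.refl))
    simp only [chainD]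
    infer_instance

theorem cmp_layer {V T U α : ∀ ω, Formula (A ω)} {I : ∀ ω, Formula (A ω) → OD}
    {L : ∀ ω, List (Step (A ω))} [Cmp b fun ω => (V ω).encode]
    [Cmp b fun ω => (T ω).encode] [Cmp b fun ω => (U ω).encode] [Cmp b fun ω => (α ω).encode]
    [Cmp b fun ω => encL Step.encode (L ω)] (hI : CmpI b I) :
    Cmp b fun ω => (layer (V ω) (T ω) (U ω) (I ω) (α ω) (L ω)).enc := by
  have := cmp_chainD (V := V) (T := T) (U := U) (L := L) hI
  have := cmp_fin (V := V) (U := U) (F := α) hI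
  unfold layer; infer_instance

/-! ### Computability of the collection of atoms and of the conclusion -/

theorem size_ins_le {B : Type u} [Atoms B] (p V : Formula B) :
    V.encode.size ≤ (ins p V).encode.size ∧
      (ins p V).encode.size ≤ p.encode.size + V.encode.size + 9 := by
  induction V with
  | or α β ih ih' => simp only [ins, Formula.encode, Tree.size_tagged, Tree.size] at *; omega
  | _ => simp only [ins, Formula.encode, Tree.size_tagged, Tree.size] at *; omega

instance cmp_ins {p V : ∀ ω, Formula (A ω)} [hp : Cmp b fun ω => (p ω).encode]
    [Cmp b fun ω => (V ω).encode] : Cmp b fun ω => (ins (p ω) (V ω)).encode := by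
  have hB : Bd b fun ω => (p ω).encode.size + 20 := inferInstance
  refine Cmp.formulaAdd V (fun ω G => (ins (p ω) G).encode) _ (hK := hB) ?_ ?_ ?_ ?_ ?_ ?_ ?_
  iterate 2
    intro ω α β
    have h1 := size_ins_le (p ω) α
    have h2 := size_ins_le (p ω) β
    refine (size_ins_le _ _).2.trans ?_
    simp only [Formula.encode, Tree.size_tagged, Tree.size]
    omega
  iterate 2 simp only [ins]; infer_instance
  all_goals
    intro b' lift
    intros
    have := lift _ hp
    simp only [ins]
    infer_instance

theorem size_cutAtom_le {B : Type u} (s : Step B) :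
    (cutAtom s).encode.size ≤ s.encode.size := by
  have h : ∀ F : Formula B, F.L.encode.size ≤ F.encode.size := fun F => by
    cases F <;> simp only [Formula.L, Formula.encode, Tree.size_tagged, Tree.size] <;> omega
  have h1 := h s.upper
  have h2 := h s.lower
  unfold cutAtom
  simp only [Step.encode, Tree.size]
  split <;> omega

instance cmp_collect {L : ∀ ω, List (Step (A ω))} [hL : Cmp b fun ω => encL Step.encode (L ω)] :
    Cmp b fun ω => (collect (L ω)).encode := by
  have hB : Bd b fun ω => (encL Step.encode (L ω)).size + 9 := inferInstance
  refine Cmp.listAdd L (fun ω l => (collect l).encode) _ (hK := hB) (h₀ := hL) ?_ ?_ ?_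
  · intro ω s k hs
    have h1 := size_le_encL Step.encode hs
    have h2 := size_cutAtom_le s
    have h3 := (size_ins_le (cutAtom s) (collect k)).2
    simp only [collect]
    split <;> omega
  · simp only [collect]; infer_instance
  · intro b' lift h1 h2 h3
    simp only [collect]
    infer_instance

theorem cmp_length {X : Ω → Type w} {e : ∀ ω, X ω → Tree (A ω)} {l : ∀ ω, List (X ω)}
    [hl : Cmp b fun ω => encL (e ω) (l ω)] : Cmp b fun ω => Tree.num (l ω).length := by
  refine Cmp.listAdd l (fun ω l => Tree.num l.length) (fun _ => 2) (h₀ := hl) ?_ ?_ ?_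
  · intros; simp only [List.length_cons, Tree.size_num]; omega
  · simp only [List.length_nil]; infer_instance
  · intro b' lift h1 h2 h3
    simp only [List.length_cons]
    infer_instance

instance cmp_ctxFill {ξ : ∀ ω, Context (A ω)} {γ : ∀ ω, Formula (A ω)}
    [hξ : Cmp b fun ω => (ξ ω).encode] [hγ : Cmp b fun ω => (γ ω).encode] :
    Cmp b fun ω => ((ξ ω).fill (γ ω)).encode := by
  have hB : Bd b fun ω => (ξ ω).encode.size + 20 := inferInstance
  refine Cmp.contextAdd ξ (fun ω ζ => (ζ.fill (γ ω)).encode) _ (hK := hB) ?_ ?_ ?_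
  · intro ω ζ h
    cases ζ <;> simp only [Context.fill, Context.sub, Context.encode, Formula.encode,
      Tree.size_tagged, Tree.size] at * <;> omega
  · simp only [Context.fill]; infer_instance
  · intro b' lift h h'
    refine (Cmp.iteFormula (c := fun x => x.2.1.tag = 1) (d := fun _ => inferInstance)
      (X := fun x => .or (x.2.1.sub.fill (γ x.1)) x.2.1.side)
      (Y := fun x => if x.2.1.tag = 2 then .or x.2.1.side (x.2.1.sub.fill (γ x.1)) else
        if x.2.1.tag = 3 then .and (x.2.1.sub.fill (γ x.1)) x.2.1.side else
          .and x.2.1.side (x.2.1.sub.fill (γ x.1)))).congr ?_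
    rintro ⟨ω, ζ, hζ⟩
    cases ζ
    · exact absurd rfl hζ
    all_goals rfl

/-- The conclusion of a chain with premiss `t`. -/
noncomputable def concl {B : Type u} : List (Step B) → Formula B
  | [] => .tt
  | s :: L => if L.length = 0 then s.conclusion else concl L

/-- The conclusion is not listed in the encoded proof; it has to be rebuilt from the last step. -/
theorem concl_eq {B : Type u} [Atoms B] {S : Set Rule} {L : List (Step B)} {α : Formula B}
    (h : IsChain S .tt L α) : concl L = α := by
  suffices H : ∀ (s : Step B) (L : List (Step B)), IsChain S s.conclusion L α →
      concl (s :: L) = α by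
    cases L with
    | nil => exact h
    | cons s L => exact H s L h.2.2.2
  intro s L
  induction L generalizing s with
  | nil => intro h; exact h
  | cons r L ih =>
    intro h
    rw [concl, if_neg (by simp)]
    exact ih r h.2.2.2

instance cmp_concl {L : ∀ ω, List (Step (A ω))} [hL : Cmp b fun ω => encL Step.encode (L ω)] :
    Cmp b fun ω => (concl (L ω)).encode := by
  have hB : Bd b fun ω => 3 * (encL Step.encode (L ω)).size := inferInstance
  refine Cmp.listAdd L (fun ω l => (concl l).encode) _ (hK := hB) (h₀ := hL) ?_ ?_ ?_
  · intro ω s k hs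
    have h1 := size_le_encL Step.encode hs
    have h2 : s.conclusion.encode.size ≤ 3 * s.encode.size := by
      have : ∀ ζ : Context (A ω), (ζ.fill s.lower).encode.size ≤
          3 * ζ.encode.size + s.lower.encode.size := by
        intro ζ
        induction ζ <;> simp only [Context.fill, Context.encode, Formula.encode,
          Tree.size_tagged, Tree.size] at * <;> omega
      have := this s.context
      simp only [Step.conclusion, Step.encode, Tree.size]
      omega
    simp only [concl]
    split
    · omega
    · omega
  · simp only [concl]; infer_instance
  · intro b' lift h1 h2 h3
    have h4 := cmp_length (b := b') (e := fun _ => Step.encode)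
      (l := fun x : Σ ω, Step (A ω) × List (Step (A ω)) => x.2.2)
    have h5 : Cmp b' fun x => bt (x.2.2.length = 0) :=
      (Cmp.btEq (hX := h4) (hY := Cmp.num 0)).congr fun x => by
        rw [Tree.num_injective.eq_iff]
    simp only [concl, Step.conclusion]
    infer_instance

end
end DeepInference

namespace DeepInference

/-! ### Tables -/

/-- The table of the values of `g` below `n`, in descending order. -/
def tab {B : Type u} (g : ℕ → Tree B) : ℕ → Tree B
  | 0 => .nil
  | n + 1 => .pair (g n) (tab g n)

theorem size_tab {B : Type u} {g : ℕ → Tree B} {n K : ℕ} (h : ∀ k < n, (g k).size ≤ K) :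
    (tab g n).size ≤ n * (K + 1) + 1 := by
  induction n with
  | zero => simp [tab, Tree.size]
  | succ n ih =>
    have h1 := h n (by omega)
    have h2 := ih fun k hk => h k (by omega)
    simp only [tab, Tree.size]
    rw [add_mul, one_mul]
    omega

theorem size_le_tab {B : Type u} (g : ℕ → Tree B) {n k : ℕ} (h : k < n) :
    (g k).size ≤ (tab g n).size := by
  induction n with
  | zero => omega
  | succ n ih =>
    simp only [tab, Tree.size]
    rcases Nat.lt_succ_iff_lt_or_eq.1 h with h | rfl
    · have := ih h; omega
    · omega

section
variable {Ω : Type v} {A : Ω → Type u} [∀ ω, Atoms (A ω)] {b : ∀ ω, Tree (A ω)}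

instance cmp_numSub {m n : Ω → ℕ} [hm : Cmp b fun ω => Tree.num (m ω)]
    [hn : Cmp b fun ω => Tree.num (n ω)] : Cmp b fun ω => Tree.num (n ω - m ω) := by
  refine Cmp.natAdd m (fun ω k => Tree.num (n ω - k)) (fun _ => 0) ?_ ?_ ?_
  · intros; simp only [Tree.size_num]; omega
  · exact hn
  · intro b' lift h h'
    refine (h'.op .tail).congr fun x => ?_
    rw [← Nat.sub_sub]
    cases n x.1 - x.2.1 <;> simp [Tree.num, Op.eval]

instance cmp_btNumEq {m n : Ω → ℕ} [hm : Cmp b fun ω => Tree.num (m ω)]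
    [hn : Cmp b fun ω => Tree.num (n ω)] : Cmp b fun ω => bt (m ω = n ω) :=
  (Cmp.btEq (hX := hm) (hY := hn)).congr fun ω => by rw [Tree.num_injective.eq_iff]

theorem cmp_tab {n : Ω → ℕ} {g : ∀ ω, ℕ → Tree (A ω)} (M : Ω → ℕ) [hB : Bd b M]
    (hM : ∀ ω k, k < n ω → (g ω k).size ≤ M ω) [hn : Cmp b fun ω => Tree.num (n ω)]
    (hg : ∀ b' : (∀ x : (Σ ω : Ω, {k // k < n ω}), Tree (A x.1)),
      (∀ Y, Cmp b Y → Cmp b' fun x => Y x.1) → Cmp b' (fun x => Tree.num x.2.1) →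
      Cmp b' fun x => g x.1 x.2.1) : Cmp b fun ω => tab (g ω) (n ω) := by
  have hB : Bd b fun ω => M ω + 1 := inferInstance
  refine Cmp.natAdd n (fun ω k => tab (g ω) k) _ (hK := hB) ?_ ?_ ?_
  · intro ω k hk
    have := hM ω k hk
    simp only [tab, Tree.size]; omega
  · simp only [tab]; infer_instance
  · intro b' lift h h'
    have := hg b' lift h
    simp only [tab]
    infer_instance

/-- Tables are in descending order, so entry k is the head after n-(k+1) tails. -/
theorem cmp_tabGet {n k : Ω → ℕ} {g : ∀ ω, ℕ → Tree (A ω)} (hk : ∀ ω, k ω < n ω)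
    [hn : Cmp b fun ω => Tree.num (n ω)] [Cmp b fun ω => Tree.num (k ω)]
    (h : Cmp b fun ω => tab (g ω) (n ω)) : Cmp b fun ω => g ω (k ω) := by
  have h1 : Cmp b fun ω => tab (g ω) (n ω - (n ω - (k ω + 1))) := by
    refine Cmp.natAdd (fun ω => n ω - (k ω + 1)) (fun ω j => tab (g ω) (n ω - j)) (fun _ => 0)
      ?_ ?_ ?_
    · intro ω j _
      rw [← Nat.sub_sub]
      cases n ω - j <;> simp only [tab, Nat.zero_sub, Nat.add_sub_cancel, Tree.size] <;> omega
    · exact h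
    · intro b' lift h h'
      refine (h'.op .tail).congr fun x => ?_
      have : ∀ m, Op.tail.eval (tab (g x.1) m) = tab (g x.1) (m - 1) := fun m => by
        cases m <;> simp [tab, Op.eval]
      exact this _
  refine (h1.op .head).congr fun ω => ?_
  have e : n ω - (n ω - (k ω + 1)) = k ω + 1 := by have := hk ω; omega
  rw [e]
  rfl

/-- Recursion is on the first index alone: the second is k+1-i, since their sum is constant, and
both factors are looked up in tables. -/
theorem cmp_conv {L R : ∀ ω, ℕ → Formula (A ω)} {n k : Ω → ℕ} (hk : ∀ ω, k ω < n ω)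
    [hn : Cmp b fun ω => Tree.num (n ω)] [hk' : Cmp b fun ω => Tree.num (k ω)]
    (hL : Cmp b fun ω => tab (fun i => (L ω i).encode) (n ω))
    (hR : Cmp b fun ω => tab (fun i => (R ω i).encode) (n ω)) :
    Cmp b fun ω => (conv (L ω) (R ω) (k ω + 1) 0).encode := by
  have hB : Bd b fun ω => (tab (fun i => (L ω i).encode) (n ω)).size +
    (tab (fun i => (R ω i).encode) (n ω)).size + 40 := inferInstance
  refine (Cmp.natAdd (fun ω => k ω + 1) (fun ω i => (conv (L ω) (R ω) i (k ω + 1 - i)).encode)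
    _ (hK := hB) ?_ ?_ ?_).congr fun ω => by rw [Nat.sub_self]
  · intro ω i hi
    have h1 := size_le_tab (fun i => (L ω i).encode) (n := n ω) (k := i) (by have := hk ω; omega)
    have h2 := size_le_tab (fun i => (R ω i).encode) (n := n ω) (k := k ω - i)
      (by have := hk ω; omega)
    have e : k ω + 1 - (i + 1) = k ω - i := by omega
    have e' : k ω - i + 1 = k ω + 1 - i := by omega
    simp only [e, e', conv, Formula.encode, Tree.size_tagged, Tree.size]
    omega
  · simp only [conv]; infer_instance
  · intro b' lift h h'
    have hn' := lift _ hn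
    have hk'' := lift _ hk'
    have h1 := cmp_tabGet (k := fun x : Σ ω, {i // i < k ω + 1} => x.2.1)
      (fun x => by have := hk x.1; have := x.2.2; omega) (lift _ hL)
    have h2 := cmp_tabGet (k := fun x : Σ ω, {i // i < k ω + 1} => k x.1 - x.2.1)
      (fun x => by have := hk x.1; have := x.2.2; omega) (lift _ hR)
    refine Cmp.congr (X := fun x : Σ ω, {i // i < k ω + 1} => (Formula.or (.and (L x.1 x.2.1)
      (R x.1 (k x.1 - x.2.1))) (conv (L x.1) (R x.1) x.2.1 (k x.1 + 1 - x.2.1))).encode)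
      inferInstance fun x => ?_
    have := x.2.2
    have e : k x.1 + 1 - (x.2.1 + 1) = k x.1 - x.2.1 := by omega
    have e' : k x.1 - x.2.1 + 1 = k x.1 + 1 - x.2.1 := by omega
    simp only [e, e', conv]

theorem cmp_incL {d : Ω → ℕ → OD} {n k : Ω → ℕ} (hk : ∀ ω, k ω < n ω)
    [hn : Cmp b fun ω => Tree.num (n ω)] [hk' : Cmp b fun ω => Tree.num (k ω)]
    (hd : Cmp b fun ω => tab (fun i => (d ω i).enc) (n ω)) :
    Cmp b fun ω => (incL (d ω) (k ω + 1)).enc := by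
  have hB : Bd b fun ω => (tab (fun i => ((d ω i).enc : Tree (A ω))) (n ω)).size + 60 :=
    inferInstance
  refine Cmp.natAdd (fun ω => k ω + 1) (fun ω i => (incL (d ω) i).enc) _ (hK := hB) ?_ ?_ ?_
  · intro ω i hi
    have h1 := size_le_tab (fun i => ((d ω i).enc : Tree (A ω))) (n := n ω) (k := i)
      (by have := hk ω; omega)
    simp only [incL, OD.enc, Tree.size_tagged, Tree.size]
    omega
  · simp only [incL]; infer_instance
  · intro b' lift h h'
    have hn' := lift _ hn
    have h1 := cmp_tabGet (k := fun x : Σ ω, {i // i < k ω + 1} => x.2.1)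
      (fun x => by have := hk x.1; have := x.2.2; omega) (lift _ hd)
    simp only [incL]
    infer_instance

theorem cmp_incR {d : Ω → ℕ → OD} {n k : Ω → ℕ} (hk : ∀ ω, k ω < n ω)
    [hn : Cmp b fun ω => Tree.num (n ω)] [hk' : Cmp b fun ω => Tree.num (k ω)]
    (hd : Cmp b fun ω => tab (fun i => (d ω i).enc) (n ω)) :
    Cmp b fun ω => (incR (d ω) (k ω + 1) 0).enc := by
  have hB : Bd b fun ω => (tab (fun i => ((d ω i).enc : Tree (A ω))) (n ω)).size + 60 :=
    inferInstance
  refine (Cmp.natAdd (fun ω => k ω + 1) (fun ω i => (incR (d ω) i (k ω + 1 - i)).enc) _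
    (hK := hB) ?_ ?_ ?_).congr fun ω => by rw [Nat.sub_self]
  · intro ω i hi
    have h1 := size_le_tab (fun i => ((d ω i).enc : Tree (A ω))) (n := n ω) (k := k ω - i)
      (by have := hk ω; omega)
    have e : k ω + 1 - (i + 1) = k ω - i := by omega
    have e' : k ω - i + 1 = k ω + 1 - i := by omega
    simp only [e, e', incR, OD.enc, Tree.size_tagged, Tree.size]
    omega
  · simp only [incR]; infer_instance
  · intro b' lift h h'
    have hn' := lift _ hn
    have hk'' := lift _ hk'
    have h1 := cmp_tabGet (k := fun x : Σ ω, {i // i < k ω + 1} => k x.1 - x.2.1)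
      (fun x => by have := hk x.1; have := x.2.2; omega) (lift _ hd)
    refine Cmp.congr (X := fun x : Σ ω, {i // i < k ω + 1} => (OD.or (.and .id (d x.1 (k x.1 - x.2.1)))
      (incR (d x.1) x.2.1 (k x.1 + 1 - x.2.1))).enc) inferInstance fun x => ?_
    have := x.2.2
    have e : k x.1 + 1 - (x.2.1 + 1) = k x.1 - x.2.1 := by omega
    have e' : k x.1 - x.2.1 + 1 = k x.1 + 1 - x.2.1 := by omega
    simp only [e, e', incR]

theorem size_conv {B : Type u} {L R : ℕ → Formula B} {n K : ℕ}
    (hL : ∀ i < n, (L i).encode.size ≤ K) (hR : ∀ i < n, (R i).encode.size ≤ K) {i j : ℕ}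
    (h : i + j ≤ n) : (conv L R i j).encode.size ≤ i * (2 * K + 40) + 3 := by
  induction i generalizing j with
  | zero => simp [conv, Formula.encode, Tree.size_tagged, Tree.size]
  | succ i ih =>
    have h1 := hL i (by omega)
    have h2 := hR j (by omega)
    have h3 := ih (j := j + 1) (by omega)
    simp only [conv, Formula.encode, Tree.size_tagged, Tree.size]
    rw [add_mul, one_mul]
    omega

theorem size_incL {B : Type u} {d : ℕ → OD} {n K : ℕ}
    (hd : ∀ i < n, ((d i).enc : Tree B).size ≤ K) {i : ℕ} (h : i ≤ n) :
    ((incL d i).enc : Tree B).size ≤ i * (2 * K + 40) + 30 := by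
  induction i with
  | zero => simp [incL, OD.enc, Tree.size_tagged, Tree.size_num, Rul.code]
  | succ i ih =>
    have h1 := hd i (by omega)
    have h3 := ih (by omega)
    simp only [incL, OD.enc, Tree.size_tagged, Tree.size]
    rw [add_mul, one_mul]
    omega

theorem size_incR {B : Type u} {d : ℕ → OD} {n K : ℕ}
    (hd : ∀ i < n, ((d i).enc : Tree B).size ≤ K) {i j : ℕ} (h : i + j ≤ n) :
    ((incR d i j).enc : Tree B).size ≤ i * (2 * K + 40) + 30 := by
  induction i generalizing j with
  | zero => simp [incR, OD.enc, Tree.size_tagged, Tree.size]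
  | succ i ih =>
    have h1 := hd j (by omega)
    have h3 := ih (j := j + 1) (by omega)
    simp only [incR, OD.enc, Tree.size_tagged, Tree.size]
    rw [add_mul, one_mul]
    omega

theorem dep_le_max {B : Type u} (G : Formula B) : dep G.L ≤ dep G ∧ dep G.R ≤ dep G := by
  cases G <;> simp only [dep, Formula.L, Formula.R, le_refl, and_self] <;> omega

/-- Divide and conquer over a balanced disjunction, by tables. -/
theorem cmp_tableRec {V : ∀ ω, Formula (A ω)} {n : Ω → ℕ} (f : ∀ ω, Formula (A ω) → ℕ → Tree (A ω))
    (hV : ∀ ω, Bal (V ω)) (K : Ω → ℕ) [hK : Bd b K]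
    (hleaf : ∀ ω G k, (∀ α β, G ≠ .or α β) → G.encode.size ≤ (V ω).encode.size →
      (f ω G k).size ≤ K ω)
    (hnode : ∀ ω α β k N, k < n ω → (∀ i < n ω, (f ω α i).size ≤ N) →
      (∀ i < n ω, (f ω β i).size ≤ N) → (f ω (.or α β) k).size ≤ n ω * (2 * N + K ω) + K ω)
    [h₀ : Cmp b fun ω => (V ω).encode] [hn : Cmp b fun ω => Tree.num (n ω)]
    (hff : Cmp b fun ω => tab (f ω .ff) (n ω)) (htt : Cmp b fun ω => tab (f ω .tt) (n ω))
    (hatom : ∀ b' : (∀ x : (Σ ω, A ω), Tree (A x.1)), (∀ Y, Cmp b Y → Cmp b' fun x => Y x.1) →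
      Cmp b' (fun x => .atom x.2) → Cmp b' fun x => tab (f x.1 (.atom x.2)) (n x.1))
    (hor : ∀ b' : (∀ x : (Σ ω, Formula (A ω) × Formula (A ω)), Tree (A x.1)),
      (∀ Y, Cmp b Y → Cmp b' fun x => Y x.1) →
      Cmp b' (fun x => x.2.1.encode) → Cmp b' (fun x => x.2.2.encode) →
      Cmp b' (fun x => tab (f x.1 x.2.1) (n x.1)) → Cmp b' (fun x => tab (f x.1 x.2.2) (n x.1)) →
      Cmp b' fun x => tab (f x.1 (.or x.2.1 x.2.2)) (n x.1))
    (hand : ∀ b' : (∀ x : (Σ ω, Formula (A ω) × Formula (A ω)), Tree (A x.1)),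
      (∀ Y, Cmp b Y → Cmp b' fun x => Y x.1) →
      Cmp b' (fun x => x.2.1.encode) → Cmp b' (fun x => x.2.2.encode) →
      Cmp b' fun x => tab (f x.1 (.and x.2.1 x.2.2)) (n x.1)) :
    Cmp b fun ω => tab (f ω (V ω)) (n ω) := by
  have hn' := Bd.num hn
  have hm : Bd b fun ω => 3 * n ω + 1 + 2 * (V ω).encode.size := inferInstance
  have hp : Bd b fun ω => (3 * n ω + 1) ^ dep (V ω) := by
    -- The argument of `QB.pow_log` is chosen to dominate the base 3n+1 and also, by `Bal.dep_le`, 2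
    -- to the power of the depth.
    refine (Bd.comp QB.pow_log hm).mono fun ω => ?_
    have h1 : dep (V ω) ≤ Nat.log 2 (3 * n ω + 1 + 2 * (V ω).encode.size) := by
      have h2 := (hV ω).dep_le
      have h3 := (V ω).size_encode.1
      exact Nat.le_log_of_pow_le (by norm_num) (h2.trans (by omega))
    exact (Nat.pow_le_pow_right (by omega) (by omega)).trans (Nat.pow_le_pow_left (by omega) _)
  have hB : Bd b fun ω => n ω * ((3 * n ω + 1) ^ dep (V ω) * K ω + 1) + 1 + (V ω).encode.size :=
    inferInstance
  refine Cmp.formulaRecOn V (fun ω G => tab (f ω G) (n ω))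
    (fun ω G => dep G ≤ dep (V ω) ∧ G.encode.size ≤ (V ω).encode.size) (fun _ => ⟨le_rfl, le_rfl⟩)
    ?_ ?_ _ (hM := hB) (fun ω G h => by omega) (fun ω G h => ?_) h₀ hff htt hatom hor
    (fun b' lift h h' _ _ => hand b' lift h h')
  iterate 2
    intro ω G h
    refine ⟨?_, le_trans ?_ h.2⟩
    · have := dep_le_max G; omega
    · cases G <;> simp only [Formula.L, Formula.R, Formula.encode, Tree.size_tagged, Tree.size] <;>
        omega
  have key : ∀ G : Formula (A ω), G.encode.size ≤ (V ω).encode.size → ∀ k < n ω,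
      (f ω G k).size ≤ (3 * n ω + 1) ^ dep G * K ω := by
    have leaf : ∀ G : Formula (A ω), (∀ α β, G ≠ .or α β) → G.encode.size ≤ (V ω).encode.size →
        ∀ k < n ω, (f ω G k).size ≤ (3 * n ω + 1) ^ dep G * K ω := fun G hG h k _ =>
      (hleaf ω G k hG h).trans (Nat.le_mul_of_pos_left _ (by positivity))
    intro G
    induction G with
    | or α β ih ih' =>
      intro h k hk
      simp only [Formula.encode, Tree.size_tagged, Tree.size] at h
      set N := (3 * n ω + 1) ^ max (dep α) (dep β) * K ω with hN
      have hKN : K ω ≤ N := Nat.le_mul_of_pos_left _ (by positivity)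
      have h1 := hnode ω α β k N hk
        (fun i hi => (ih (by omega) i hi).trans (Nat.mul_le_mul_right _
          (Nat.pow_le_pow_right (by omega) (le_max_left _ _))))
        (fun i hi => (ih' (by omega) i hi).trans (Nat.mul_le_mul_right _
          (Nat.pow_le_pow_right (by omega) (le_max_right _ _))))
      have h2 : n ω * (2 * N + K ω) ≤ n ω * (3 * N) := Nat.mul_le_mul_left _ (by omega)
      -- One level costs n(2N+K)+K, and K ≤ N makes this at most (3n+1)N; hence the base 3n+1.
      have e : (3 * n ω + 1) ^ dep (α.or β) * K ω = n ω * (3 * N) + N := by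
        rw [dep, pow_succ, hN]; ring
      rw [e]
      omega
    | _ => exact leaf _ (by simp)
  have h1 : (3 * n ω + 1) ^ dep G * K ω ≤ (3 * n ω + 1) ^ dep (V ω) * K ω :=
    Nat.mul_le_mul_right _ (Nat.pow_le_pow_right (by omega) h.1)
  have := size_tab fun k hk => (key G h.2 k hk).trans h1
  omega

/-! ### Computability of the threshold formulae -/

theorem cmp_tabLeaf {F : ∀ ω, Formula (A ω)} {n : Ω → ℕ} [hF : Cmp b fun ω => (F ω).encode]
    [hn : Cmp b fun ω => Tree.num (n ω)] :
    Cmp b fun ω => tab (fun k => (if k = 0 then .tt else if k = 1 then F ω else .ff :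
      Formula (A ω)).encode) (n ω) := by
  have hB : Bd b fun ω => (F ω).encode.size + 40 := inferInstance
  refine cmp_tab _ (hB := hB) (fun ω k _ => ?_) (fun b' lift h => ?_)
  · split_ifs <;> (try simp only [Formula.encode, Tree.size_tagged, Tree.size]) <;> omega
  · have := lift _ hF
    have h0 : Cmp b' fun x => bt (x.2.1 = 0) := cmp_btNumEq (n := fun _ => 0) (hn := Cmp.num 0)
    have h1 : Cmp b' fun x => bt (x.2.1 = 1) := cmp_btNumEq (n := fun _ => 1) (hn := Cmp.num 1)
    infer_instance

/-- The thresholds of a disjunction need those of both parts for all indices up to k. A table of k+1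
entries per subformula provides them, and balance keeps the tables quasipolynomial. -/
theorem cmp_TH {V : ∀ ω, Formula (A ω)} {k : Ω → ℕ} (hV : ∀ ω, Bal (V ω))
    [h₀ : Cmp b fun ω => (V ω).encode] [hk : Cmp b fun ω => Tree.num (k ω)] :
    Cmp b fun ω => (TH (V ω) (k ω)).encode := by
  have hB : Bd b fun ω => (V ω).encode.size + 40 := inferInstance
  refine cmp_tabGet (n := fun ω => k ω + 1) (g := fun ω k => (TH (V ω) k).encode)
    (fun _ => Nat.lt_succ_self _)
    (cmp_tableRec (fun ω G k => (TH G k).encode) hV _ (hK := hB) ?_ ?_ ?_ ?_ ?_ ?_ ?_)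
  · intro ω G k hG hs
    cases G with
    | or α β => exact absurd rfl (hG α β)
    | _ =>
      simp only [TH]
      split_ifs <;> simp only [Formula.encode, Tree.size_tagged, Tree.size] at hs ⊢ <;> omega
  · intro ω α β i N hi h h'
    have h1 := size_conv h h' (i := i + 1) (j := 0) (by omega)
    have h2 : (i + 1) * (2 * N + 40) ≤ (k ω + 1) * (2 * N + ((V ω).encode.size + 40)) :=
      Nat.mul_le_mul (by omega) (by omega)
    simp only [TH]
    omega
  · simp only [TH]; exact cmp_tabLeaf (F := fun _ => .ff)
  · simp only [TH]; exact cmp_tabLeaf (F := fun _ => .tt)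
  · intro b' lift h
    have := lift _ hk
    simp only [TH]; exact cmp_tabLeaf (F := fun x : Σ ω, A ω => .atom x.2)
  · intro b' lift h1 h2 h3 h4
    have := lift _ hk
    have hB1 : Bd b' fun x => (k x.1 + 1) * (2 *
      ((tab (fun i => (TH x.2.1 i).encode) (k x.1 + 1)).size +
        (tab (fun i => (TH x.2.2 i).encode) (k x.1 + 1)).size) + 40) + 3 := by
      have := Bd.num this
      infer_instance
    simp only [TH]
    refine cmp_tab _ (n := fun x : Σ ω, Formula (A ω) × Formula (A ω) => k x.1 + 1)
      (hB := hB1) (fun x i hi => ?_) (fun b'' lift' h => ?_)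
    · refine (size_conv (n := k x.1 + 1) (fun j hj => ?_) (fun j hj => ?_) (by omega)).trans
        (Nat.add_le_add_right (Nat.mul_le_mul_right _ (by omega)) _)
      · exact (size_le_tab (fun i => (TH x.2.1 i).encode) hj).trans (Nat.le_add_right _ _)
      · exact (size_le_tab (fun i => (TH x.2.2 i).encode) hj).trans (Nat.le_add_left _ _)
    · have := lift' _ this
      exact cmp_conv (n := fun x : Σ x : (Σ ω, Formula (A ω) × Formula (A ω)), {i // i < k x.1 + 1} =>
        k x.1.1 + 1) (k := fun x => x.2.1) (fun x => x.2.2) (lift' _ h3) (lift' _ h4)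
  · intro b' lift h1 h2
    have := lift _ hk
    simp only [TH]
    exact cmp_tabLeaf (F := fun x : Σ ω, Formula (A ω) × Formula (A ω) => .and x.2.1 x.2.2)

theorem cmp_tabConst {n : Ω → ℕ} (D : OD) [hn : Cmp b fun ω => Tree.num (n ω)] :
    Cmp b fun ω => tab (fun _ => D.enc) (n ω) :=
  cmp_tab _ (hB := Bd.size (H := Cmp.odConst D)) (fun _ _ _ => le_rfl) fun _ _ _ => inferInstance

/-- The same table recursion as for the thresholds, since the terms have the same branching. -/
theorem cmp_INC {V p : ∀ ω, Formula (A ω)} {k : Ω → ℕ} (hV : ∀ ω, Bal (V ω))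
    [h₀ : Cmp b fun ω => (V ω).encode] [hp : Cmp b fun ω => (p ω).encode]
    [hk : Cmp b fun ω => Tree.num (k ω)] : Cmp b fun ω => (INC (p ω) (V ω) (k ω)).enc := by
  have hB : Bd b fun ω => 100 + (orW'.enc : Tree (A ω)).size := inferInstance
  refine cmp_tabGet (n := fun ω => k ω + 1) (g := fun ω k => (INC (p ω) (V ω) k).enc)
    (fun _ => Nat.lt_succ_self _)
    (cmp_tableRec (fun ω G k => (INC (p ω) G k).enc) hV _ (hK := hB) ?_ ?_ ?_ ?_ ?_ ?_ ?_)
  · intro ω G k hG hs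
    cases G with
    | or α β => exact absurd rfl (hG α β)
    | _ => simp only [INC, OD.enc, Tree.size_tagged, Tree.size]; omega
  · intro ω α β i N hi h h'
    have h1 := size_incL h (i := i + 1) (by omega)
    have h2 := size_incR h' (i := i + 1) (j := 0) (by omega)
    have h3 : (i + 1) * (2 * N + 40) ≤ (k ω + 1) * (2 * N + (100 + (orW'.enc : Tree (A ω)).size)) :=
      Nat.mul_le_mul (by omega) (by omega)
    simp only [INC]
    split
    · omega
    · simp only [OD.enc, Tree.size_tagged, Tree.size]
      omega
  · simp only [INC]; exact cmp_tabConst .id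
  · simp only [INC]; exact cmp_tabConst .id
  · intro b' lift h
    have := lift _ hk
    simp only [INC]; exact cmp_tabConst .id
  · intro b' lift h1 h2 h3 h4
    have hk' := lift _ hk
    have hp' := lift _ hp
    have hB1 : Bd b' fun x => (k x.1 + 1) * (2 *
      ((tab (fun i => ((INC (p x.1) x.2.1 i).enc : Tree (A x.1))) (k x.1 + 1)).size +
        (tab (fun i => ((INC (p x.1) x.2.2 i).enc : Tree (A x.1))) (k x.1 + 1)).size) + 40) +
          100 + (orW'.enc : Tree (A x.1)).size := by
      have := Bd.num hk'
      infer_instance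
    simp only [INC]
    refine cmp_tab _ (n := fun x : Σ ω, Formula (A ω) × Formula (A ω) => k x.1 + 1)
      (hB := hB1) (fun x i hi => ?_) (fun b'' lift' h => ?_)
    · have e1 := size_incL (d := INC (p x.1) x.2.1) (n := k x.1 + 1) (fun j hj => size_le_tab
        (fun i => ((INC (p x.1) x.2.1 i).enc : Tree (A x.1))) hj) (i := i + 1) (by omega)
      have e2 := size_incR (d := INC (p x.1) x.2.2) (n := k x.1 + 1) (fun j hj => size_le_tab
        (fun i => ((INC (p x.1) x.2.2 i).enc : Tree (A x.1))) hj) (i := i + 1) (j := 0) (by omega)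
      have e3 : ∀ N N', (i + 1) * (2 * N + 40) ≤ (k x.1 + 1) * (2 * (N + N') + 40) ∧
          (i + 1) * (2 * N' + 40) ≤ (k x.1 + 1) * (2 * (N + N') + 40) := fun N N' =>
        ⟨Nat.mul_le_mul (by omega) (by omega), Nat.mul_le_mul (by omega) (by omega)⟩
      have e3 := e3 (tab (fun i => ((INC (p x.1) x.2.1 i).enc : Tree (A x.1))) (k x.1 + 1)).size
        (tab (fun i => ((INC (p x.1) x.2.2 i).enc : Tree (A x.1))) (k x.1 + 1)).size
      split
      · omega
      · simp only [OD.enc, Tree.size_tagged, Tree.size]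
        omega
    · have := lift' _ hk'
      have := lift' _ hp'
      have := lift' _ h1
      have := cmp_incL (n := fun x : Σ x : (Σ ω, Formula (A ω) × Formula (A ω)),
        {i // i < k x.1 + 1} => k x.1.1 + 1) (k := fun x => x.2.1) (fun x => x.2.2) (lift' _ h3)
      have := cmp_incR (n := fun x : Σ x : (Σ ω, Formula (A ω) × Formula (A ω)),
        {i // i < k x.1 + 1} => k x.1.1 + 1) (k := fun x => x.2.1) (fun x => x.2.2) (lift' _ h4)
      infer_instance
  · intro b' lift h1 h2
    have := lift _ hk
    simp only [INC]
    exact cmp_tabConst .id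

theorem cmp_layerAt {V α : ∀ ω, Formula (A ω)} {L : ∀ ω, List (Step (A ω))} {k : Ω → ℕ}
    (hV : ∀ ω, Bal (V ω)) [h₀ : Cmp b fun ω => (V ω).encode] [Cmp b fun ω => (α ω).encode]
    [Cmp b fun ω => encL Step.encode (L ω)] [hk : Cmp b fun ω => Tree.num (k ω)] :
    Cmp b fun ω => (layer (V ω) (TH (V ω) (k ω)) (TH (V ω) (k ω + 1))
      (fun p => INC p (V ω) (k ω)) (α ω) (L ω)).enc := by
  have := cmp_TH (b := b) (k := k) hV
  have := cmp_TH (b := b) (k := fun ω => k ω + 1) hV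
  refine cmp_layer (V := V) (T := fun ω => TH (V ω) (k ω)) (U := fun ω => TH (V ω) (k ω + 1))
    (α := α) (L := L) (I := fun ω p => INC p (V ω) (k ω)) ?_
  have h := Cmp.refl (Ω := Σ ω, Formula (A ω)) (A := fun x => A x.1)
    (b := fun x => .pair (b x.1) x.2.encode)
  have := h.fst.trans (h₀.pull _)
  have := h.fst.trans (hk.pull _)
  have := h.snd
  exact cmp_INC (V := fun x : Σ ω, Formula (A ω) => V x.1) (p := fun x => x.2)
    (k := fun x => k x.1) fun x => hV x.1

theorem cmp_layers {V α : ∀ ω, Formula (A ω)} {L : ∀ ω, List (Step (A ω))} {n : Ω → ℕ}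
    (hV : ∀ ω, Bal (V ω)) [h₀ : Cmp b fun ω => (V ω).encode] [hα : Cmp b fun ω => (α ω).encode]
    [hL : Cmp b fun ω => encL Step.encode (L ω)] [hn : Cmp b fun ω => Tree.num (n ω)] :
    Cmp b fun ω => (layers (V ω) (α ω) (L ω) (n ω)).enc := by
  have hB : Bd b fun ω => (b ω).size + (Tree.num (n ω) : Tree (A ω)).size + 1 := inferInstance
  -- All layers are treated with their number as an input, so that `Bd.sup` bounds them uniformly
  -- and the stack grows additively.
  have hst : Cmp (Ω := Σ ω, {k // k < n ω}) (fun x => .pair (b x.1) (.num x.2.1))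
      fun x => (layer (V x.1) (TH (V x.1) x.2.1) (TH (V x.1) (x.2.1 + 1))
        (fun p => INC p (V x.1) x.2.1) (α x.1) (L x.1)).enc := by
    have h := Cmp.refl (Ω := Σ ω, {k // k < n ω}) (A := fun x => A x.1)
      (b := fun x => .pair (b x.1) (.num x.2.1))
    have := h.fst.trans (h₀.pull _)
    have := h.fst.trans (hα.pull _)
    have := h.fst.trans (hL.pull _)
    have := h.snd
    exact cmp_layerAt (V := fun x : Σ ω, {k // k < n ω} => V x.1) (α := fun x => α x.1)
      (L := fun x => L x.1) (k := fun x => x.2.1) fun x => hV x.1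
  obtain ⟨K, hK, h⟩ := Bd.sup (b := b) (Bd.size (H := hst)) hB fun ω i => by
    have := i.2
    simp only [Tree.size, Tree.size_num]; omega
  have hK' : Bd b fun ω => K ω + 100 + ((ct (α ω)).enc : Tree (A ω)).size := inferInstance
  refine Cmp.natAdd n (fun ω k => (layers (V ω) (α ω) (L ω) k).enc) _ (hK := hK') ?_ ?_ ?_
  · intro ω k hk
    have := h ω ⟨k, hk⟩
    simp only [layers, OD.enc, Tree.size_tagged, Tree.size, Tree.size_num, Rul.code, Lin.code]
    dsimp only at this
    omega
  · simp only [layers]; infer_instance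
  · intro b' lift h1 h2
    have := lift _ h₀
    have := lift _ hα
    have := lift _ hL
    have := cmp_layerAt (b := b') (V := fun x : Σ ω, {k // k < n ω} => V x.1) (α := fun x => α x.1)
      (L := fun x => L x.1) (k := fun x => x.2.1) fun x => hV x.1
    simp only [layers]
    infer_instance

theorem cmp_whole {V α : ∀ ω, Formula (A ω)} {L : ∀ ω, List (Step (A ω))} {n : Ω → ℕ}
    (hV : ∀ ω, Bal (V ω)) [h₀ : Cmp b fun ω => (V ω).encode] [hα : Cmp b fun ω => (α ω).encode]
    [hL : Cmp b fun ω => encL Step.encode (L ω)] [hn : Cmp b fun ω => Tree.num (n ω)] :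
    Cmp b fun ω => (whole (V ω) (α ω) (L ω) (n ω)).enc := by
  have := cmp_layers (b := b) (α := α) (L := L) (n := n) hV
  have := cmp_TH (b := b) (k := n) hV
  unfold whole
  infer_instance

end
end DeepInference

namespace DeepInference

/-! ### Computability of the derivation that a term describes -/

/-- The number of the outermost constructor. -/
def OD.tag : OD → ℕ
  | .id => 0
  | .rule _ => 1
  | .or _ _ => 2
  | .and _ _ => 3
  | .comp _ _ => 4

/-- The left immediate subterm, if there is one. -/
def OD.left : OD → OD
  | .or D _ => D
  | .and D _ => D
  | .comp D _ => D
  | D => D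

/-- The right immediate subterm, if there is one. -/
def OD.right : OD → OD
  | .or _ E => E
  | .and _ E => E
  | .comp _ E => E
  | D => D

/-- The rule of a term that consists of a single rule. -/
def OD.rul : OD → Rul
  | .rule ρ => ρ
  | _ => .W

/-- A formula and a list of steps as a tree. -/
def encR {B : Type u} (r : Formula B × List (Step B)) : Tree B :=
  .pair r.1.encode (encL Step.encode r.2)

section
variable {Ω : Type v} {A : Ω → Type u} [∀ ω, Atoms (A ω)] {b : ∀ ω, Tree (A ω)}

instance Cmp.btConst (p : Prop) : Cmp b fun _ => bt p := by
  by_cases h : p <;> simp only [h] <;> infer_instance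

section
variable {D : Ω → OD} [h : Cmp b fun ω => (D ω).enc]

instance cmp_btODTag {n : ℕ} : Cmp b fun ω => bt ((D ω).tag = n) :=
  (Cmp.btEq (hX := h.op .head) (hY := Cmp.num n)).congr fun ω => by
    cases D ω <;> simp [OD.enc, Tree.tagged, Op.eval, OD.tag, Tree.num_injective.eq_iff]

instance cmp_odLeft : Cmp b fun ω => (D ω).left.enc :=
  (Cmp.ite (d := fun _ => inferInstance) (c := fun ω => (D ω).tag = 0 ∨ (D ω).tag = 1)
    inferInstance h ((h.op .tail).op .head)).congr fun ω => by
    cases h : D ω <;> simp [OD.enc, Tree.tagged, Op.eval, OD.tag, OD.left]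

instance cmp_odRight : Cmp b fun ω => (D ω).right.enc :=
  (Cmp.ite (d := fun _ => inferInstance) (c := fun ω => (D ω).tag = 0 ∨ (D ω).tag = 1)
    inferInstance h ((h.op .tail).op .tail)).congr fun ω => by
    cases h : D ω <;> simp [OD.enc, Tree.tagged, Op.eval, OD.tag, OD.right]

instance cmp_btRulEq (σ : Rul) : Cmp b fun ω => bt ((D ω).rul = σ) := by
  have h1 : Cmp b fun ω => bt (Op.tail.eval (D ω).enc = Tree.num σ.code) :=
    Cmp.btEq (hX := h.op .tail) (hY := Cmp.num _)
  refine (Cmp.ite (d := fun _ => inferInstance) (c := fun ω => (D ω).tag = 1) inferInstance h1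
    (Cmp.btConst (.W = σ))).congr fun ω => ?_
  cases h : D ω <;> simp [OD.enc, Tree.tagged, Op.eval, OD.tag, OD.rul,
    Tree.num_injective.eq_iff, Rul.code_injective.eq_iff]

end

instance cmp_encR {F : ∀ ω, Formula (A ω)} {l : ∀ ω, List (Step (A ω))}
    [Cmp b fun ω => (F ω).encode] [Cmp b fun ω => encL Step.encode (l ω)] :
    Cmp b fun ω => encR (F ω, l ω) := by
  simp only [encR]; infer_instance

instance cmp_iteR {X Y : ∀ ω, Formula (A ω) × List (Step (A ω))} {c : Ω → Prop}
    {d : ∀ ω, Decidable (c ω)} [hc : Cmp b fun ω => bt (c ω)] [hX : Cmp b fun ω => encR (X ω)]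
    [hY : Cmp b fun ω => encR (Y ω)] : Cmp b fun ω => encR (if c ω then X ω else Y ω) :=
  (Cmp.ite (d := d) hc hX hY).congr fun ω => by split <;> rfl

instance cmp_resFst {r : ∀ ω, Formula (A ω) × List (Step (A ω))} [h : Cmp b fun ω => encR (r ω)] :
    Cmp b fun ω => (r ω).1.encode := h.op .head

instance cmp_resSnd {r : ∀ ω, Formula (A ω) × List (Step (A ω))} [h : Cmp b fun ω => encR (r ω)] :
    Cmp b fun ω => encL Step.encode (r ω).2 := h.op .tail

instance cmp_append {l m : ∀ ω, List (Step (A ω))} [hl : Cmp b fun ω => encL Step.encode (l ω)]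
    [hm : Cmp b fun ω => encL Step.encode (m ω)] :
    Cmp b fun ω => encL Step.encode (l ω ++ m ω) := by
  have hB : Bd b fun ω => (encL Step.encode (l ω)).size + 1 := inferInstance
  refine Cmp.listAdd l (fun ω k => encL Step.encode (k ++ m ω)) _ (hK := hB) (h₀ := hl) ?_ ?_ ?_
  · intro ω x k hx
    have := size_le_encL Step.encode hx
    simp only [List.cons_append, encL, Tree.size]
    omega
  · exact hm
  · intro b' lift h1 h2 h3
    simp only [List.cons_append]
    infer_instance

theorem cmp_mapSteps {l : ∀ ω, List (Step (A ω))} (φ : ∀ ω, Step (A ω) → Step (A ω)) (K : Ω → ℕ)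
    [hK : Bd b K] (hφ : ∀ ω s, (φ ω s).encode.size ≤ s.encode.size + K ω)
    (hφ' : ∀ b' : (∀ x : (Σ ω, Step (A ω) × List (Step (A ω))), Tree (A x.1)),
      (∀ Y, Cmp b Y → Cmp b' fun x => Y x.1) → Cmp b' (fun x => x.2.1.encode) →
      Cmp b' fun x => (φ x.1 x.2.1).encode) [hl : Cmp b fun ω => encL Step.encode (l ω)] :
    Cmp b fun ω => encL Step.encode ((l ω).map (φ ω)) := by
  have hB : Bd b fun ω => (encL Step.encode (l ω)).size + K ω + 1 := inferInstance
  refine Cmp.listAdd l (fun ω k => encL Step.encode (k.map (φ ω))) _ (hK := hB) (h₀ := hl) ?_ ?_ ?_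
  · intro ω x k hx
    have := size_le_encL Step.encode hx
    have := hφ ω x
    simp only [List.map_cons, encL, Tree.size]
    omega
  · simp only [List.map_nil]; infer_instance
  · intro b' lift h1 h2 h3
    have := hφ' b' lift h1
    simp only [List.map_cons]
    infer_instance

theorem size_stepIn {B : Type u} (γ : Formula B) (s : Step B) :
    (s.orL γ).encode.size ≤ s.encode.size + (γ.encode.size + 11) ∧
    (s.orR γ).encode.size ≤ s.encode.size + (γ.encode.size + 11) ∧
    (s.andL γ).encode.size ≤ s.encode.size + (γ.encode.size + 11) ∧
    (s.andR γ).encode.size ≤ s.encode.size + (γ.encode.size + 11) := by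
  simp only [Step.orL, Step.orR, Step.andL, Step.andR, Step.encode, Context.encode,
    Tree.size_tagged, Tree.size]
  omega

section
variable {l : ∀ ω, List (Step (A ω))} {γ : ∀ ω, Formula (A ω)}
  [hl : Cmp b fun ω => encL Step.encode (l ω)] [hγ : Cmp b fun ω => (γ ω).encode]

instance cmp_mapOrL : Cmp b fun ω => encL Step.encode ((l ω).map (Step.orL (γ ω))) := by
  have hB : Bd b fun ω => (γ ω).encode.size + 11 := inferInstance
  refine cmp_mapSteps (fun ω => Step.orL (γ ω)) _ (hK := hB) (fun ω s => (size_stepIn _ _).1) ?_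
  intro b' lift h
  have := lift _ hγ
  simp only [Step.orL]; infer_instance

instance cmp_mapOrR : Cmp b fun ω => encL Step.encode ((l ω).map (Step.orR (γ ω))) := by
  have hB : Bd b fun ω => (γ ω).encode.size + 11 := inferInstance
  refine cmp_mapSteps (fun ω => Step.orR (γ ω)) _ (hK := hB) (fun ω s => (size_stepIn _ _).2.1) ?_
  intro b' lift h
  have := lift _ hγ
  simp only [Step.orR]; infer_instance

instance cmp_mapAndL : Cmp b fun ω => encL Step.encode ((l ω).map (Step.andL (γ ω))) := by
  have hB : Bd b fun ω => (γ ω).encode.size + 11 := inferInstance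
  refine cmp_mapSteps (fun ω => Step.andL (γ ω)) _ (hK := hB)
    (fun ω s => (size_stepIn _ _).2.2.1) ?_
  intro b' lift h
  have := lift _ hγ
  simp only [Step.andL]; infer_instance

instance cmp_mapAndR : Cmp b fun ω => encL Step.encode ((l ω).map (Step.andR (γ ω))) := by
  have hB : Bd b fun ω => (γ ω).encode.size + 11 := inferInstance
  refine cmp_mapSteps (fun ω => Step.andR (γ ω)) _ (hK := hB)
    (fun ω s => (size_stepIn _ _).2.2.2) ?_
  intro b' lift h
  have := lift _ hγ
  simp only [Step.andR]; infer_instance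

end
end

theorem Formula.size_LR {B : Type u} (F : Formula B) : F.L.size + F.R.size ≤ F.size + 1 ∧
    F.L.size ≤ F.size ∧ F.R.size ≤ F.size := by
  have := F.L.size_pos
  have := F.R.size_pos
  cases F <;> simp only [L, R, size] at * <;> omega

section
variable {B : Type u} {h : Rul → Formula B → Formula B × List (Step B)}

/-- Each node of a term raises the size of the formula by at most 3 on the way up, so premisses stay
linear. No correctness of the term is assumed. -/
theorem size_run (hp : ∀ ρ F, (h ρ F).1.size ≤ F.size + 3) (D : OD) (F : Formula B) :
    (run h D F).1.size ≤ F.size + 3 * D.len := by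
  induction D generalizing F with
  | id => simp only [run]; omega
  | rule ρ => exact hp ρ F
  | or D E ih ih' =>
    have h1 := ih F.L
    have h2 := ih' F.R
    have := F.size_LR
    simp only [run, Formula.size, OD.len]
    omega
  | and D E ih ih' =>
    have h1 := ih F.L
    have h2 := ih' F.R
    have := F.size_LR
    simp only [run, Formula.size, OD.len]
    omega
  | comp D E ih ih' =>
    have h1 := ih (run h E F).1
    have h2 := ih' F
    simp only [run, OD.len]
    omega

/-- Every rule meets a formula of size at most `m`, which bounds its own steps by `Q`; the contexts
around them consist of side formulae that together are no larger than a formula of the derivation.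
-/
theorem run_steps (hp : ∀ ρ F, (h ρ F).1.size ≤ F.size + 3) {m Q : ℕ}
    (hQ : ∀ ρ F, F.size ≤ m → (h ρ F).2.length ≤ Q ∧ ∀ s ∈ (h ρ F).2, s.encode.size ≤ Q)
    (D : OD) (F : Formula B) (hm : F.size + 3 * D.len ≤ m) :
    (run h D F).2.length ≤ D.len * Q ∧
      ∀ s ∈ (run h D F).2, s.encode.size ≤ Q + 30 * (F.size + 3 * D.len) := by
  induction D generalizing F with
  | id => simp [run]
  | rule ρ =>
    have h1 := hQ ρ F (by omega)
    exact ⟨by simpa [run, OD.len] using h1.1, fun s hs => (h1.2 s hs).trans (by omega)⟩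
  | or D E ih ih' =>
    have h0 := F.size_LR
    simp only [OD.len] at hm
    have h1 := ih F.L (by omega)
    have h2 := ih' F.R (by omega)
    have h3 := size_run hp E F.R
    have h4 := (run h E F.R).1.size_encode.2
    have h5 := F.L.size_encode.2
    simp only [run, OD.len, List.length_append, List.length_map, List.mem_append, List.mem_map]
    constructor
    · have e : (D.len + E.len + 1) * Q = D.len * Q + E.len * Q + Q := by ring
      omega
    · rintro s (⟨s, hs, rfl⟩ | ⟨s, hs, rfl⟩)
      · have := h1.2 s hs
        have := (size_stepIn (run h E F.R).1 s).1
        omega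
      · have := h2.2 s hs
        have := (size_stepIn F.L s).2.1
        omega
  | and D E ih ih' =>
    have h0 := F.size_LR
    simp only [OD.len] at hm
    have h1 := ih F.L (by omega)
    have h2 := ih' F.R (by omega)
    have h3 := size_run hp E F.R
    have h4 := (run h E F.R).1.size_encode.2
    have h5 := F.L.size_encode.2
    simp only [run, OD.len, List.length_append, List.length_map, List.mem_append, List.mem_map]
    constructor
    · have e : (D.len + E.len + 1) * Q = D.len * Q + E.len * Q + Q := by ring
      omega
    · rintro s (⟨s, hs, rfl⟩ | ⟨s, hs, rfl⟩)
      · have := h1.2 s hs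
        have := (size_stepIn (run h E F.R).1 s).2.2.1
        omega
      · have := h2.2 s hs
        have := (size_stepIn F.L s).2.2.2
        omega
  | comp D E ih ih' =>
    simp only [OD.len] at hm
    have h3 := size_run hp E F
    have h1 := ih (run h E F).1 (by omega)
    have h2 := ih' F (by omega)
    simp only [run, OD.len, List.length_append, List.mem_append]
    constructor
    · have e : (D.len + E.len + 1) * Q = D.len * Q + E.len * Q + Q := by ring
      omega
    · rintro s (hs | hs)
      · have := h1.2 s hs
        omega
      · have := h2.2 s hs
        omega

end

section
variable {Ω : Type v} {A : Ω → Type u} [∀ ω, Atoms (A ω)] {b : ∀ ω, Tree (A ω)}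

/-- Only computability of each single rule and slow growth of its premiss are required. The handler
may therefore itself be built with `run`, as `hFull` is. -/
theorem cmp_run {h : ∀ ω, Rul → Formula (A ω) → Formula (A ω) × List (Step (A ω))}
    (hp : ∀ ω ρ F, (h ω ρ F).1.size ≤ F.size + 3)
    (hh : ∀ ρ, Cmp (Ω := Σ ω, Formula (A ω)) (fun x => x.2.encode) fun x => encR (h x.1 ρ x.2))
    {D : Ω → OD} {F : ∀ ω, Formula (A ω)} [hD : Cmp b fun ω => (D ω).enc]
    [hF : Cmp b fun ω => (F ω).encode] : Cmp b fun ω => encR (run (h ω) (D ω) (F ω)) := by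
  -- The leaves of the recursion: identity terms and single rules, the latter treated by cases over
  -- the finite list of rules.
  have H : Cmp (Ω := Σ ω, {i : OD × Formula (A ω) // i.1.tag = 0 ∨ i.1.tag = 1})
      (fun x => .pair x.2.1.1.enc x.2.1.2.encode) fun x => encR (run (h x.1) x.2.1.1 x.2.1.2) := by
    have h0 := Cmp.refl (Ω := Σ ω, {i : OD × Formula (A ω) // i.1.tag = 0 ∨ i.1.tag = 1})
      (A := fun x => A x.1) (b := fun x => .pair x.2.1.1.enc x.2.1.2.encode)
    have h1 := h0.fst
    have h2 := h0.snd
    have h3 := Cmp.enum rules (ρ := fun x : (Σ ω, {i : OD × Formula (A ω) //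
        i.1.tag = 0 ∨ i.1.tag = 1}) => x.2.1.1.rul)
      (b := fun x : (Σ ω, {i : OD × Formula (A ω) // i.1.tag = 0 ∨ i.1.tag = 1}) =>
        .pair x.2.1.1.enc x.2.1.2.encode)
      (X := fun x σ => encR (h x.1 σ x.2.1.2)) (fun _ => mem_rules _) (fun σ => inferInstance)
      (fun σ => h2.trans ((hh σ).pull fun x : (Σ ω, {i : OD × Formula (A ω) //
        i.1.tag = 0 ∨ i.1.tag = 1}) => ⟨x.1, x.2.1.2⟩))
    refine (cmp_iteR (c := fun x => x.2.1.1.tag = 0) (d := fun _ => inferInstance)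
      (X := fun x => (x.2.1.2, [])) (hY := h3)).congr ?_
    rintro ⟨ω, ⟨D, F⟩, hD⟩
    cases D <;> simp [OD.tag] at hD
    · rfl
    · rfl
  obtain ⟨q, hq, hqH⟩ := (Bd.size (H := H)).out
  have hm : Bd b fun ω => (F ω).size + 3 * (D ω).len := by
    have h1 : Bd b fun ω => (F ω).size :=
      (Bd.size (H := hF)).mono fun ω => (F ω).size_encode.1
    have h2 : Bd b fun ω => (D ω).len := (Bd.size (H := hD)).mono fun ω => (D ω).len_le
    infer_instance
  set m : Ω → ℕ := fun ω => (F ω).size + 3 * (D ω).len with hmdef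
  -- The argument of q is the size of the encoded pair of a single rule and a formula of size at
  -- most m: 60 and 18m for the components, 1 for the pair.
  set Q : Ω → ℕ := fun ω => q (61 + 18 * m ω) with hQdef
  have hQ : Bd b Q := by
    have : Bd b fun ω => 61 + 18 * m ω := inferInstance
    exact Bd.comp hq this
  have hQ' : ∀ ω ρ G, G.size ≤ m ω → (h ω ρ G).2.length ≤ Q ω ∧
      ∀ s ∈ (h ω ρ G).2, s.encode.size ≤ Q ω := by
    intro ω ρ G hG
    have h1 := hqH ⟨ω, (.rule ρ, G), Or.inr rfl⟩
    have h2 : (encR (h ω ρ G)).size ≤ Q ω := by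
      refine h1.trans (hq.mono ?_)
      have h3 := OD.enc_size_le (B := A ω) (.rule ρ)
      have h4 := G.size_encode.2
      simp only [OD.len] at h3
      simp only [Tree.size]
      omega
    have h3 := length_le_encL Step.encode (h ω ρ G).2
    simp only [encR, Tree.size] at h2
    refine ⟨by omega, fun s hs => ?_⟩
    have := size_le_encL Step.encode hs
    omega
  have hB : Bd b fun ω => 60 * m ω + 18 * m ω + (m ω * Q ω) * (Q ω + 30 * m ω + 1) + 2 :=
    inferInstance
  refine Cmp.rec2 (b := b)
    (I := fun ω => {i : OD × Formula (A ω) // i.2.size + 3 * i.1.len ≤ m ω})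
    (fun ω i => .pair i.1.1.enc i.1.2.encode) (fun ω i => encR (run (h ω) i.1.1 i.1.2))
    (fun ω i => ¬ (i.1.1.tag = 0 ∨ i.1.1.tag = 1))
    -- In a vertical composition the upper term starts from the premiss found by the lower one. This
    -- is why the first recursive call of `Cmp.rec2` may use the result of the second.
    (fun ω i => ⟨(i.1.1.left, if i.1.1.tag = 4 then (run (h ω) i.1.1.right i.1.2).1 else i.1.2.L),
      ?_⟩)
    (fun ω i => ⟨(i.1.1.right, if i.1.1.tag = 4 then i.1.2 else i.1.2.R), ?_⟩)
    (fun ω i => i.1.1.len) ?_ ?_ ?_ ?_ ?_ ?_ _ (hM := hB) ?_ ?_ ?_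
    (fun ω => ⟨(D ω, F ω), le_rfl⟩) inferInstance
  · obtain ⟨⟨D, F⟩, hi⟩ := i
    have h1 := F.size_LR
    have h2 := fun E => size_run (hp ω) E F
    dsimp only at hi ⊢
    cases D with
    | comp D E => have := h2 E; simp only [OD.tag, OD.left, OD.right, OD.len, if_true] at hi ⊢; omega
    | _ => simp [OD.tag, OD.left, OD.len] at hi ⊢ <;> omega
  · obtain ⟨⟨D, F⟩, hi⟩ := i
    have h1 := F.size_LR
    dsimp only at hi ⊢
    cases D <;> simp [OD.tag, OD.right, OD.len] at hi ⊢ <;> omega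
  · have h0 := (Cmp.refl (Ω := Σ ω, {i : OD × Formula (A ω) // i.2.size + 3 * i.1.len ≤ m ω})
      (A := fun x => A x.1) (b := fun x => .pair x.2.1.1.enc x.2.1.2.encode)).fst
    infer_instance
  · exact H.pull fun x : (Σ ω, {i : {i : OD × Formula (A ω) // i.2.size + 3 * i.1.len ≤ m ω} //
      ¬ ¬ (i.1.1.tag = 0 ∨ i.1.1.tag = 1)}) => ⟨x.1, x.2.1.1, not_not.1 x.2.2⟩
  · have h0 := Cmp.refl (Ω := Σ ω, {i : {i : OD × Formula (A ω) // i.2.size + 3 * i.1.len ≤ m ω} //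
      ¬ (i.1.1.tag = 0 ∨ i.1.1.tag = 1)})
      (A := fun x => A x.1) (b := fun x => .pair x.2.1.1.1.enc x.2.1.1.2.encode)
    have h1 := h0.fst
    have h2 := h0.snd
    infer_instance
  · have h0 := Cmp.refl (Ω := Σ ω, {i : {i : OD × Formula (A ω) // i.2.size + 3 * i.1.len ≤ m ω} //
      ¬ (i.1.1.tag = 0 ∨ i.1.1.tag = 1)})
      (A := fun x => A x.1) (b := fun x => .pair (.pair x.2.1.1.1.enc x.2.1.1.2.encode)
        (encR (run (h x.1) x.2.1.1.1.right (if x.2.1.1.1.tag = 4 then x.2.1.1.2 else x.2.1.1.2.R))))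
    have h1 := h0.fst.fst
    have h2 := h0.fst.snd
    have h3 := h0.snd
    have h4 : Cmp _ fun x : (Σ ω, {i : {i : OD × Formula (A ω) // i.2.size + 3 * i.1.len ≤ m ω} //
      ¬ (i.1.1.tag = 0 ∨ i.1.1.tag = 1)}) => (if x.2.1.1.1.tag = 4 then (run (h x.1) x.2.1.1.1.right
        (if x.2.1.1.1.tag = 4 then x.2.1.1.2 else x.2.1.1.2.R)).1 else x.2.1.1.2.L).encode :=
      Cmp.iteFormula (hX := cmp_resFst (h := h3))
    have h5 := h4.congr (Y := fun x : (Σ ω, {i : {i : OD × Formula (A ω) //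
      i.2.size + 3 * i.1.len ≤ m ω} // ¬ (i.1.1.tag = 0 ∨ i.1.1.tag = 1)}) => (if x.2.1.1.1.tag = 4 then
      (run (h x.1) x.2.1.1.1.right x.2.1.1.2).1 else x.2.1.1.2.L).encode)
      fun x => by split <;> rfl
    infer_instance
  · let Ω' := Σ ω, {i : {i : OD × Formula (A ω) // i.2.size + 3 * i.1.len ≤ m ω} //
      ¬ (i.1.1.tag = 0 ∨ i.1.1.tag = 1)}
    let r₂ : ∀ x : Ω', Formula (A x.1) × List (Step (A x.1)) := fun x =>
      run (h x.1) x.2.1.1.1.right (if x.2.1.1.1.tag = 4 then x.2.1.1.2 else x.2.1.1.2.R)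
    let r₁ : ∀ x : Ω', Formula (A x.1) × List (Step (A x.1)) := fun x =>
      run (h x.1) x.2.1.1.1.left (if x.2.1.1.1.tag = 4 then
        (run (h x.1) x.2.1.1.1.right x.2.1.1.2).1 else x.2.1.1.2.L)
    have h0 := Cmp.refl (Ω := Ω') (A := fun x => A x.1) (b := fun x =>
      .pair (.pair (.pair x.2.1.1.1.enc x.2.1.1.2.encode) (encR (r₂ x))) (encR (r₁ x)))
    have h1 := h0.fst.fst.fst
    have h2 := h0.fst.fst.snd
    have h3 := h0.fst.snd
    have h4 := h0.snd
    refine Cmp.congr (X := fun x : Ω' => encR (if x.2.1.1.1.tag = 4 then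
        ((r₁ x).1, (r₁ x).2 ++ (r₂ x).2)
      else if x.2.1.1.1.tag = 2 then (.or (r₁ x).1 (r₂ x).1,
        (r₁ x).2.map (Step.orL (r₂ x).1) ++ (r₂ x).2.map (Step.orR x.2.1.1.2.L))
      else (.and (r₁ x).1 (r₂ x).1,
        (r₁ x).2.map (Step.andL (r₂ x).1) ++ (r₂ x).2.map (Step.andR x.2.1.1.2.L))))
      inferInstance ?_
    rintro ⟨ω, ⟨⟨D, F⟩, hi⟩, hD⟩
    cases D with
    | id => exact absurd (Or.inl rfl) hD
    | rule => exact absurd (Or.inr rfl) hD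
    | _ => rfl
  · rintro ω ⟨⟨D, F⟩, hi⟩ hn
    cases D <;> simp [OD.tag, OD.left, OD.right, OD.len] at hn ⊢
  · rintro ω ⟨⟨D, F⟩, hi⟩
    have h1 := OD.enc_size_le (B := A ω) D
    have h2 := F.size_encode.2
    dsimp only at hi
    simp only [Tree.size]
    omega
  · rintro ω ⟨⟨D, F⟩, hi⟩
    have h1 := size_run (hp ω) D F
    have h2 := run_steps (hp ω) (hQ' ω) D F hi
    have h3 := encL_size_le Step.encode (run (h ω) D F).2 _ h2.2
    have h4 := (run (h ω) D F).1.size_encode.2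
    dsimp only at hi
    have h5 : (run (h ω) D F).2.length * (Q ω + 30 * (F.size + 3 * D.len) + 1) ≤
        (m ω * Q ω) * (Q ω + 30 * m ω + 1) :=
      Nat.mul_le_mul (h2.1.trans (Nat.mul_le_mul_right _ (by omega))) (by omega)
    simp only [encR, Tree.size]
    omega
  · rintro ω ⟨⟨D, F⟩, hi⟩
    dsimp only at hi ⊢
    omega

end
end DeepInference

/-! ### Growth of premisses, and assembly of the algorithm. -/

namespace DeepInference

section
variable {B : Type u}

/-- Splitting a unit or atom into its parts duplicates it, a gain of one. Medial splits three times,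
which accounts for the 3. -/
theorem size_up (i : Lin) (F : Formula B) : (i.up F).size ≤ F.size + 3 := by
  have h := F.size_LR
  have h1 := F.L.size_LR
  have h2 := F.R.size_LR
  have := F.size_pos
  cases i <;> simp only [Lin.up, Formula.size] <;> omega

theorem size_hRaw (ρ : Rul) (F : Formula B) : (hRaw ρ F).1.size ≤ F.size + 3 := by
  have := F.size_pos
  have := F.size_LR
  cases ρ with
  | lin i => exact size_up i F
  | ac =>
    simp only [hRaw]
    split
    · rename_i h
      have : F.size = 1 := by cases F <;> simp [Formula.tag, Formula.size] at h ⊢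
      simp only [single, Formula.size]; omega
    · simp
  | _ => simp only [hRaw, single, Formula.size] <;> omega

theorem L_and (α β : Formula B) : (Formula.and α β).L = α := rfl

theorem size_prem (ρ : Rul) (F : Formula B) : (prem ρ F).size ≤ F.size + 3 := by
  have := F.size_pos
  have := F.size_LR
  cases ρ with
  | lin i => exact size_up i F
  | ac =>
    simp only [prem, patch]
    split
    · simp [run, hRaw, single, Lin.up, Formula.size]
    · exact size_hRaw .ac F
  | acu =>
    simp only [prem, patch]
    split_ifs <;> simp only [run, hRaw, single, Lin.up, L_and] <;> omega
  | _ => simp only [prem, patch, run, Formula.size] <;> omega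

end

section
variable {Ω : Type v} {A : Ω → Type u} [∀ ω, Atoms (A ω)] {b : ∀ ω, Tree (A ω)}

theorem cmp_hRaw (ρ : Rul) {F : ∀ ω, Formula (A ω)} [Cmp b fun ω => (F ω).encode] :
    Cmp b fun ω => encR (hRaw ρ (F ω)) := by
  cases ρ with
  | lin i => simp only [hRaw, single]; infer_instance
  | _ => simp only [hRaw, single]; infer_instance

instance cmp_patch (ρ : Rul) {F : ∀ ω, Formula (A ω)} [Cmp b fun ω => (F ω).encode] :
    Cmp b fun ω => (patch ρ (F ω)).enc := by
  cases ρ <;> simp only [patch] <;> infer_instance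

/-- The patch of a rule is itself a term, expanded by a second use of `cmp_run` with the handler
`hRaw`. -/
theorem cmp_hFull (ρ : Rul) {F : ∀ ω, Formula (A ω)} [Cmp b fun ω => (F ω).encode] :
    Cmp b fun ω => encR (hFull ρ (F ω)) := by
  have h := cmp_run (b := b) (h := fun _ => hRaw) (fun _ => size_hRaw)
    (fun σ => cmp_hRaw (b := fun x : Σ ω, Formula (A ω) => x.2.encode) σ (F := fun x => x.2))
    (D := fun ω => patch ρ (F ω)) (F := F)
  have h' : Cmp b fun ω => (prem ρ (F ω)).encode := by
    cases ρ <;> simp only [prem] <;> infer_instance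
  simp only [hFull]
  infer_instance

/-- The derivation in analytic `SKS` that is extracted from the steps of a proof in `SKS`. -/
noncomputable def analytic {B : Type u} [Atoms B] (L : List (Step B)) : List (Step B) :=
  (run hFull (whole (collect L) (concl L) L (L.length + 2)) (concl L)).2

theorem cmp_analytic {L : ∀ ω, List (Step (A ω))} (hL : ∀ ω, Bal (collect (L ω)))
    [h : Cmp b fun ω => encL Step.encode (L ω)] :
    Cmp b fun ω => encL Step.encode (analytic (L ω)) := by
  have := cmp_length (b := b) (e := fun _ => Step.encode) (l := L)
  have := cmp_whole (b := b) (V := fun ω => collect (L ω)) (α := fun ω => concl (L ω)) (L := L)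
    (n := fun ω => (L ω).length + 2) hL
  have := cmp_run (b := b) (h := fun _ => hFull) (fun _ => size_prem)
    (fun σ => cmp_hFull (b := fun x : Σ ω, Formula (A ω) => x.2.encode) σ (F := fun x => x.2))
    (D := fun ω => whole (collect (L ω)) (concl (L ω)) (L ω) ((L ω).length + 2))
    (F := fun ω => concl (L ω))
  unfold analytic
  infer_instance

end

/-! ### The main result -/

section
variable {B : Type u} [Atoms B]

theorem IsChain.instances {S : Set Rule} {L : List (Step B)} {α β : Formula B}
    (h : IsChain S α L β) : ∀ s ∈ L, Instance s.rule s.upper s.lower := by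
  induction L generalizing α with
  | nil => simp
  | cons s L ih =>
    intro r hr
    rcases List.mem_cons.1 hr with rfl | hr
    · exact h.2.1
    · exact ih h.2.2.2 r hr

/-- The collection has at most one leaf more than the proof has steps, so the threshold `L.length +
2` is out of reach, as `der_whole` requires. -/
theorem analytic_spec {S : Set Rule} {L : List (Step B)} {α : Formula B} (h : IsChain S .tt L α) :
    IsChain aSKS .tt (analytic L) α := by
  have h1 := collect_spec h.instances
  have h2 := collect_size h.instances
  have h3 := der_whole h h1.2.2 h1.2.1 (n := L.length + 2) (by omega)
  unfold analytic
  rw [concl_eq h]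
  exact run_hFull h3

/-- Each node of a context comes with a side formula of positive size, which pays for the tag. -/
theorem size_context_le (ξ : Context B) (γ : Formula B) :
    ξ.encode.size + 8 ≤ 20 * (ξ.fill γ).size ∧ γ.size ≤ (ξ.fill γ).size := by
  have hγ := γ.size_pos
  induction ξ with
  | hole => simp only [Context.encode, Context.fill, Tree.size_tagged, Tree.size]; omega
  | orLeft ξ β ih | orRight β ξ ih | andLeft ξ β ih | andRight β ξ ih =>
    have := β.size_encode.2
    simp only [Context.encode, Context.fill, Tree.size_tagged, Tree.size, Formula.size]
    omega

theorem size_step_le (s : Step B) :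
    s.encode.size ≤ 60 * (s.premiss.size + s.conclusion.size) := by
  have h1 := size_context_le s.context s.upper
  have h2 := size_context_le s.context s.lower
  have h3 := s.upper.size_encode.2
  have h4 := s.lower.size_encode.2
  have h5 : (s.rule.encode : Tree B).size ≤ 17 := by
    cases s.rule <;> simp [Rule.encode, Tree.size_num]
  simp only [Step.encode, Tree.size, Step.premiss, Step.conclusion]
  omega

/-- A step is charged to its premiss and its conclusion. Each formula of the chain is thus charged
at most twice, so the input tree is linear in the size of the derivation. -/
theorem IsChain.size_encode {S : Set Rule} {L : List (Step B)} {α β : Formula B}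
    (h : IsChain S α L β) :
    (encodeSteps L).size ≤ 61 * (α.size + 2 * (L.map fun s => s.conclusion.size).sum) := by
  induction L generalizing α with
  | nil => have := α.size_pos; simp only [encodeSteps, Tree.size]; omega
  | cons s L ih =>
    have h1 := size_step_le s
    have h2 := ih h.2.2.2
    have h3 := α.size_pos
    rw [h.2.2.1] at h1
    simp only [encodeSteps, Tree.size, List.map_cons, List.sum_cons]
    omega

theorem IsProof.size_encode {S : Set Rule} {α : Formula B} {P : Derivation B}
    (h : IsProof S α P) : P.encode.size ≤ 200 * P.size := by
  have h1 := h.2.size_encode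
  have h2 := P.premiss.size_encode.2
  have h3 := h.1
  simp only [Derivation.encode, Tree.size, Derivation.size]
  rw [h3] at h2 ⊢
  omega

end

/-- A proof in `SKS`, with its set of atoms and its conclusion. -/
structure SKSProof : Type (u + 1) where
  A : Type u
  atoms : Atoms A
  α : Formula A
  P : Derivation A
  isProof : IsProof SKS α P

instance SKSProof.instAtoms (ω : SKSProof.{u}) : Atoms ω.A := ω.atoms

/-- The index ranges over proofs together with their sets of atoms, so a single program and a single
bound serve all sets of atoms. -/
theorem cmp_main : Cmp (Ω := SKSProof.{u}) (fun ω => ω.P.encode)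
    fun ω => (Derivation.mk .tt (analytic ω.P.steps)).encode := by
  have h : Cmp (Ω := SKSProof.{u}) (fun ω => ω.P.encode) fun ω => encL Step.encode ω.P.steps :=
    (Cmp.refl.op .tail).congr fun ω => encodeSteps_eq _
  have h' := cmp_analytic (b := fun ω : SKSProof.{u} => ω.P.encode) (L := fun ω => ω.P.steps)
    fun ω => (collect_size ω.isProof.2.instances).1
  exact Cmp.congr (X := fun ω => .pair Formula.tt.encode (encL Step.encode (analytic ω.P.steps)))
    inferInstance fun ω => by simp only [Derivation.encode, encodeSteps_eq]

end DeepInference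

/-- There is an algorithm that transforms each proof `P` of a formula `α` in `SKS` into a proof of
`α` in `aSKS`, in time quasipolynomial in the size of `P`. -/
theorem mainTheorem1 :
    ∃ (N : DeepInference.Prog) (q : ℕ → ℕ), DeepInference.IsQuasipolynomial q ∧
      ∀ (A : Type u) [DeepInference.Atoms A] (α : DeepInference.Formula A)
        (P : DeepInference.Derivation A), DeepInference.IsProof DeepInference.SKS α P →
        ∃ (P' : DeepInference.Derivation A) (t : ℕ),
          N.HaltsWith P.encode P'.encode t ∧ t ≤ q P.size ∧
            DeepInference.IsProof DeepInference.aSKS α P' := by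
  obtain ⟨N, q, hq, h⟩ := DeepInference.cmp_main.{u}.out
  -- The factor 200 converts the size of the derivation into the size of its encoding, by
  -- `IsProof.size_encode`.
  refine ⟨N, fun n => q (200 * n),
    (hq.comp ((DeepInference.QB.const 200).mul DeepInference.QB.id)).quasi, ?_⟩
  intro A hA α P hP
  obtain ⟨t, ht, hN⟩ := h ⟨A, hA, α, P, hP⟩ N
  exact ⟨_, t, hN, ht.trans (hq.mono hP.size_encode), rfl, DeepInference.analytic_spec hP.2⟩
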